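/- Let $A>0$ and let $g\in C^\infty(\mathbb R\times[0,A];\mathbb C)$, written $g(x,\alpha)$, satisfy, for some $C_0>0$ and all $(x,\alpha)\in\mathbb R\times[0,A]$, $$\operatorname{Im} g(x,\alpha)\ \ge\ \frac{x^2}{C_0}-C_0,\qquad |g(x,\alpha)|\le C_0(x^2+1).$$ For each $h\in(0,1]$ let $g_*(\cdot,\cdot;h)\in C^\infty(\mathbb R\times[0,A];\mathbb C)$, and suppose that $g_*\sim g_*^0+hg_*^1+h^2g_*^2+\cdots$ with $g_*^j\in C_0^\infty(\mathbb R\times[0,A])$, in the sense that for every $N$ all the $(x,\alpha)$-derivatives of $g_*-\sum_{j<N}h^jg_*^j$ are $O(h^N)$ uniformly on $\mathbb R\times[0,A]$, $h\in(0,1]$. Assume moreover that $\operatorname{Im} g(x,0)>0$ for $x\ne0$ and that $$g(0,0)=0,\qquad g'_\alpha(0,0)=-i,\qquad g'_x(0,0)=0,\qquad \operatorname{Im} g''_{xx}(0,0)>0 .$$ On $L^2(\mathbb R)$ consider, with $D_x=\frac1i\frac{d}{dx}$, $$P_\alpha=hD_x+g(x,\alpha)+h^2g_*(x,\alpha;h),\qquad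 \text{with domain } H_{sc}(\mathbb R)=\{u\in L^2:\ x^2u\in L^2,\ hD_xu\in L^2\},$$ let $p_\alpha(x,\xi)=\xi+g(x,\alpha)$ on $\mathbb R^2$, and $\{a,b\}=a'_\xi b'_x-a'_xb'_\xi$. Then: 1. For all $\alpha\in[0,A]$ and $h\in(0,1]$ the operator $P_\alpha:H_{sc}(\mathbb R)\to L^2(\mathbb R)$ is well defined and bijective, and $P_\alpha^{-1}$ is bounded on $L^2(\mathbb R)$. There are $\varepsilon\in(0,A]$ and $C>0$, independent of $\alpha$ and $h$, such that for all $0<\alpha\le\varepsilon$: 2. $p_\alpha^{-1}(0)=\{\rho_+,\rho_-\}$ with $\rho_\pm=\rho_\pm(\alpha)=(x_\pm(\alpha),\xi_\pm(\alpha))$, where $\mp\operatorname{Im}g'_x(x_\pm,\alpha)>0$ and $\pm\frac1{2i}\{p_\alpha,\overline{p_\alpha}\}(\rho_\pm)>0$. Moreover $\{p_0,\frac1{2i}\{p_0,\overline{p_0}\}\}(0,0)<0$ and $$\left|x_\pm(\alpha)\pm\alpha^{1/2}\left(\frac{-2}{\{p_0,\frac1{2i}\{p_0,\overline{p_0}\}\}(0,0)}\right)^{1/2}\right|\le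 C\alpha .$$ 3. With $\ell_0(\alpha)=-\int_{x_+(\alpha)}^{x_-(\alpha)}g(y,\alpha)\,dy$, $$\tfrac1C\alpha^{3/2}\le\operatorname{Im}\ell_0(\alpha)\le C\alpha^{3/2},\qquad \tfrac1C\alpha^{1/2}\le\left|\tfrac12\{p_\alpha,\overline{p_\alpha}\}(\rho_\pm)\right|\le C\alpha^{1/2}.$$ 4. For all $h\in(0,1]$ with $h\le\varepsilon\alpha^{3/2}$, $$\|P_\alpha^{-1}\|=\frac{\sqrt\pi\,\exp\left(\frac1h\operatorname{Im}\ell_0(\alpha)\right)}{h^{1/2}\left(\frac1{2i}\{p_\alpha,\overline{p_\alpha}\}(\rho_+)\right)^{1/4}\left(\frac1{2i}\{\overline{p_\alpha},p_\alpha\}(\rho_-)\right)^{1/4}}\,(1+r)+s,\qquad |r|\le C\,\frac{h}{\alpha^{3/2}},\quad |s|\le\frac{C}{h^{1/2}\alpha^{1/4}} .$$ -/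

import Mathlib

open MeasureTheory Set
open scoped ContDiff

/-- The Hilbert space `L²(ℝ)` of complex valued functions (Lebesgue measure). -/
abbrev L2 : Type := Lp ℂ 2 (volume : Measure ℝ)

/-- `w` is the derivative of `u` in the sense of distributions. Real test functions suffice, by
linearity. -/
def IsWeakDeriv (u w : L2) : Prop :=
  ∀ φ : ℝ → ℝ, ContDiff ℝ ∞ φ → HasCompactSupport φ →
    ∫ x, deriv φ x • u x = - ∫ x, φ x • w x

theorem L2.integrable_smul (u : L2) {φ : ℝ → ℝ} (hc : Continuous φ) (hs : HasCompactSupport φ) :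
    Integrable (fun x => φ x • u x) :=
  ((Lp.memLp u).locallyIntegrable (by norm_num)).integrable_smul_left_of_hasCompactSupport hc hs

theorem IsWeakDeriv.unique {u w w' : L2} (h : IsWeakDeriv u w) (h' : IsWeakDeriv u w') :
    w = w' := by
  apply Lp.ext
  refine ae_eq_of_integral_contDiff_smul_eq ((Lp.memLp w).locallyIntegrable (by norm_num))
    ((Lp.memLp w').locallyIntegrable (by norm_num)) fun φ hφ hs => ?_
  have h1 := h φ hφ hs
  have h2 := h' φ hφ hs
  rw [h1] at h2
  exact neg_injective h2

theorem IsWeakDeriv.add {u w u' w' : L2} (h : IsWeakDeriv u w) (h' : IsWeakDeriv u' w') :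
    IsWeakDeriv (u + u') (w + w') := by
  intro φ hφ hs
  have key : ∀ (ψ : ℝ → ℝ) (a b : L2), Continuous ψ → HasCompactSupport ψ →
      ∫ x, ψ x • (a + b : L2) x = (∫ x, ψ x • a x) + ∫ x, ψ x • b x := by
    intro ψ a b hc hs
    rw [← integral_add (a.integrable_smul hc hs) (b.integrable_smul hc hs)]
    refine integral_congr_ae ?_
    filter_upwards [Lp.coeFn_add a b] with x hx
    rw [hx, Pi.add_apply, smul_add]
  have hd : Continuous (deriv φ) := hφ.continuous_deriv (by norm_num)
  rw [key _ _ _ hd hs.deriv, key _ _ _ hφ.continuous hs, h φ hφ hs, h' φ hφ hs, neg_add]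

theorem IsWeakDeriv.smul {u w : L2} (c : ℂ) (h : IsWeakDeriv u w) :
    IsWeakDeriv (c • u) (c • w) := by
  intro φ hφ hs
  have key : ∀ (ψ : ℝ → ℝ) (a : L2),
      ∫ x, ψ x • (c • a : L2) x = c • ∫ x, ψ x • a x := by
    intro ψ a
    rw [← integral_smul]
    refine integral_congr_ae ?_
    filter_upwards [Lp.coeFn_smul c a] with x hx
    rw [hx, Pi.smul_apply, smul_comm]
  rw [key, key, h φ hφ hs, smul_neg]

/-- The functions `u ∈ L²(ℝ)` with `m u ∈ L²(ℝ)`: the maximal domain of multiplication by `m`. -/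
noncomputable def mulDomain (m : ℝ → ℂ) : Submodule ℂ L2 where
  carrier := {u | MemLp (fun x => m x * u x) 2 volume}
  zero_mem' := by
    refine (memLp_congr_ae ?_).mpr (MemLp.zero : MemLp (0 : ℝ → ℂ) 2 volume)
    filter_upwards [Lp.coeFn_zero ℂ 2 (volume : Measure ℝ)] with x hx
    rw [hx]; simp
  add_mem' := by
    intro u v hu hv
    refine (memLp_congr_ae ?_).mpr (MemLp.add hu hv)
    filter_upwards [Lp.coeFn_add u v] with x hx
    rw [hx]; simp [mul_add]
  smul_mem' := by
    intro c u hu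
    refine (memLp_congr_ae ?_).mpr (MemLp.const_smul hu c)
    filter_upwards [Lp.coeFn_smul c u] with x hx
    rw [hx]; simp [mul_left_comm]

/-- The functions `u ∈ L²(ℝ)` whose distributional derivative belongs to `L²(ℝ)`. -/
noncomputable def weakDerivDomain : Submodule ℂ L2 where
  carrier := {u | ∃ w, IsWeakDeriv u w}
  zero_mem' := by
    refine ⟨(0 : ℂ) • 0, ?_⟩
    intro φ _ _
    have h0 := Lp.coeFn_zero ℂ 2 (volume : Measure ℝ)
    have key : ∀ ψ : ℝ → ℝ, ∫ x, ψ x • (0 : L2) x = 0 := by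
      intro ψ
      rw [← integral_zero ℝ ℂ]
      refine integral_congr_ae ?_
      filter_upwards [h0] with x hx
      rw [hx]; simp
    rw [smul_zero, key, key, neg_zero]
  add_mem' := by
    rintro u v ⟨w, hw⟩ ⟨z, hz⟩
    exact ⟨w + z, hw.add hz⟩
  smul_mem' := by
    rintro c u ⟨w, hw⟩
    exact ⟨c • w, hw.smul c⟩

/-- The space `H_sc(ℝ) = {u ∈ L² : x² u ∈ L², h D_x u ∈ L²}`; as a set it is the same for all
`h > 0`. -/
noncomputable def Hsc : Submodule ℂ L2 := mulDomain (fun x => (x : ℂ) ^ 2) ⊓ weakDerivDomain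

/-- The distributional derivative, as a linear map with values in `L²(ℝ)`. -/
noncomputable def weakDeriv : weakDerivDomain →ₗ[ℂ] L2 where
  toFun u := Classical.choose u.2
  map_add' u v :=
    (Classical.choose_spec (u + v).2).unique
      ((Classical.choose_spec u.2).add (Classical.choose_spec v.2))
  map_smul' c u :=
    (Classical.choose_spec (c • u).2).unique ((Classical.choose_spec u.2).smul c)

/-- Multiplication by `m`, on its maximal domain. -/
noncomputable def mulOp (m : ℝ → ℂ) : mulDomain m →ₗ[ℂ] L2 where
  toFun u := MemLp.toLp (fun x => m x * (u : L2) x) u.2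
  map_add' u v := by
    apply Lp.ext
    have h1 := MemLp.coeFn_toLp (u + v).2
    have h2 := MemLp.coeFn_toLp u.2
    have h3 := MemLp.coeFn_toLp v.2
    filter_upwards [h1, h2, h3, Lp.coeFn_add (u : L2) (v : L2),
      Lp.coeFn_add (MemLp.toLp _ u.2) (MemLp.toLp _ v.2)] with x e1 e2 e3 e4 e5
    rw [e1, e5, Pi.add_apply, e2, e3, Submodule.coe_add, e4, Pi.add_apply, mul_add]
  map_smul' c u := by
    apply Lp.ext
    have h1 := MemLp.coeFn_toLp (c • u).2
    have h2 := MemLp.coeFn_toLp u.2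
    filter_upwards [h1, h2, Lp.coeFn_smul c (u : L2),
      Lp.coeFn_smul c (MemLp.toLp _ u.2)] with x e1 e2 e4 e5
    rw [e1, RingHom.id_apply, e5, Pi.smul_apply, e2, Submodule.coe_smul, e4, Pi.smul_apply,
      smul_eq_mul, smul_eq_mul, mul_left_comm]

/-- The unbounded operator `h D_x + m` on `L²(ℝ)`, where `D_x = -i d/dx`, on the domain of all
`u ∈ H_sc(ℝ)` with `m u ∈ L²(ℝ)`. This is all of `H_sc(ℝ)` if `m = O(x² + 1)` is measurable. -/
noncomputable def modelOp (h : ℝ) (m : ℝ → ℂ) : L2 →ₗ.[ℂ] L2 where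
  domain := Hsc ⊓ mulDomain m
  toFun := ((h : ℂ) / Complex.I) •
      weakDeriv ∘ₗ Submodule.inclusion (inf_le_left.trans inf_le_right)
    + mulOp m ∘ₗ Submodule.inclusion inf_le_right

/-- The bounded operator `R` is the (two-sided) inverse of the unbounded operator `T`. -/
def IsBoundedInverse (T : L2 →ₗ.[ℂ] L2) (R : L2 →L[ℂ] L2) : Prop :=
  (∀ v, ∃ hv : R v ∈ T.domain, T ⟨R v, hv⟩ = v) ∧ ∀ u : T.domain, R (T u) = u

/-- The Poisson bracket `{a, b} = a'_ξ b'_x - a'_x b'_ξ` at a point `ρ = (x, ξ)`. -/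
noncomputable def poisson (a b : ℝ × ℝ → ℂ) (ρ : ℝ × ℝ) : ℂ :=
  fderiv ℝ a ρ (0, 1) * fderiv ℝ b ρ (1, 0) - fderiv ℝ a ρ (1, 0) * fderiv ℝ b ρ (0, 1)

/-- The function `(1/2i) {a, b}` on phase space. -/
noncomputable def poissonHalfI (a b : ℝ × ℝ → ℂ) (ρ : ℝ × ℝ) : ℂ :=
  1 / (2 * Complex.I) * poisson a b ρ

/-- The principal symbol `p_α(x, ξ) = ξ + g(x, α)`. -/
def symb (g : ℝ → ℝ → ℂ) (α : ℝ) (ρ : ℝ × ℝ) : ℂ := (ρ.2 : ℂ) + g ρ.1 α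

/-- The complex conjugate of the principal symbol. -/
noncomputable def symbConj (g : ℝ → ℝ → ℂ) (α : ℝ) (ρ : ℝ × ℝ) : ℂ :=
  (starRingEnd ℂ) (symb g α ρ)

/-- The closed strip `ℝ × [0, A]` of points `(x, α)`. -/
def strip (A : ℝ) : Set (ℝ × ℝ) := univ ×ˢ Icc 0 A

/-- `f(x, α; h) ~ a₀(x, α) + h a₁(x, α) + h² a₂(x, α) + ⋯` as `h → 0`, where the `a_j` are smooth on
`ℝ × [0, A]` with compact support, and every remainder after `N` terms is `O(h^N)`, `h ∈ (0, 1]`,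
uniformly on `ℝ × [0, A]` together with all its derivatives in `(x, α)`. -/
def HasSmoothExpansion (A : ℝ) (f : ℝ → ℝ → ℝ → ℂ) (a : ℕ → ℝ → ℝ → ℂ) : Prop :=
  (∀ j, ContDiffOn ℝ ∞ (fun q : ℝ × ℝ => a j q.1 q.2) (strip A)) ∧
  (∀ j, ∃ K : ℝ, ∀ x, ∀ α ∈ Icc 0 A, K < |x| → a j x α = 0) ∧
  ∀ N k : ℕ, ∃ C : ℝ, ∀ h ∈ Ioc (0 : ℝ) 1, ∀ q ∈ strip A,
    ‖iteratedFDerivWithin ℝ k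
      (fun q : ℝ × ℝ => f q.1 q.2 h - ∑ j ∈ Finset.range N, (h : ℂ) ^ j * a j q.1 q.2)
      (strip A) q‖ ≤ C * h ^ N

/-- The action `ℓ₀ = -∫_{x₊}^{x₋} g(y, α) dy`. -/
noncomputable def action (g : ℝ → ℝ → ℂ) (α xp xm : ℝ) : ℂ := - ∫ y in xp..xm, g y α

/-- The leading term
`√π exp(Im ℓ₀ / h) / (h^{1/2} ((1/2i){p, p̄}(ρ₊))^{1/4} ((1/2i){p̄, p}(ρ₋))^{1/4})`. The two brackets
are real valued functions on phase space. -/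
noncomputable def leadingTerm (g : ℝ → ℝ → ℂ) (α h : ℝ) (ρp ρm : ℝ × ℝ) : ℝ :=
  Real.sqrt Real.pi * Real.exp ((action g α ρp.1 ρm.1).im / h) /
    (h ^ (1 / 2 : ℝ) * (poissonHalfI (symb g α) (symbConj g α) ρp).re ^ (1 / 4 : ℝ) *
      (poissonHalfI (symbConj g α) (symb g α) ρm).re ^ (1 / 4 : ℝ))

/-! With `m = g + h² g_*`, the operator `h D_x + m` is of first order on the line and can be
inverted by hand: its inverse has the kernel `-(i/h) exp((i/h) ∫_x^y m)` for `y > x`, and `0` for `y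
< x`. The modulus of this kernel is `(1/h) exp(-(1/h) ∫_x^y Im m)`. Quadratic growth of `Im m` makes
it decay fast enough for Schur's test, even after multiplication by `x²`, and this gives bijectivity
from `H_sc` for every `α` and `h` (`Confining.exists_isBoundedInverse`).

For small `α = s²` the function `Im g(·, α)` is negative exactly between two zeros `x₊ < 0 < x₋`,
which lie at distance about `s` from `0` and where the slope has size about `s`. Hence `-∫_x^y Im g`
is largest at `x = x₊`, `y = x₋`, with value `Im ℓ₀` of order `s³`. Cut the line at `0`. For `x < 0
< y` the kernel is a function of `x` times a function of `y`, so this block has rank one and its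
norm is exactly `(1/h) √(I J)`, where `I` and `J` are the integrals of `exp(±(2/h) ∫₀ˣ Im m)` over
the two half lines. It bounds the norm of the inverse from below (`Confining.le_norm_inverse`). The
blocks with `x` and `y` on the same side see only one of the two parts of the action and are smaller
by a factor that is exponentially small in `s³/h`, up to powers of `s` and `h`
(`Confining.norm_inverse_le`).

The integrals `I` and `J` are evaluated by Laplace's method at `x₊` and `x₋`, with relative error
`O(h/s³)` uniformly in `s` (`LeftWell.exists_laplace`): the cubic Taylor term is odd and integrates
to zero, and near the wells `h² g_*` moves the exponent by `O(h)` only. The square root of the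
product is the leading term (`tunnelTerm_eq`). The exponentially small blocks fit into the same
relative error, so the additive remainder can be taken to be `0`.

Uniformity in `α` comes from `exists_wellData`, which compares `Im g(·, α)` with its values at `α =
0`, and from `exists_leftWell`, where strong convexity near `0` produces the zeros and all
constants. The brackets are `∓ 2i Im g'_x`, so the statements about them are statements about the
slopes at the two zeros. -/

/-! ### Schur's test and exponential kernels -/

open scoped ENNReal in
/-- Schur's test, for nonnegative kernels. -/
theorem lintegral_sq_kernel_le {X Y : Type*} [MeasurableSpace X] [MeasurableSpace Y]
    {μ : Measure X} {ν : Measure Y} [SFinite μ] [SFinite ν] {k : X → Y → ℝ≥0∞}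
    (hk : Measurable (Function.uncurry k)) {a b : ℝ≥0∞} (ha : ∀ x, ∫⁻ y, k x y ∂ν ≤ a)
    (hb : ∀ y, ∫⁻ x, k x y ∂μ ≤ b) {f : Y → ℝ≥0∞} (hf : Measurable f) :
    ∫⁻ x, (∫⁻ y, k x y * f y ∂ν) ^ 2 ∂μ ≤ a * b * ∫⁻ y, f y ^ 2 ∂ν := by
  have cs : ∀ x, (∫⁻ y, k x y * f y ∂ν) ^ 2 ≤ a * ∫⁻ y, k x y * f y ^ 2 ∂ν := by
    intro x
    have hkx : Measurable (k x) := hk.of_uncurry_left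
    have h2 : ∀ z : ℝ≥0∞, (z ^ (1 / 2 : ℝ)) ^ 2 = z := fun z => by
      rw [← ENNReal.rpow_natCast, ← ENNReal.rpow_mul]; norm_num
    -- Cauchy–Schwarz with the kernel split as `k = k^{1/2} · k^{1/2}`.
    have hh := ENNReal.lintegral_mul_le_Lp_mul_Lq ν Real.HolderConjugate.two_two
      (f := fun y => k x y ^ (1 / 2 : ℝ)) (g := fun y => k x y ^ (1 / 2 : ℝ) * f y)
      (hkx.pow_const _).aemeasurable ((hkx.pow_const _).mul hf).aemeasurable
    have e1 : ∀ y, (((fun y => k x y ^ (1 / 2 : ℝ)) * fun y => k x y ^ (1 / 2 : ℝ) * f y) : _) y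
        = k x y * f y := by
      intro y
      simp only [Pi.mul_apply]
      rw [← mul_assoc, ← sq, h2]
    simp only [e1] at hh
    have e2 : ∀ y, (k x y ^ (1 / 2 : ℝ)) ^ (2 : ℝ) = k x y := fun y => by
      rw [← ENNReal.rpow_mul]; norm_num
    have e3 : ∀ y, (k x y ^ (1 / 2 : ℝ) * f y) ^ (2 : ℝ) = k x y * f y ^ 2 := fun y => by
      rw [ENNReal.mul_rpow_of_nonneg _ _ (by norm_num), e2]
      congr 1
      exact ENNReal.rpow_two _
    simp only [e2, e3] at hh
    calc (∫⁻ y, k x y * f y ∂ν) ^ 2 ≤ _ := pow_le_pow_left' hh 2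
      _ = (∫⁻ y, k x y ∂ν) * ∫⁻ y, k x y * f y ^ 2 ∂ν := by rw [mul_pow, h2, h2]
      _ ≤ _ := by gcongr; exact ha x
  have hm : Measurable (Function.uncurry fun x y => k x y * f y ^ 2) :=
    hk.mul ((hf.pow_const 2).comp measurable_snd)
  calc ∫⁻ x, (∫⁻ y, k x y * f y ∂ν) ^ 2 ∂μ ≤ ∫⁻ x, a * ∫⁻ y, k x y * f y ^ 2 ∂ν ∂μ :=
        lintegral_mono cs
    _ = a * ∫⁻ y, ∫⁻ x, k x y * f y ^ 2 ∂μ ∂ν := by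
        rw [lintegral_const_mul _ hm.lintegral_prod_right, lintegral_lintegral_swap hm.aemeasurable]
    _ ≤ a * ∫⁻ y, b * f y ^ 2 ∂ν := by
        gcongr with y
        rw [lintegral_mul_const _ hk.of_uncurry_right]
        gcongr
        exact hb y
    _ = _ := by rw [lintegral_const_mul _ (hf.pow_const 2), mul_assoc]

theorem eLpNorm_two_sq {X E : Type*} [MeasurableSpace X] [NormedAddCommGroup E] {μ : Measure X}
    (f : X → E) : eLpNorm f 2 μ ^ 2 = ∫⁻ x, ‖f x‖ₑ ^ 2 ∂μ := by
  have := eLpNorm_nnreal_pow_eq_lintegral (μ := μ) (f := f) (p := 2) (by norm_num)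
  simpa using this

open scoped ENNReal in
theorem eLpNorm_two_le {X E : Type*} [MeasurableSpace X] [NormedAddCommGroup E] {μ : Measure X}
    {f : X → E} {a : ℝ≥0∞} (h : ∫⁻ x, ‖f x‖ₑ ^ 2 ∂μ ≤ a ^ 2) : eLpNorm f 2 μ ≤ a := by
  rw [← eLpNorm_two_sq] at h
  exact (ENNReal.pow_le_pow_left_iff two_ne_zero).mp h

/-- The prefactor is the one that cancels the decay rate, so the bound is independent of `a`. This
permits `a = x²` and `a = y²`, including the value `0`. -/
theorem lintegral_Ioi_exp_le (x : ℝ) {a κ : ℝ} (ha : 0 ≤ a) (hκ : 0 < κ) :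
    ∫⁻ y in Ioi x, ENNReal.ofReal (a * Real.exp (-(κ * (a * (y - x))))) ≤
      ENNReal.ofReal (1 / κ) := by
  rcases ha.eq_or_lt with rfl | ha
  · simp
  have e : ∀ y, a * Real.exp (-(κ * (a * (y - x)))) =
      (a * Real.exp (κ * a * x)) * Real.exp (-(κ * a) * y) := fun y => by
    rw [mul_assoc, ← Real.exp_add]; ring_nf
  have hn : -(κ * a) < 0 := by have := mul_pos hκ ha; linarith
  rw [← ofReal_integral_eq_lintegral_ofReal]
  · apply ENNReal.ofReal_le_ofReal
    simp_rw [e]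
    rw [integral_const_mul, integral_exp_mul_Ioi hn, mul_assoc, mul_div_assoc', mul_neg,
      ← Real.exp_add]
    apply le_of_eq
    have : κ * a * x + -(κ * a) * x = 0 := by ring
    rw [this, Real.exp_zero]
    field_simp
  · simp_rw [e]
    exact (integrableOn_exp_mul_Ioi hn x).const_mul _
  · exact Filter.Eventually.of_forall fun y => by positivity

theorem lintegral_Iio_exp_le (y : ℝ) {a κ : ℝ} (ha : 0 ≤ a) (hκ : 0 < κ) :
    ∫⁻ x in Iio y, ENNReal.ofReal (a * Real.exp (-(κ * (a * (y - x))))) ≤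
      ENNReal.ofReal (1 / κ) := by
  have h := lintegral_Ioi_exp_le (-y) ha hκ
  rw [← lintegral_indicator measurableSet_Ioi] at h
  rw [← lintegral_indicator measurableSet_Iio, ← (Measure.measurePreserving_neg volume).lintegral_comp_emb
    (MeasurableEquiv.neg ℝ).measurableEmbedding]
  refine le_trans (le_of_eq (lintegral_congr fun x => ?_)) h
  simp only [indicator, mem_Iio, mem_Ioi, neg_lt]
  ring_nf

/-- An operator whose kernel is dominated by `a e^{-κ (y - x)}` for `x < y` and vanishes for
`y < x`. -/
theorem eLpNorm_le_of_exp_kernel {κ : ℝ} (hκ : 0 < κ) {v u : ℝ → ℂ} (hv : StronglyMeasurable v)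
    {a : ℝ} (ha : 0 ≤ a)
    (hu : ∀ x, ‖u x‖ₑ ≤
      ∫⁻ y in Ioi x, ENNReal.ofReal (a * Real.exp (-(κ * (y - x)))) * ‖v y‖ₑ) :
    eLpNorm u 2 volume ≤ ENNReal.ofReal (a / κ) * eLpNorm v 2 volume := by
  apply eLpNorm_two_le
  let S : Set (ℝ × ℝ) := {p | p.1 < p.2}
  have hS : MeasurableSet S := measurableSet_lt measurable_fst measurable_snd
  let k : ℝ → ℝ → ENNReal := fun x y =>
    S.indicator (fun p => ENNReal.ofReal (a * Real.exp (-(κ * (p.2 - p.1))))) (x, y)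
  have hk : Measurable (Function.uncurry k) := by
    refine Measurable.indicator ?_ hS
    fun_prop
  have hrow : ∀ x, ∫⁻ y, k x y ≤ ENNReal.ofReal (a / κ) := by
    intro x
    have h := lintegral_Ioi_exp_le x (zero_le_one) hκ
    have : ∀ y, k x y = (Ioi x).indicator (fun y => ENNReal.ofReal a *
        ENNReal.ofReal (1 * Real.exp (-(κ * (1 * (y - x)))))) y := by
      intro y
      simp only [k, S, indicator, mem_ofPred_eq, mem_Ioi, one_mul, ← ENNReal.ofReal_mul ha]
    simp_rw [this]
    rw [lintegral_indicator measurableSet_Ioi, lintegral_const_mul _ (by fun_prop),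
      div_eq_mul_one_div, ENNReal.ofReal_mul ha]
    gcongr
  have hcol : ∀ y, ∫⁻ x, k x y ≤ ENNReal.ofReal (a / κ) := by
    intro y
    have h := lintegral_Iio_exp_le y (zero_le_one) hκ
    have : ∀ x, k x y = (Iio y).indicator (fun x => ENNReal.ofReal a *
        ENNReal.ofReal (1 * Real.exp (-(κ * (1 * (y - x)))))) x := by
      intro x
      simp only [k, S, indicator, mem_ofPred_eq, mem_Iio, one_mul, ← ENNReal.ofReal_mul ha]
    simp_rw [this]
    rw [lintegral_indicator measurableSet_Iio, lintegral_const_mul _ (by fun_prop),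
      div_eq_mul_one_div, ENNReal.ofReal_mul ha]
    gcongr
  calc ∫⁻ x, ‖u x‖ₑ ^ 2 ≤ ∫⁻ x, (∫⁻ y, k x y * ‖v y‖ₑ) ^ 2 := by
        gcongr with x
        refine (hu x).trans (le_of_eq ?_)
        rw [← lintegral_indicator measurableSet_Ioi]
        refine lintegral_congr fun y => ?_
        by_cases hxy : x < y <;> simp [k, S, hxy]
    _ ≤ _ := lintegral_sq_kernel_le hk hrow hcol hv.enorm
    _ = _ := by rw [← eLpNorm_two_sq]; ring

/-- An operator whose kernel is dominated by `a x² e^{-κ (1 + c x² + c y²)(y - x)}` for `x < y` and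
vanishes for `y < x`. -/
theorem eLpNorm_lt_top_of_sq_mul_exp_kernel {κ c : ℝ} (hκ : 0 < κ) (hc : 0 < c) {v u : ℝ → ℂ}
    (hv : StronglyMeasurable v) (hv2 : eLpNorm v 2 volume < ⊤) {a : ℝ} (ha : 0 ≤ a)
    (hu : ∀ x, ‖u x‖ₑ ≤ ∫⁻ y in Ioi x,
      ENNReal.ofReal (a * (x ^ 2 * Real.exp (-(κ * ((1 + c * x ^ 2 + c * y ^ 2) * (y - x)))))) *
        ‖v y‖ₑ) :
    eLpNorm u 2 volume < ⊤ := by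
  let S : Set (ℝ × ℝ) := {p | p.1 < p.2}
  have hS : MeasurableSet S := measurableSet_lt measurable_fst measurable_snd
  let k : ℝ → ℝ → ENNReal := fun x y =>
    S.indicator (fun p => ENNReal.ofReal (a * (p.1 ^ 2 *
      Real.exp (-(κ * ((1 + c * p.1 ^ 2 + c * p.2 ^ 2) * (p.2 - p.1))))))) (x, y)
  have hk : Measurable (Function.uncurry k) := by
    refine Measurable.indicator ?_ hS
    fun_prop
  have hκc : 0 < κ * c := mul_pos hκ hc
  have hrow : ∀ x, ∫⁻ y, k x y ≤ ENNReal.ofReal a * ENNReal.ofReal (1 / (κ * c)) := by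
    intro x
    -- In a row `x` is fixed, and the part `c x²` of the rate alone pays for the factor `x²`.
    refine le_trans ?_ (mul_le_mul_right (lintegral_Ioi_exp_le x (sq_nonneg x) hκc) _)
    rw [← lintegral_const_mul _ (by fun_prop), ← lintegral_indicator measurableSet_Ioi]
    refine lintegral_mono fun y => ?_
    by_cases hxy : x < y
    · simp only [k, S, indicator, mem_ofPred_eq, mem_Ioi, hxy, if_true, ← ENNReal.ofReal_mul ha]
      refine ENNReal.ofReal_le_ofReal ?_
      gcongr _ * (_ * Real.exp ?_)
      have h1 : 0 ≤ κ * (y - x) * (1 + c * y ^ 2) := by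
        have : 0 < y - x := by linarith
        positivity
      nlinarith
    · simp [k, S, hxy]
  -- In a column `x` varies. With `s = y - x`, `x² ≤ 2 y² + 2 s²`: the rate `c y²` pays for `y²`,
  -- and half of the constant rate pays for `s²` through `s² e^{-κ s/2} ≤ 8/κ²`, leaving the other
  -- half for integrability.
  have hcol : ∀ y, ∫⁻ x, k x y ≤ ENNReal.ofReal a * (ENNReal.ofReal 2 *
      ENNReal.ofReal (1 / (κ * c)) + ENNReal.ofReal (16 / κ ^ 2) *
        ENNReal.ofReal (1 / (κ / 2))) := by
    intro y
    refine le_trans ?_ (mul_le_mul_right (add_le_add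
      (mul_le_mul_right (lintegral_Iio_exp_le y (sq_nonneg y) hκc) _)
      (mul_le_mul_right (lintegral_Iio_exp_le y zero_le_one (half_pos hκ)) _)) _)
    rw [← lintegral_const_mul _ (by fun_prop), ← lintegral_const_mul _ (by fun_prop),
      ← lintegral_add_left (by fun_prop), ← lintegral_const_mul _ (by fun_prop),
      ← lintegral_indicator measurableSet_Iio]
    refine lintegral_mono fun x => ?_
    by_cases hxy : x < y
    · simp only [k, S, indicator, mem_ofPred_eq, mem_Iio, hxy, if_true]
      rw [← ENNReal.ofReal_mul (by positivity), ← ENNReal.ofReal_mul (by positivity),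
        ← ENNReal.ofReal_add (by positivity) (by positivity), ← ENNReal.ofReal_mul ha]
      refine ENNReal.ofReal_le_ofReal ?_
      refine mul_le_mul_of_nonneg_left ?_ ha
      obtain ⟨s, rfl⟩ : ∃ s, x = y - s := ⟨y - x, by ring⟩
      have hs : 0 < s := by linarith
      have e : y - (y - s) = s := by ring
      rw [e, one_mul, one_mul]
      have h1 : Real.exp (-(κ * ((1 + c * (y - s) ^ 2 + c * y ^ 2) * s))) ≤
          Real.exp (-(κ * c * (y ^ 2 * s))) := by
        apply Real.exp_le_exp.mpr
        have : 0 ≤ κ * s * (1 + c * (y - s) ^ 2) := by positivity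
        nlinarith
      have h2 : Real.exp (-(κ * ((1 + c * (y - s) ^ 2 + c * y ^ 2) * s))) ≤
          Real.exp (-(κ / 2 * s)) * Real.exp (-(κ / 2 * s)) := by
        rw [← Real.exp_add]
        apply Real.exp_le_exp.mpr
        have : 0 ≤ κ * s * (c * (y - s) ^ 2 + c * y ^ 2) := by positivity
        nlinarith
      have h3 : s ^ 2 * Real.exp (-(κ / 2 * s)) ≤ 8 / κ ^ 2 := by
        have h4 := Real.quadratic_le_exp_of_nonneg (x := κ / 2 * s) (by positivity)
        rw [Real.exp_neg, ← div_eq_mul_inv, div_le_div_iff₀ (Real.exp_pos _) (by positivity)]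
        have : 0 ≤ κ / 2 * s := by positivity
        nlinarith
      have h5 : (y - s) ^ 2 ≤ 2 * y ^ 2 + 2 * s ^ 2 := by nlinarith [sq_nonneg (y + s)]
      calc (y - s) ^ 2 * Real.exp (-(κ * ((1 + c * (y - s) ^ 2 + c * y ^ 2) * s)))
          ≤ (2 * y ^ 2 + 2 * s ^ 2) *
            Real.exp (-(κ * ((1 + c * (y - s) ^ 2 + c * y ^ 2) * s))) := by gcongr
        _ = 2 * y ^ 2 * Real.exp (-(κ * ((1 + c * (y - s) ^ 2 + c * y ^ 2) * s))) +
            2 * s ^ 2 * Real.exp (-(κ * ((1 + c * (y - s) ^ 2 + c * y ^ 2) * s))) := by ring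
        _ ≤ 2 * y ^ 2 * Real.exp (-(κ * c * (y ^ 2 * s))) +
            2 * s ^ 2 * (Real.exp (-(κ / 2 * s)) * Real.exp (-(κ / 2 * s))) := by gcongr
        _ = 2 * (y ^ 2 * Real.exp (-(κ * c * (y ^ 2 * s)))) +
            2 * (s ^ 2 * Real.exp (-(κ / 2 * s))) * Real.exp (-(κ / 2 * s)) := by ring
        _ ≤ 2 * (y ^ 2 * Real.exp (-(κ * c * (y ^ 2 * s)))) +
            2 * (8 / κ ^ 2) * Real.exp (-(κ / 2 * s)) := by gcongr
        _ = _ := by ring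
    · simp [k, S, hxy]
  have key := lintegral_sq_kernel_le hk hrow hcol (f := fun y => ‖v y‖ₑ) hv.enorm
  have hsq : ∫⁻ x, ‖u x‖ₑ ^ 2 ≤ ∫⁻ x, (∫⁻ y, k x y * ‖v y‖ₑ) ^ 2 := by
    gcongr with x
    refine (hu x).trans (le_of_eq ?_)
    rw [← lintegral_indicator measurableSet_Ioi]
    refine lintegral_congr fun y => ?_
    by_cases hxy : x < y <;> simp [k, S, hxy]
  rw [← eLpNorm_two_sq] at hsq key
  have hlt : eLpNorm u 2 volume ^ 2 < ⊤ := by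
    refine (hsq.trans key).trans_lt ?_
    finiteness
  by_contra hne
  rw [not_lt, top_le_iff] at hne
  simp [hne] at hlt

/-! ### Weak derivatives on the line -/

/-- Fubini on `{x < y}`, where `∫_{-∞}^y Φ' = Φ y`. No differentiability of the tail integral is
needed, so `w` may be merely integrable. -/
theorem integral_deriv_mul_integral_Ioi {Φ : ℝ → ℂ} (hΦ : ContDiff ℝ 1 Φ)
    (hs : HasCompactSupport Φ) {w : ℝ → ℂ} (hw : ∀ x, IntegrableOn w (Ioi x)) :
    ∫ x, deriv Φ x * ∫ y in Ioi x, w y = ∫ y, Φ y * w y := by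
  obtain ⟨r, hr⟩ := hs.isCompact.isBounded.subset_closedBall 0
  obtain ⟨a, ha⟩ : ∃ a, ∀ x ≤ a, x ∉ tsupport Φ := by
    refine ⟨-r - 1, fun x hx hxs => ?_⟩
    have := hr hxs
    rw [mem_closedBall_zero_iff, Real.norm_eq_abs, abs_le] at this
    linarith
  have hΦ0 : ∀ x ≤ a, Φ x = 0 := fun x hx => image_eq_zero_of_notMem_tsupport (ha x hx)
  have hdΦ0 : ∀ x ≤ a, deriv Φ x = 0 := fun x hx =>
    by_contra fun h => ha x hx (support_deriv_subset h)
  have hdc : Continuous (deriv Φ) := hΦ.continuous_deriv le_rfl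
  have hdi : Integrable (deriv Φ) := hdc.integrable_of_hasCompactSupport hs.deriv
  let S : Set (ℝ × ℝ) := {p | p.1 < p.2}
  have hS : MeasurableSet S := measurableSet_lt measurable_fst measurable_snd
  -- `w` is integrable only on right half lines. Cutting it off to the left of the support of `Φ`
  -- makes the double integral converge absolutely and changes neither side.
  let w' := (Ioi a).indicator w
  have hw' : Integrable w' := (integrable_indicator_iff measurableSet_Ioi).mpr (hw a)
  have hint : Integrable (Function.uncurry fun x y =>
      S.indicator (fun p => deriv Φ p.1 * w' p.2) (x, y)) (volume.prod volume) :=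
    (hdi.mul_prod hw').indicator hS
  have e1 : ∀ x, deriv Φ x * ∫ y in Ioi x, w y =
      ∫ y, S.indicator (fun p => deriv Φ p.1 * w' p.2) (x, y) := by
    intro x
    rcases le_or_gt x a with hx | hx
    · have : ∀ y, S.indicator (fun p => deriv Φ p.1 * w' p.2) (x, y) = 0 := by
        intro y
        simp [indicator, hdΦ0 x hx]
      simp_rw [this]
      simp [hdΦ0 x hx]
    · rw [← integral_indicator measurableSet_Ioi, ← integral_const_mul]
      refine integral_congr_ae (Filter.Eventually.of_forall fun y => ?_)
      by_cases hxy : x < y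
      · simp [S, w', hxy, hx.trans hxy]
      · simp [S, hxy]
  have e2 : ∀ y, Φ y * w y = ∫ x, S.indicator (fun p => deriv Φ p.1 * w' p.2) (x, y) := by
    intro y
    rcases le_or_gt y a with hy | hy
    · have : ∀ x, S.indicator (fun p => deriv Φ p.1 * w' p.2) (x, y) = 0 := by
        intro x
        simp [indicator, w', hy.not_gt]
      simp_rw [this]
      simp [hΦ0 y hy]
    · have : ∀ x, S.indicator (fun p => deriv Φ p.1 * w' p.2) (x, y) =
          (Iio y).indicator (fun x => deriv Φ x * w y) x := by
        intro x
        simp [indicator, S, w', hy]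
      simp_rw [this]
      rw [integral_indicator measurableSet_Iio, integral_mul_const, ← integral_Iic_eq_integral_Iio,
        hs.integral_Iic_deriv_eq hΦ]
  simp_rw [e1, e2]
  exact integral_integral_swap hint

/-- Splits into real and imaginary parts. Complex test functions are needed because uniqueness is
tested against `φ` times the complex phase. -/
theorem IsWeakDeriv.integral_deriv_mul {u w : L2} (h : IsWeakDeriv u w) {Φ : ℝ → ℂ}
    (hΦ : ContDiff ℝ ∞ Φ) (hs : HasCompactSupport Φ) :
    ∫ x, deriv Φ x * u x = - ∫ x, Φ x * w x := by
  have hre : ContDiff ℝ ∞ fun x => (Φ x).re := Complex.reCLM.contDiff.comp hΦ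
  have him : ContDiff ℝ ∞ fun x => (Φ x).im := Complex.imCLM.contDiff.comp hΦ
  have hsre : HasCompactSupport fun x => (Φ x).re := hs.comp_left (g := Complex.re) rfl
  have hsim : HasCompactSupport fun x => (Φ x).im := hs.comp_left (g := Complex.im) rfl
  have hdiff : Differentiable ℝ Φ := hΦ.differentiable (by simp)
  have dre : ∀ x, deriv (fun x => (Φ x).re) x = (deriv Φ x).re := fun x =>
    (Complex.reCLM.hasFDerivAt.comp_hasDerivAt x (hdiff x).hasDerivAt).deriv
  have dim : ∀ x, deriv (fun x => (Φ x).im) x = (deriv Φ x).im := fun x =>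
    (Complex.imCLM.hasFDerivAt.comp_hasDerivAt x (hdiff x).hasDerivAt).deriv
  have key : ∀ (z : ℂ) (y : ℂ), z * y = z.re • y + Complex.I * (z.im • y) := by
    intro z y
    conv_lhs => rw [← Complex.re_add_im z]
    simp only [Complex.real_smul]
    ring
  have c1 : Continuous fun x => deriv (fun x => (Φ x).re) x := hre.continuous_deriv (by simp)
  have c2 : Continuous fun x => deriv (fun x => (Φ x).im) x := him.continuous_deriv (by simp)
  have i1 := u.integrable_smul c1 hsre.deriv
  have i2 := u.integrable_smul c2 hsim.deriv
  have i3 := w.integrable_smul hre.continuous hsre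
  have i4 := w.integrable_smul him.continuous hsim
  have h1 := h _ hre hsre
  have h2 := h _ him hsim
  simp_rw [dre] at h1 i1
  simp_rw [dim] at h2 i2
  calc ∫ x, deriv Φ x * u x
      = ∫ x, ((deriv Φ x).re • u x + Complex.I * ((deriv Φ x).im • u x)) := by
        simp_rw [← key]
    _ = - ∫ x, ((Φ x).re • w x + Complex.I * ((Φ x).im • w x)) := by
        rw [integral_add i1 (i2.const_mul _), integral_add i3 (i4.const_mul _),
          integral_const_mul, integral_const_mul, h1, h2]
        ring
    _ = _ := by simp_rw [← key]

/-- The du Bois-Reymond lemma. A test function of mean zero is the derivative of a test function,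
and any `φ` becomes one of mean zero after subtraction of `(∫ φ) ψ₀`, with `ψ₀` a normalized bump.
-/
theorem ae_eq_const_of_integral_deriv_smul_eq_zero {U : ℝ → ℂ} (hU : LocallyIntegrable U)
    (h : ∀ φ : ℝ → ℝ, ContDiff ℝ ∞ φ → HasCompactSupport φ → ∫ x, deriv φ x • U x = 0) :
    ∃ c : ℂ, ∀ᵐ x, U x = c := by
  let bump : ContDiffBump (0 : ℝ) := ⟨1, 2, by norm_num, by norm_num⟩
  let ψ₀ : ℝ → ℝ := bump.normed volume
  have hψ₀ : ContDiff ℝ ∞ ψ₀ := bump.contDiff_normed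
  have hψ₀s : HasCompactSupport ψ₀ := bump.hasCompactSupport_normed
  have hψ₀i : ∫ x, ψ₀ x = 1 := bump.integral_normed
  have step : ∀ ψ : ℝ → ℝ, ContDiff ℝ ∞ ψ → HasCompactSupport ψ → ∫ x, ψ x = 0 →
      ∫ x, ψ x • U x = 0 := by
    intro ψ hψ hs hi
    obtain ⟨r, hr⟩ := hs.isCompact.isBounded.subset_closedBall 0
    have hz : ∀ x, r < |x| → ψ x = 0 := fun x hx =>
      image_eq_zero_of_notMem_tsupport fun hxs => by
        have := hr hxs
        rw [mem_closedBall_zero_iff, Real.norm_eq_abs] at this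
        linarith
    let r' := |r| + 1
    have hr' : r < r' := lt_of_le_of_lt (le_abs_self r) (lt_add_one _)
    have hr'0 : 0 < r' := by positivity
    let Ψ : ℝ → ℝ := fun x => ∫ t in (-r')..x, ψ t
    have hd : ∀ x, HasDerivAt Ψ (ψ x) x := fun x =>
      intervalIntegral.integral_hasDerivAt_right (hψ.continuous.intervalIntegrable _ _)
        (hψ.continuous.stronglyMeasurableAtFilter _ _) hψ.continuous.continuousAt
    have hdΨ : deriv Ψ = ψ := funext fun x => (hd x).deriv
    have hΨ : ContDiff ℝ ∞ Ψ := by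
      rw [contDiff_infty_iff_deriv, hdΨ]
      exact ⟨fun x => (hd x).differentiableAt, hψ⟩
    have hΨs : HasCompactSupport Ψ := by
      refine HasCompactSupport.intro (isCompact_Icc (a := -r') (b := r')) fun x hx => ?_
      rcases lt_or_ge x (-r') with h1 | h1
      · refine intervalIntegral.integral_zero_ae (Filter.Eventually.of_forall fun t ht => hz t ?_)
        rw [uIoc_of_ge h1.le] at ht
        rw [lt_abs]; right; linarith [ht.2]
      · have h2 : r' < x := by
          by_contra h3
          exact hx ⟨h1, not_lt.mp h3⟩
        change ∫ t in (-r')..x, ψ t = 0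
        rw [intervalIntegral.integral_eq_integral_of_support_subset, hi]
        intro t ht
        have : |t| ≤ r := by
          by_contra h3
          exact ht (hz t (not_le.mp h3))
        rw [abs_le] at this
        exact ⟨by linarith, by linarith⟩
    have := h Ψ hΨ hΨs
    rwa [hdΨ] at this
  have int : ∀ ψ : ℝ → ℝ, ContDiff ℝ ∞ ψ → HasCompactSupport ψ →
      Integrable fun x => ψ x • U x := fun ψ hψ hs =>
    hU.integrable_smul_left_of_hasCompactSupport hψ.continuous hs
  refine ⟨∫ x, ψ₀ x • U x, ?_⟩
  refine ae_eq_of_integral_contDiff_smul_eq hU (locallyIntegrable_const _) fun φ hφ hs => ?_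
  have h1 := step (fun x => φ x - (∫ t, φ t) * ψ₀ x) (hφ.sub (contDiff_const.mul hψ₀))
    (hs.sub (hψ₀s.mul_left)) (by
      rw [integral_sub (hφ.continuous.integrable_of_hasCompactSupport hs)
        ((hψ₀.continuous.integrable_of_hasCompactSupport hψ₀s).const_mul _),
        integral_const_mul, hψ₀i, mul_one, sub_self])
  simp_rw [sub_smul, mul_smul] at h1
  rw [integral_sub (int φ hφ hs) ((int ψ₀ hψ₀ hψ₀s).fun_smul _), sub_eq_zero, integral_smul] at h1
  rw [h1, integral_smul_const]

/-! ### The explicit inverse of `h D_x + m` -/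

/-- The function `exp((i/h) ∫₀ˣ m)`, which spans the kernel of `h D_x - m`. -/
noncomputable def phase (h : ℝ) (m : ℝ → ℂ) (x : ℝ) : ℂ :=
  Complex.exp (Complex.I / h * ∫ t in (0 : ℝ)..x, m t)

theorem phase_ne_zero (h : ℝ) (m : ℝ → ℂ) (x : ℝ) : phase h m x ≠ 0 := Complex.exp_ne_zero _

theorem hasDerivAt_phase (h : ℝ) {m : ℝ → ℂ} (hm : Continuous m) (x : ℝ) :
    HasDerivAt (phase h m) (Complex.I / h * m x * phase h m x) x := by
  have h1 : HasDerivAt (fun x => ∫ t in (0 : ℝ)..x, m t) (m x) x :=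
    intervalIntegral.integral_hasDerivAt_right (hm.intervalIntegrable _ _)
      (hm.stronglyMeasurableAtFilter _ _) hm.continuousAt
  have h2 := (h1.const_mul (Complex.I / h)).cexp
  rw [mul_comm] at h2
  exact h2

theorem continuous_phase (h : ℝ) {m : ℝ → ℂ} (hm : Continuous m) : Continuous (phase h m) :=
  continuous_iff_continuousAt.mpr fun x => (hasDerivAt_phase h hm x).continuousAt

theorem contDiff_phase (h : ℝ) {m : ℝ → ℂ} (hm : ContDiff ℝ ∞ m) : ContDiff ℝ ∞ (phase h m) := by
  have h1 : ContDiff ℝ ∞ fun x => ∫ t in (0 : ℝ)..x, m t := by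
    have hd : ∀ x, HasDerivAt (fun x => ∫ t in (0 : ℝ)..x, m t) (m x) x := fun x =>
      intervalIntegral.integral_hasDerivAt_right (hm.continuous.intervalIntegrable _ _)
        (hm.continuous.stronglyMeasurableAtFilter _ _) hm.continuous.continuousAt
    rw [contDiff_infty_iff_deriv, funext fun x => (hd x).deriv]
    exact ⟨fun x => (hd x).differentiableAt, hm⟩
  exact (contDiff_const.mul h1).cexp

theorem norm_phase (h : ℝ) {m : ℝ → ℂ} (hm : Continuous m) (x : ℝ) :
    ‖phase h m x‖ = Real.exp (-(∫ t in (0 : ℝ)..x, (m t).im) / h) := by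
  rw [phase, Complex.norm_exp]
  congr 1
  have : (∫ t in (0 : ℝ)..x, (m t).im) = (∫ t in (0 : ℝ)..x, m t).im :=
    Complex.imCLM.intervalIntegral_comp_comm (hm.intervalIntegrable _ _)
  rw [this, div_mul_eq_mul_div, Complex.div_ofReal_re]
  simp

/-- Up to the factor `1/h` this is the modulus of the kernel of the inverse: only `Im m` between `x`
and `y` matters. -/
theorem norm_phase_div (h : ℝ) {m : ℝ → ℂ} (hm : Continuous m) (x y : ℝ) :
    ‖phase h m y‖ / ‖phase h m x‖ = Real.exp (-(∫ t in x..y, (m t).im) / h) := by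
  have hi : ∀ a b : ℝ, IntervalIntegrable (fun t => (m t).im) volume a b := fun a b =>
    (Complex.continuous_im.comp hm).intervalIntegrable _ _
  rw [norm_phase h hm, norm_phase h hm, ← Real.exp_sub,
    ← intervalIntegral.integral_add_adjacent_intervals (hi 0 x) (hi x y)]
  ring_nf

/-- The solution `-(i/h) ∫_x^∞ exp((i/h) ∫_x^y m) v(y) dy` of `(h D_x + m) u = v`. -/
noncomputable def resolventFun (h : ℝ) (m : ℝ → ℂ) (v : ℝ → ℂ) (x : ℝ) : ℂ :=
  -(Complex.I / h) * (phase h m x)⁻¹ * ∫ y in Ioi x, phase h m y * v y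

theorem resolventFun_congr (h : ℝ) (m : ℝ → ℂ) {v v' : ℝ → ℂ} (hv : v =ᵐ[volume] v') :
    resolventFun h m v = resolventFun h m v' := by
  funext x
  rw [resolventFun, resolventFun]
  congr 1
  refine integral_congr_ae (ae_restrict_of_ae ?_)
  filter_upwards [hv] with y hy
  rw [hy]

theorem stronglyMeasurable_resolventFun (h : ℝ) {m : ℝ → ℂ} (hm : Continuous m) {v : ℝ → ℂ}
    (hv : StronglyMeasurable v) : StronglyMeasurable (resolventFun h m v) := by
  have hp := continuous_phase h hm
  let S : Set (ℝ × ℝ) := {p | p.1 < p.2}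
  have hS : MeasurableSet S := measurableSet_lt measurable_fst measurable_snd
  have h1 : StronglyMeasurable (S.indicator fun p => phase h m p.2 * v p.2) :=
    ((hp.stronglyMeasurable.mul hv).comp_measurable measurable_snd).indicator hS
  have h2 := StronglyMeasurable.integral_prod_right (ν := (volume : Measure ℝ))
    (f := fun x y => S.indicator (fun p => phase h m p.2 * v p.2) (x, y)) h1
  have h3 : (fun x => ∫ y, S.indicator (fun p => phase h m p.2 * v p.2) (x, y)) =
      fun x => ∫ y in Ioi x, phase h m y * v y := by
    funext x
    rw [← integral_indicator measurableSet_Ioi]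
    refine integral_congr_ae (Filter.Eventually.of_forall fun y => ?_)
    by_cases hxy : x < y <;> simp [S, hxy]
  rw [h3] at h2
  exact ((stronglyMeasurable_const.mul
    (hp.inv₀ (phase_ne_zero h m)).stronglyMeasurable).mul h2)

theorem enorm_resolventFun_le {h : ℝ} (hh : 0 < h) {m : ℝ → ℂ} (hm : Continuous m) (v : ℝ → ℂ)
    (x : ℝ) : ‖resolventFun h m v x‖ₑ ≤ ∫⁻ y in Ioi x,
      ENNReal.ofReal (1 / h * Real.exp (-(∫ t in x..y, (m t).im) / h)) * ‖v y‖ₑ := by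
  have hc : ‖-(Complex.I / h) * (phase h m x)⁻¹‖ₑ ≠ ⊤ := enorm_ne_top
  rw [resolventFun, enorm_mul (_ * _)]
  calc _ ≤ ‖-(Complex.I / h) * (phase h m x)⁻¹‖ₑ * ∫⁻ y in Ioi x, ‖phase h m y * v y‖ₑ := by
        gcongr
        exact enorm_integral_le_lintegral_enorm _
    _ = _ := by
        rw [← lintegral_const_mul' _ _ hc]
        refine lintegral_congr fun y => ?_
        rw [enorm_mul (phase h m y), ← mul_assoc, ← enorm_mul, ← norm_phase_div h hm, ← ofReal_norm]
        congr 2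
        simp only [norm_mul, norm_neg, norm_div, Complex.norm_I, Complex.norm_real, norm_inv,
          Real.norm_eq_abs, abs_of_pos hh]
        ring

/-- The assumptions under which `h D_x + m` is inverted: `m` is smooth, of at most quadratic growth,
and its imaginary part grows quadratically. -/
structure Confining (m : ℝ → ℂ) (c C : ℝ) : Prop where
  smooth : ContDiff ℝ ∞ m
  c_pos : 0 < c
  C_nonneg : 0 ≤ C
  lower : ∀ x, c * x ^ 2 - C ≤ (m x).im
  upper : ∀ x, ‖m x‖ ≤ C * (x ^ 2 + 1)

namespace Confining

variable {m : ℝ → ℂ} {c C : ℝ}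

/-- The cubic `c (y³ - x³)/3` dominates. After `c/12 (x² + y²)(y - x)` is set aside, at least `c/24
(y - x)³` is left over, and it absorbs `(C + 1)(y - x)` up to a constant. The squares kept in the
bound are what gives `x² u ∈ L²` for the solution. -/
theorem exists_integral_im_ge (hm : Confining m c C) : ∃ D : ℝ, ∀ x y, x ≤ y →
    (1 + c / 12 * x ^ 2 + c / 12 * y ^ 2) * (y - x) - D ≤ ∫ t in x..y, (m t).im := by
  have hc := hm.c_pos
  have hC := hm.C_nonneg
  refine ⟨(C + 1) * (1 + 24 * (C + 1) / c), fun x y hxy => ?_⟩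
  have h1 : ∫ t in x..y, (c * t ^ 2 - C) ≤ ∫ t in x..y, (m t).im :=
    intervalIntegral.integral_mono_on hxy (Continuous.intervalIntegrable (by fun_prop) _ _)
      ((Complex.continuous_im.comp hm.smooth.continuous).intervalIntegrable _ _)
      fun t _ => hm.lower t
  refine le_trans ?_ h1
  rw [intervalIntegral.integral_sub (Continuous.intervalIntegrable (by fun_prop) _ _)
    (Continuous.intervalIntegrable (by fun_prop) _ _), intervalIntegral.integral_const_mul,
    integral_pow, intervalIntegral.integral_const]
  simp only [smul_eq_mul]
  obtain ⟨s, rfl⟩ : ∃ s, y = x + s := ⟨y - x, by ring⟩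
  have hs : 0 ≤ s := by linarith
  -- Short intervals are paid for by the constant and long ones by the cubic; the `1 +` in the
  -- threshold ensures `s ≤ s²` in the second case.
  have h2 : (C + 1) * s ≤ c * s ^ 3 / 24 + (C + 1) * (1 + 24 * (C + 1) / c) := by
    rcases le_or_gt s (1 + 24 * (C + 1) / c) with h | h
    · have : (C + 1) * s ≤ (C + 1) * (1 + 24 * (C + 1) / c) := by gcongr
      have : 0 ≤ c * s ^ 3 / 24 := by positivity
      linarith
    · have h3 : 24 * (C + 1) / c ≤ s := by linarith
      have h4 : 1 ≤ s := by
        have : 0 ≤ 24 * (C + 1) / c := by positivity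
        linarith
      rw [div_le_iff₀ hc] at h3
      have h5 : (C + 1) * s ≤ c * s ^ 3 / 24 := by
        have : (24 * (C + 1)) * s ≤ (s * c) * (s * s) :=
          mul_le_mul h3 (by nlinarith) hs (by positivity)
        nlinarith
      have : 0 ≤ (C + 1) * (1 + 24 * (C + 1) / c) := by positivity
      linarith
  have h6 : 0 ≤ c * s * (2 * x + s) ^ 2 := by positivity
  norm_num
  nlinarith

/-- The constant grows exponentially as `h → 0`. This is harmless, because the bound serves only
existence, boundedness and integrability for a fixed `h`; the sharp norm is found separately. -/
theorem exists_norm_kernel_le (hm : Confining m c C) {h : ℝ} (hh : 0 < h) : ∃ K : ℝ, 0 ≤ K ∧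
    ∀ x y, x ≤ y → Real.exp (-(∫ t in x..y, (m t).im) / h) ≤
      K * Real.exp (-(1 / h * ((1 + c / 12 * x ^ 2 + c / 12 * y ^ 2) * (y - x)))) := by
  obtain ⟨D, hD⟩ := hm.exists_integral_im_ge
  refine ⟨Real.exp (D / h), (Real.exp_pos _).le, fun x y hxy => ?_⟩
  rw [← Real.exp_add]
  apply Real.exp_le_exp.mpr
  have := hD x y hxy
  rw [one_div, inv_mul_eq_div, ← sub_eq_add_neg, ← sub_div]
  gcongr
  linarith

theorem exists_norm_kernel_le' (hm : Confining m c C) {h : ℝ} (hh : 0 < h) : ∃ K : ℝ, 0 ≤ K ∧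
    ∀ x y, x ≤ y → Real.exp (-(∫ t in x..y, (m t).im) / h) ≤
      K * Real.exp (-(1 / h * (y - x))) := by
  obtain ⟨K, hK, hle⟩ := hm.exists_norm_kernel_le hh
  have hc := hm.c_pos
  refine ⟨K, hK, fun x y hxy => (hle x y hxy).trans ?_⟩
  gcongr
  have : 0 ≤ (c / 12 * x ^ 2 + c / 12 * y ^ 2) * (y - x) :=
    mul_nonneg (by positivity) (by linarith)
  linarith

theorem integrableOn_phase_mul (hm : Confining m c C) {h : ℝ} (hh : 0 < h) (v : L2) (x : ℝ) :
    IntegrableOn (fun y => phase h m y * v y) (Ioi x) := by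
  obtain ⟨K, hK, hle⟩ := hm.exists_norm_kernel_le' hh
  have hp := continuous_phase h hm.smooth.continuous
  have hx : 0 < ‖phase h m x‖ := norm_pos_iff.mpr (phase_ne_zero h m x)
  have h1 : MemLp (phase h m) 2 (volume.restrict (Ioi x)) := by
    have he : ∀ y, Real.exp (-(1 / h * (y - x))) ^ 2 =
        Real.exp (2 / h * x) * Real.exp (-(2 / h) * y) := fun y => by
      rw [← Real.exp_nat_mul, ← Real.exp_add]; push_cast; ring_nf
    have h2 : MemLp (fun y => Real.exp (-(1 / h * (y - x)))) 2 (volume.restrict (Ioi x)) := by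
      rw [memLp_two_iff_integrable_sq (by fun_prop)]
      simp_rw [he]
      have : -(2 / h) < 0 := by rw [neg_lt_zero]; positivity
      exact (integrableOn_exp_mul_Ioi this x).const_mul _
    refine h2.of_le_mul (c := ‖phase h m x‖ * K) hp.aestronglyMeasurable ?_
    filter_upwards [self_mem_ae_restrict measurableSet_Ioi] with y hy
    have := hle x y (le_of_lt hy)
    rw [← norm_phase_div h hm.smooth.continuous, div_le_iff₀ hx] at this
    rw [Real.norm_of_nonneg (Real.exp_pos _).le]
    linarith
  exact h1.integrable_mul ((Lp.memLp v).restrict _)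

theorem eLpNorm_resolventFun_le (hm : Confining m c C) {h : ℝ} (hh : 0 < h) : ∃ K : ℝ, 0 ≤ K ∧
    ∀ v : L2, eLpNorm (resolventFun h m v) 2 volume ≤
      ENNReal.ofReal K * eLpNorm v 2 volume := by
  obtain ⟨K, hK, hle⟩ := hm.exists_norm_kernel_le' hh
  refine ⟨1 / h * K / (1 / h), by positivity, fun v => ?_⟩
  refine eLpNorm_le_of_exp_kernel (one_div_pos.mpr hh) (Lp.stronglyMeasurable v)
    (by positivity) fun x => (enorm_resolventFun_le hh hm.smooth.continuous v x).trans ?_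
  refine setLIntegral_mono' measurableSet_Ioi fun y hy => ?_
  gcongr ENNReal.ofReal ?_ * _
  rw [mul_assoc]
  gcongr
  exact hle x y (le_of_lt hy)

theorem memLp_resolventFun (hm : Confining m c C) {h : ℝ} (hh : 0 < h) (v : L2) :
    MemLp (resolventFun h m v) 2 volume := by
  obtain ⟨K, hK, hle⟩ := hm.eLpNorm_resolventFun_le hh
  refine ⟨(stronglyMeasurable_resolventFun h hm.smooth.continuous
    (Lp.stronglyMeasurable v)).aestronglyMeasurable, (hle v).trans_lt ?_⟩
  exact ENNReal.mul_lt_top ENNReal.ofReal_lt_top (Lp.eLpNorm_lt_top v)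

theorem memLp_sq_mul_resolventFun (hm : Confining m c C) {h : ℝ} (hh : 0 < h) (v : L2) :
    MemLp (fun x : ℝ => (x : ℂ) ^ 2 * resolventFun h m v x) 2 volume := by
  obtain ⟨K, hK, hle⟩ := hm.exists_norm_kernel_le hh
  have hc := hm.c_pos
  refine ⟨((by fun_prop : Continuous fun x : ℝ => (x : ℂ) ^ 2).stronglyMeasurable.mul
    (stronglyMeasurable_resolventFun h hm.smooth.continuous
    (Lp.stronglyMeasurable v))).aestronglyMeasurable, ?_⟩
  refine eLpNorm_lt_top_of_sq_mul_exp_kernel (one_div_pos.mpr hh) (c := c / 12) (by positivity)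
    (Lp.stronglyMeasurable v) (Lp.eLpNorm_lt_top v) (a := 1 / h * K) (by positivity) fun x => ?_
  rw [enorm_mul]
  refine (mul_le_mul_right (enorm_resolventFun_le hh hm.smooth.continuous v x) _).trans ?_
  rw [← lintegral_const_mul' _ _ enorm_ne_top]
  refine setLIntegral_mono' measurableSet_Ioi fun y hy => ?_
  rw [← mul_assoc]
  refine mul_le_mul_left ?_ _
  rw [← ofReal_norm, ← ENNReal.ofReal_mul (norm_nonneg _)]
  refine ENNReal.ofReal_le_ofReal ?_
  have e : ‖(x : ℂ) ^ 2‖ = x ^ 2 := by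
    rw [norm_pow, Complex.norm_real, Real.norm_eq_abs, sq_abs]
  rw [e]
  calc x ^ 2 * (1 / h * Real.exp (-(∫ t in x..y, (m t).im) / h)) ≤
      x ^ 2 * (1 / h * (K * Real.exp (-(1 / h *
        ((1 + c / 12 * x ^ 2 + c / 12 * y ^ 2) * (y - x)))))) := by
        gcongr
        exact hle x y (le_of_lt hy)
    _ = _ := by ring

theorem memLp_mul (hm : Confining m c C) {u : ℝ → ℂ} (hu : MemLp u 2 volume)
    (hu2 : MemLp (fun x : ℝ => (x : ℂ) ^ 2 * u x) 2 volume) :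
    MemLp (fun x => m x * u x) 2 volume := by
  have h1 : MemLp (fun x : ℝ => ‖(x : ℂ) ^ 2 * u x‖ + ‖u x‖) 2 volume := hu2.norm.add hu.norm
  refine h1.of_le_mul (c := C) (hm.smooth.continuous.aestronglyMeasurable.mul hu.1)
    (Filter.Eventually.of_forall fun x => ?_)
  rw [Real.norm_of_nonneg (by positivity), norm_mul, norm_mul, norm_pow, Complex.norm_real,
    Real.norm_eq_abs, sq_abs]
  have := mul_le_mul_of_nonneg_right (hm.upper x) (norm_nonneg (u x))
  linarith

/-- A test function is divided by the phase: for `Φ = φ / phase`, the product rule turns `∫ Φ' ·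
(tail integral)` into `∫ (φ' - (i/h) m φ) u` up to a constant factor, while Fubini turns it into `∫
φ v`. -/
theorem isWeakDeriv_resolventFun (hm : Confining m c C) {h : ℝ} (hh : 0 < h) {u v w : L2}
    (hu : u =ᵐ[volume] resolventFun h m v) (hw : ∀ᵐ x, w x = Complex.I / h * (v x - m x * u x)) :
    IsWeakDeriv u w := by
  intro φ hφ hs
  have hmc := hm.smooth.continuous
  have hpc := continuous_phase h hmc
  have hp0 := phase_ne_zero h m
  let Φ : ℝ → ℂ := fun x => φ x * (phase h m x)⁻¹
  have hφd : ∀ x, HasDerivAt (fun x => (φ x : ℂ)) ((deriv φ x : ℝ) : ℂ) x := fun x =>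
    ((hφ.differentiable (by simp)) x).hasDerivAt.ofReal_comp
  have hΦd : ∀ x, HasDerivAt Φ (deriv φ x * (phase h m x)⁻¹ -
      φ x * (Complex.I / h * m x * (phase h m x)⁻¹)) x := fun x => by
    have h1 := (hφd x).mul ((hasDerivAt_phase h hmc x).inv (hp0 x))
    refine h1.congr_deriv ?_
    have hpx := hp0 x
    simp only [Pi.inv_apply]
    field_simp
    ring
  have hφC : ContDiff ℝ ∞ fun x => (φ x : ℂ) := Complex.ofRealCLM.contDiff.comp hφ
  have hΦC : ContDiff ℝ 1 Φ :=
    (hφC.mul ((contDiff_phase h hm.smooth).inv hp0)).of_le (by norm_num)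
  have hφs : HasCompactSupport fun x => (φ x : ℂ) := hs.comp_left (g := fun t : ℝ => (t : ℂ)) rfl
  have hΦs : HasCompactSupport Φ := hφs.mul_right
  have key := integral_deriv_mul_integral_Ioi hΦC hΦs (hm.integrableOn_phase_mul hh v)
  have hdc : Continuous (deriv φ) := hφ.continuous_deriv (by simp)
  have i1 := u.integrable_smul hdc hs.deriv
  have i2 : Integrable fun x => (φ x * (Complex.I / h * m x)) * u x := by
    have hc : Continuous fun x => φ x * (Complex.I / h * m x) := by
      have := hφ.continuous
      fun_prop
    have := ((Lp.memLp u).locallyIntegrable (by norm_num)).integrable_smul_left_of_hasCompactSupport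
      hc hφs.mul_right
    simpa using this
  have i3 := v.integrable_smul hφ.continuous hs
  have e1 : ∀ᵐ x, deriv φ x • u x - (φ x * (Complex.I / h * m x)) * u x =
      -(Complex.I / h) * (deriv Φ x * ∫ y in Ioi x, phase h m y * v y) := by
    filter_upwards [hu] with x hx
    rw [hx, (hΦd x).deriv, resolventFun, Complex.real_smul]
    ring
  have e2 : ∀ x, Φ x * (phase h m x * v x) = φ x • v x := fun x => by
    simp only [Φ, Complex.real_smul]
    field_simp [hp0 x]
  have e3 : ∀ᵐ x, φ x • w x =
      Complex.I / h * (φ x • v x) - (φ x * (Complex.I / h * m x)) * u x := by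
    filter_upwards [hw] with x hx
    rw [hx, Complex.real_smul, Complex.real_smul]
    ring
  rw [integral_congr_ae e3, integral_sub (i3.const_mul _) i2, integral_const_mul]
  have h4 := integral_congr_ae e1
  rw [integral_sub i1 i2, integral_const_mul, key] at h4
  simp_rw [e2] at h4
  linear_combination h4

/-- The product `phase · u` has weak derivative zero, hence equals a constant `z` almost everywhere.
The phase is bounded on the right half line, so there `|z|` is dominated by a multiple of `|u|`, and
a nonzero constant would be square integrable on a set of infinite measure. -/
theorem eq_zero_of_isWeakDeriv (hm : Confining m c C) {h : ℝ} (hh : 0 < h) {u w : L2}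
    (hw : IsWeakDeriv u w) (hwu : ∀ᵐ x, w x = -(Complex.I / h) * (m x * u x)) : u = 0 := by
  have hmc := hm.smooth.continuous
  have hpc := continuous_phase h hmc
  have hp0 := phase_ne_zero h m
  have hloc := (Lp.memLp u).locallyIntegrable (μ := volume) (by norm_num)
  have hcmul : ∀ {f : ℝ → ℂ}, Continuous f → HasCompactSupport f →
      Integrable fun x => f x * u x := fun hf hs => by
    simpa using hloc.integrable_smul_left_of_hasCompactSupport hf hs
  obtain ⟨z, hz⟩ := ae_eq_const_of_integral_deriv_smul_eq_zero (U := fun x => phase h m x * u x)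
    (by
      rw [← locallyIntegrableOn_univ] at hloc ⊢
      exact hloc.continuousOn_mul hpc.continuousOn isOpen_univ.isLocallyClosed)
    (fun φ hφ hs => by
      have hφC : ContDiff ℝ ∞ fun x => (φ x : ℂ) := Complex.ofRealCLM.contDiff.comp hφ
      have hφs : HasCompactSupport fun x => (φ x : ℂ) :=
        hs.comp_left (g := fun t : ℝ => (t : ℂ)) rfl
      have hφd : ∀ x, HasDerivAt (fun x => (φ x : ℂ)) ((deriv φ x : ℝ) : ℂ) x := fun x =>
        ((hφ.differentiable (by simp)) x).hasDerivAt.ofReal_comp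
      have hdc : Continuous (deriv φ) := hφ.continuous_deriv (by simp)
      have hds : HasCompactSupport fun x => ((deriv φ x : ℝ) : ℂ) :=
        hs.deriv.comp_left (g := fun t : ℝ => (t : ℂ)) rfl
      have h1 := hw.integral_deriv_mul (hφC.mul (contDiff_phase h hm.smooth)) hφs.mul_right
      have h2 : ∀ x, deriv (fun x => (φ x : ℂ) * phase h m x) x = deriv φ x * phase h m x +
          φ x * (Complex.I / h * m x * phase h m x) := fun x =>
        ((hφd x).mul (hasDerivAt_phase h hmc x)).deriv
      have i1 := hcmul (f := fun x => deriv φ x * phase h m x) (by fun_prop) hds.mul_right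
      have i2 := hcmul (f := fun x => φ x * (Complex.I / h * m x * phase h m x))
        (by have := hφ.continuous; fun_prop) hφs.mul_right
      have e : ∀ᵐ x, φ x * phase h m x * w x =
          -(φ x * (Complex.I / h * m x * phase h m x) * u x) := by
        filter_upwards [hwu] with x hx
        rw [hx]; ring
      simp_rw [h2, add_mul] at h1
      rw [integral_add i1 i2, integral_congr_ae e, integral_neg, neg_neg, add_eq_right] at h1
      rw [← h1]
      refine integral_congr_ae (Filter.Eventually.of_forall fun x => ?_)
      simp only [Complex.real_smul]
      ring)
  by_cases hz0 : z = 0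
  · apply Lp.ext
    filter_upwards [hz, Lp.coeFn_zero ℂ 2 (volume : Measure ℝ)] with x hx h0
    rw [h0, Pi.zero_apply]
    rw [hz0] at hx
    exact (mul_eq_zero.mp hx).resolve_left (hp0 x)
  · exfalso
    obtain ⟨K, hK, hle⟩ := hm.exists_norm_kernel_le' hh
    have hKb : ∀ x, 0 ≤ x → ‖phase h m x‖ ≤ K := fun x hx => by
      have h1 := hle 0 x hx
      rw [norm_phase h hmc]
      refine h1.trans (mul_le_of_le_one_right hK (Real.exp_le_one_iff.mpr ?_))
      have : 0 ≤ 1 / h * (x - 0) := by rw [sub_zero]; positivity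
      linarith
    have hconst : MemLp (fun _ : ℝ => z) 2 (volume.restrict (Ioi 0)) := by
      refine ((Lp.memLp u).restrict (Ioi 0)).of_le_mul (c := K) aestronglyMeasurable_const ?_
      filter_upwards [ae_restrict_of_ae hz, self_mem_ae_restrict measurableSet_Ioi] with x hx h0
      rw [← hx, norm_mul]
      gcongr
      exact hKb x (le_of_lt h0)
    rw [memLp_const_iff (by norm_num) (by norm_num)] at hconst
    simp [hz0] at hconst

theorem Hsc_le_mulDomain (hm : Confining m c C) : Hsc ≤ mulDomain m := fun u hu =>
  hm.memLp_mul (Lp.memLp u) hu.1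

theorem domain_modelOp (hm : Confining m c C) (h : ℝ) : (modelOp h m).domain = Hsc :=
  inf_eq_left.mpr hm.Hsc_le_mulDomain

end Confining

/-- Frees the operator from the arbitrary choice in `weakDeriv`: by uniqueness any weak derivative
of `u` may be used. -/
theorem modelOp_apply_ae {h : ℝ} {m : ℝ → ℂ} (u : (modelOp h m).domain) {w : L2}
    (hw : IsWeakDeriv u w) :
    ∀ᵐ x, (modelOp h m) u x = (h : ℂ) / Complex.I * w x + m x * (u : L2) x := by
  have hu : (u : L2) ∈ Hsc ⊓ mulDomain m := u.2
  have e : (modelOp h m) u = ((h : ℂ) / Complex.I) • weakDeriv ⟨u, hu.1.2⟩ +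
      mulOp m ⟨u, hu.2⟩ := rfl
  have hwd : weakDeriv ⟨u, hu.1.2⟩ = w := (Classical.choose_spec hu.1.2).unique hw
  have hmul : mulOp m ⟨u, hu.2⟩ =ᵐ[volume] fun x => m x * (u : L2) x := MemLp.coeFn_toLp hu.2
  rw [e, hwd]
  filter_upwards [hmul, Lp.coeFn_add (((h : ℂ) / Complex.I) • w) (mulOp m ⟨u, hu.2⟩),
    Lp.coeFn_smul ((h : ℂ) / Complex.I) w] with x h1 h2 h3
  rw [h2, Pi.add_apply, h1, h3, Pi.smul_apply, smul_eq_mul]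

theorem Confining.exists_isBoundedInverse {m : ℝ → ℂ} {c C : ℝ} (hm : Confining m c C) {h : ℝ}
    (hh : 0 < h) : ∃ R : L2 →L[ℂ] L2, IsBoundedInverse (modelOp h m) R ∧
      ∀ v : L2, R v =ᵐ[volume] resolventFun h m v := by
  have hint := hm.integrableOn_phase_mul hh
  let T : L2 →ₗ[ℂ] L2 :=
    { toFun := fun v => (hm.memLp_resolventFun hh v).toLp _
      map_add' := fun v v' => by
        apply Lp.ext
        filter_upwards [(hm.memLp_resolventFun hh (v + v')).coeFn_toLp,
          (hm.memLp_resolventFun hh v).coeFn_toLp, (hm.memLp_resolventFun hh v').coeFn_toLp,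
          Lp.coeFn_add ((hm.memLp_resolventFun hh v).toLp _)
            ((hm.memLp_resolventFun hh v').toLp _)] with x h1 h2 h3 h4
        rw [h1, h4, Pi.add_apply, h2, h3, resolventFun_congr h m (Lp.coeFn_add v v'),
          resolventFun, resolventFun, resolventFun]
        simp only [Pi.add_apply, mul_add]
        rw [integral_add (hint v x) (hint v' x), mul_add]
      map_smul' := fun z v => by
        apply Lp.ext
        filter_upwards [(hm.memLp_resolventFun hh (z • v)).coeFn_toLp,
          (hm.memLp_resolventFun hh v).coeFn_toLp,
          Lp.coeFn_smul z ((hm.memLp_resolventFun hh v).toLp _)] with x h1 h2 h4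
        rw [h1, RingHom.id_apply, h4, Pi.smul_apply, h2, resolventFun_congr h m (Lp.coeFn_smul z v),
          resolventFun, resolventFun]
        simp only [Pi.smul_apply, smul_eq_mul, mul_left_comm _ z]
        rw [integral_const_mul]
        ring }
  obtain ⟨K, hK, hle⟩ := hm.eLpNorm_resolventFun_le hh
  let R : L2 →L[ℂ] L2 := T.mkContinuous K fun v => by
    have h1 : ‖T v‖ = (eLpNorm (resolventFun h m v) 2 volume).toReal :=
      Lp.norm_toLp _ (hm.memLp_resolventFun hh v)
    rw [h1, Lp.norm_def, ← ENNReal.toReal_ofReal hK, ← ENNReal.toReal_mul]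
    exact ENNReal.toReal_mono
      (ENNReal.mul_lt_top ENNReal.ofReal_lt_top (Lp.eLpNorm_lt_top v)).ne (hle v)
  have hR : ∀ v : L2, R v =ᵐ[volume] resolventFun h m v := fun v =>
    (hm.memLp_resolventFun hh v).coeFn_toLp
  have hsol : ∀ v, ∃ hv : R v ∈ (modelOp h m).domain, (modelOp h m) ⟨R v, hv⟩ = v := by
    intro v
    have hsq : R v ∈ mulDomain fun x : ℝ => (x : ℂ) ^ 2 := by
      refine (memLp_congr_ae ?_).mpr (hm.memLp_sq_mul_resolventFun hh v)
      filter_upwards [hR v] with x hx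
      rw [hx]
    have hmu : MemLp (fun x => m x * (R v) x) 2 volume := hm.memLp_mul (Lp.memLp (R v)) hsq
    let w : L2 := (Complex.I / h) • (v - hmu.toLp _)
    have hw : ∀ᵐ x, w x = Complex.I / h * (v x - m x * (R v) x) := by
      filter_upwards [Lp.coeFn_smul (Complex.I / h) (v - hmu.toLp _),
        Lp.coeFn_sub v (hmu.toLp _), hmu.coeFn_toLp] with x h1 h2 h3
      rw [h1, Pi.smul_apply, h2, Pi.sub_apply, h3, smul_eq_mul]
    have hwd : IsWeakDeriv (R v) w := hm.isWeakDeriv_resolventFun hh (hR v) hw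
    refine ⟨⟨⟨hsq, w, hwd⟩, hmu⟩, ?_⟩
    apply Lp.ext
    filter_upwards [modelOp_apply_ae (h := h) (m := m) ⟨R v, ⟨⟨hsq, w, hwd⟩, hmu⟩⟩ hwd, hw]
      with x h1 h2
    rw [h1, h2, Complex.div_I]
    have hh' : (h : ℂ) ≠ 0 := by exact_mod_cast hh.ne'
    field_simp
    linear_combination (-(v x - m x * (R v) x)) * Complex.I_sq
  refine ⟨R, ⟨hsol, fun u => ?_⟩, hR⟩
  obtain ⟨hv, hPv⟩ := hsol (modelOp h m u)
  rw [← sub_eq_zero]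
  -- `R (T u)` and `u` have the same image under `T`, so injectivity turns the right inverse into a
  -- left inverse.
  let d : (modelOp h m).domain := ⟨R (modelOp h m u), hv⟩ - u
  have hd : modelOp h m d = 0 := by
    change modelOp h m (_ - u) = 0
    rw [LinearPMap.map_sub, hPv, sub_self]
  obtain ⟨w, hw⟩ : ∃ w, IsWeakDeriv d w := d.2.1.2
  refine hm.eq_zero_of_isWeakDeriv hh hw ?_
  have h1 := modelOp_apply_ae d hw
  rw [hd] at h1
  filter_upwards [h1, Lp.coeFn_zero ℂ 2 (volume : Measure ℝ)] with x h2 h3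
  rw [h3, Pi.zero_apply, Complex.div_I] at h2
  have hh' : (h : ℂ) ≠ 0 := by exact_mod_cast hh.ne'
  change w x = -(Complex.I / h) * (m x * (d : L2) x)
  field_simp
  linear_combination (-Complex.I) * h2 + (h * w x) * Complex.I_sq

/-! ### Two-sided bounds for the norm of the inverse -/

theorem L2.ofReal_norm_sq (v : L2) : ENNReal.ofReal (‖v‖ ^ 2) = ∫⁻ x, ‖v x‖ₑ ^ 2 := by
  rw [← eLpNorm_two_sq, Lp.norm_def, ENNReal.ofReal_pow ENNReal.toReal_nonneg,
    ENNReal.ofReal_toReal (Lp.eLpNorm_ne_top v)]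

/-- The integral of `exp((2/h) ∫₀ˣ f)` over the left half line. -/
noncomputable def leftIntegral (h : ℝ) (f : ℝ → ℝ) : ℝ :=
  ∫ x in Iic 0, Real.exp (2 * (∫ t in (0 : ℝ)..x, f t) / h)

/-- The integral of `exp(-(2/h) ∫₀ˣ f)` over the right half line. -/
noncomputable def rightIntegral (h : ℝ) (f : ℝ → ℝ) : ℝ :=
  ∫ x in Ioi 0, Real.exp (-(2 * (∫ t in (0 : ℝ)..x, f t) / h))

theorem leftIntegral_nonneg (h : ℝ) (f : ℝ → ℝ) : 0 ≤ leftIntegral h f :=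
  integral_nonneg fun _ => (Real.exp_pos _).le

theorem rightIntegral_nonneg (h : ℝ) (f : ℝ → ℝ) : 0 ≤ rightIntegral h f :=
  integral_nonneg fun _ => (Real.exp_pos _).le

/-- Reflection exchanges the two half lines, so that Laplace's method has to be carried out for left
wells only. -/
theorem rightIntegral_eq_leftIntegral (h : ℝ) (f : ℝ → ℝ) :
    rightIntegral h f = leftIntegral h fun x => f (-x) := by
  have h1 := integral_comp_neg_Iic 0
    (fun x => Real.exp (-(2 * (∫ t in (0 : ℝ)..x, f t) / h)))
  rw [neg_zero] at h1
  rw [rightIntegral, leftIntegral, ← h1]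
  refine integral_congr_ae (Filter.Eventually.of_forall fun x => ?_)
  simp only
  rw [intervalIntegral.integral_comp_neg, neg_zero, intervalIntegral.integral_symm]
  ring_nf

theorem sq_norm_phase (h : ℝ) {m : ℝ → ℂ} (hm : Continuous m) (x : ℝ) :
    ‖phase h m x‖ ^ 2 = Real.exp (-(2 * (∫ t in (0 : ℝ)..x, (m t).im) / h)) := by
  rw [norm_phase h hm, ← Real.exp_nat_mul]
  push_cast
  ring_nf

theorem sq_norm_phase_inv (h : ℝ) {m : ℝ → ℂ} (hm : Continuous m) (x : ℝ) :
    ‖(phase h m x)⁻¹‖ ^ 2 = Real.exp (2 * (∫ t in (0 : ℝ)..x, (m t).im) / h) := by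
  rw [norm_inv, inv_pow, sq_norm_phase h hm, ← Real.exp_neg, neg_neg]

namespace Confining

variable {m : ℝ → ℂ} {c C : ℝ}

theorem integrableOn_left (hm : Confining m c C) {h : ℝ} (hh : 0 < h) :
    IntegrableOn (fun x => Real.exp (2 * (∫ t in (0 : ℝ)..x, (m t).im) / h)) (Iic 0) := by
  have hmc := hm.smooth.continuous
  obtain ⟨K, hK, hle⟩ := hm.exists_norm_kernel_le' hh
  have hpos : 0 < 2 / h := by positivity
  refine ((integrableOn_exp_mul_Iic hpos 0).const_mul (K ^ 2)).mono' ?_ ?_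
  · simp_rw [← sq_norm_phase_inv h hmc]
    exact (((continuous_phase h hmc).inv₀
      (phase_ne_zero h m)).norm.pow 2).aestronglyMeasurable
  · filter_upwards [self_mem_ae_restrict measurableSet_Iic] with x hx
    have h1 := hle x 0 hx
    rw [Real.norm_of_nonneg (Real.exp_pos _).le]
    have e1 : Real.exp (2 * (∫ t in (0 : ℝ)..x, (m t).im) / h) =
        Real.exp (-(∫ t in x..0, (m t).im) / h) ^ 2 := by
      rw [← Real.exp_nat_mul, intervalIntegral.integral_symm]
      push_cast
      ring_nf
    rw [e1]
    calc _ ≤ (K * Real.exp (-(1 / h * (0 - x)))) ^ 2 := by gcongr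
      _ = _ := by
        rw [mul_pow, ← Real.exp_nat_mul]
        push_cast
        ring_nf

theorem integrableOn_right (hm : Confining m c C) {h : ℝ} (hh : 0 < h) :
    IntegrableOn (fun x => Real.exp (-(2 * (∫ t in (0 : ℝ)..x, (m t).im) / h))) (Ioi 0) := by
  have hmc := hm.smooth.continuous
  obtain ⟨K, hK, hle⟩ := hm.exists_norm_kernel_le' hh
  have hneg : -(2 / h) < 0 := by rw [neg_lt_zero]; positivity
  refine ((integrableOn_exp_mul_Ioi hneg 0).const_mul (K ^ 2)).mono' ?_ ?_
  · simp_rw [← sq_norm_phase h hmc]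
    exact ((continuous_phase h hmc).norm.pow 2).aestronglyMeasurable
  · filter_upwards [self_mem_ae_restrict measurableSet_Ioi] with x hx
    have h1 := hle 0 x (le_of_lt hx)
    rw [Real.norm_of_nonneg (Real.exp_pos _).le]
    have e1 : Real.exp (-(2 * (∫ t in (0 : ℝ)..x, (m t).im) / h)) =
        Real.exp (-(∫ t in (0 : ℝ)..x, (m t).im) / h) ^ 2 := by
      rw [← Real.exp_nat_mul]
      push_cast
      ring_nf
    rw [e1]
    calc _ ≤ (K * Real.exp (-(1 / h * (x - 0)))) ^ 2 := by gcongr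
      _ = _ := by
        rw [mul_pow, ← Real.exp_nat_mul]
        push_cast
        ring_nf

theorem lintegral_left (hm : Confining m c C) {h : ℝ} (hh : 0 < h) :
    ∫⁻ x in Iic 0, ‖(phase h m x)⁻¹‖ₑ ^ 2 =
      ENNReal.ofReal (leftIntegral h fun t => (m t).im) := by
  rw [leftIntegral, ofReal_integral_eq_lintegral_ofReal (hm.integrableOn_left hh)
    (Filter.Eventually.of_forall fun _ => (Real.exp_pos _).le)]
  refine lintegral_congr fun x => ?_
  rw [← sq_norm_phase_inv h hm.smooth.continuous, ENNReal.ofReal_pow (norm_nonneg _), ofReal_norm]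

theorem lintegral_right (hm : Confining m c C) {h : ℝ} (hh : 0 < h) :
    ∫⁻ x in Ioi 0, ‖phase h m x‖ₑ ^ 2 =
      ENNReal.ofReal (rightIntegral h fun t => (m t).im) := by
  rw [rightIntegral, ofReal_integral_eq_lintegral_ofReal (hm.integrableOn_right hh)
    (Filter.Eventually.of_forall fun _ => (Real.exp_pos _).le)]
  refine lintegral_congr fun x => ?_
  rw [← sq_norm_phase h hm.smooth.continuous, ENNReal.ofReal_pow (norm_nonneg _), ofReal_norm]

theorem rightIntegral_pos (hm : Confining m c C) {h : ℝ} (hh : 0 < h) :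
    0 < rightIntegral h fun t => (m t).im := by
  rw [rightIntegral, setIntegral_pos_iff_support_of_nonneg_ae
    (Filter.Eventually.of_forall fun _ => (Real.exp_pos _).le) (hm.integrableOn_right hh)]
  have : (Function.support fun x : ℝ =>
      Real.exp (-(2 * (∫ t in (0 : ℝ)..x, (m t).im) / h))) = univ :=
    eq_univ_of_forall fun x => (Real.exp_pos _).ne'
  rw [this, univ_inter, Real.volume_Ioi]
  exact ENNReal.zero_lt_top

theorem enorm_setIntegral_phase_mul_le (hm : Confining m c C) {h : ℝ} (hh : 0 < h) (v : L2) :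
    ‖∫ y in Ioi 0, phase h m y * v y‖ₑ ≤
      ENNReal.ofReal (Real.sqrt (rightIntegral h fun t => (m t).im)) * eLpNorm v 2 volume := by
  have hp := continuous_phase h hm.smooth.continuous
  have hJ := rightIntegral_nonneg h fun t => (m t).im
  have h1 := ENNReal.lintegral_mul_le_Lp_mul_Lq (volume.restrict (Ioi 0))
    Real.HolderConjugate.two_two (f := fun y => ‖phase h m y‖ₑ) (g := fun y => ‖v y‖ₑ)
    hp.enorm.aemeasurable (Lp.stronglyMeasurable v).enorm.aemeasurable
  simp only [ENNReal.rpow_two] at h1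
  rw [hm.lintegral_right hh] at h1
  refine (enorm_integral_le_lintegral_enorm _).trans ?_
  simp_rw [enorm_mul]
  refine h1.trans ?_
  gcongr
  · rw [ENNReal.ofReal_rpow_of_nonneg hJ (by norm_num), Real.sqrt_eq_rpow]
  · calc (∫⁻ y in Ioi 0, ‖v y‖ₑ ^ 2) ^ (1 / 2 : ℝ) ≤ (eLpNorm v 2 volume ^ 2) ^ (1 / 2 : ℝ) := by
          rw [eLpNorm_two_sq]
          gcongr
          exact Measure.restrict_le_self
      _ = _ := by
          rw [← ENNReal.rpow_two, ← ENNReal.rpow_mul]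
          norm_num

/-- The kernel is cut at `0`. The block from `y > 0` to `x ≤ 0` is the rank one kernel `phase(x)⁻¹
phase(y)` up to a constant, and its norm is the product of two `L²` norms. The hypothesis `hD`
concerns only pairs on one side of `0`, and Schur's test bounds those blocks. -/
theorem norm_inverse_le (hm : Confining m c C) {h : ℝ} (hh : 0 < h) {R : L2 →L[ℂ] L2}
    (hR : ∀ v : L2, R v =ᵐ[volume] resolventFun h m v) {D κ : ℝ} (hκ : 0 < κ)
    (hD : ∀ x y, x < y → y ≤ 0 ∨ 0 ≤ x → -(∫ t in x..y, (m t).im) ≤ D - κ * (y - x)) :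
    ‖R‖ ≤ Real.exp (D / h) / κ + 1 / h * Real.sqrt (leftIntegral h fun t => (m t).im) *
      Real.sqrt (rightIntegral h fun t => (m t).im) := by
  have hmc := hm.smooth.continuous
  have hp := continuous_phase h hmc
  set I := leftIntegral h fun t => (m t).im
  set J := rightIntegral h fun t => (m t).im
  have hI : 0 ≤ I := leftIntegral_nonneg _ _
  refine ContinuousLinearMap.opNorm_le_bound _ (by positivity) fun v => ?_
  have hint := hm.integrableOn_phase_mul hh v
  let z : ℂ := -(Complex.I / h) * ∫ y in Ioi 0, phase h m y * v y
  let u₂ : ℝ → ℂ := (Iic 0).indicator fun x => (phase h m x)⁻¹ * z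
  have hu₂m : StronglyMeasurable u₂ :=
    ((hp.inv₀ (phase_ne_zero h m)).stronglyMeasurable.mul
      stronglyMeasurable_const).indicator measurableSet_Iic
  have hum := stronglyMeasurable_resolventFun h hmc (Lp.stronglyMeasurable v)
  have hz : ‖z‖ₑ ≤ ENNReal.ofReal (1 / h * Real.sqrt J) * eLpNorm v 2 volume := by
    rw [enorm_mul, ENNReal.ofReal_mul (by positivity), mul_assoc]
    refine mul_le_mul' ?_ (hm.enorm_setIntegral_phase_mul_le hh v)
    rw [← ofReal_norm]
    simp [abs_of_pos hh]
  have h2 : eLpNorm u₂ 2 volume ≤ ENNReal.ofReal (Real.sqrt I) * ‖z‖ₑ := by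
    apply eLpNorm_two_le
    rw [mul_pow, ← ENNReal.ofReal_pow (Real.sqrt_nonneg _), Real.sq_sqrt hI,
      ← hm.lintegral_left hh, ← lintegral_mul_const' _ _ (by finiteness),
      ← lintegral_indicator measurableSet_Iic]
    refine lintegral_mono fun x => ?_
    by_cases hx : x ∈ Iic (0 : ℝ)
    · simp only [u₂, indicator_of_mem hx, enorm_mul, mul_pow]
      exact le_rfl
    · simp [u₂, indicator_of_notMem hx]
  have h1 : eLpNorm (resolventFun h m v - u₂) 2 volume ≤
      ENNReal.ofReal (Real.exp (D / h) / κ) * eLpNorm v 2 volume := by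
    -- The `1/h` in front of the kernel cancels the `1/h` in the decay rate, so the Schur bound
    -- carries no power of `h`.
    have e : Real.exp (D / h) / κ = (1 / h * Real.exp (D / h)) / (κ / h) := by field_simp
    rw [e]
    have hker : ∀ x y, x < y → y ≤ 0 ∨ 0 ≤ x →
        1 / h * Real.exp (-(∫ t in x..y, (m t).im) / h) ≤
          1 / h * Real.exp (D / h) * Real.exp (-(κ / h * (y - x))) := fun x y hxy hor => by
      rw [mul_assoc, ← Real.exp_add]
      gcongr
      rw [div_mul_eq_mul_div, ← sub_eq_add_neg, ← sub_div]
      gcongr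
      exact hD x y hxy hor
    refine eLpNorm_le_of_exp_kernel (div_pos hκ hh) (Lp.stronglyMeasurable v) (by positivity)
      fun x => ?_
    rcases lt_or_ge 0 x with hx | hx
    · have e0 : (resolventFun h m v - u₂) x = resolventFun h m v x := by
        simp [u₂, hx]
      rw [e0]
      refine (enorm_resolventFun_le hh hmc v x).trans ?_
      refine setLIntegral_mono' measurableSet_Ioi fun y hy => ?_
      gcongr ENNReal.ofReal ?_ * _
      exact hker x y hy (Or.inr hx.le)
    -- For `x ≤ 0`, removing the rank one part amounts to restricting `v` to the left half line, so
    -- only pairs with `y ≤ 0` remain.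
    · have e0 : (resolventFun h m v - u₂) x =
          resolventFun h m ((Iic 0).indicator v) x := by
        have hsplit : ∫ y in Ioi x, phase h m y * v y =
            (∫ y in Ioc x 0, phase h m y * v y) + ∫ y in Ioi 0, phase h m y * v y := by
          rw [← setIntegral_union Ioc_disjoint_Ioi_same measurableSet_Ioi
            ((hint x).mono_set Ioc_subset_Ioi_self) (hint 0), Ioc_union_Ioi_eq_Ioi hx]
        have e1 : ∫ y in Ioi x, phase h m y * (Iic 0).indicator v y =
            ∫ y in Ioc x 0, phase h m y * v y := by
          rw [← Ioi_inter_Iic, ← setIntegral_indicator measurableSet_Iic]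
          refine integral_congr_ae (Filter.Eventually.of_forall fun y => ?_)
          by_cases hy : y ∈ Iic (0 : ℝ)
          · simp [indicator_of_mem hy]
          · simp [indicator_of_notMem hy]
        rw [Pi.sub_apply]
        simp only [u₂, indicator_of_mem (show x ∈ Iic (0 : ℝ) from hx), z]
        rw [resolventFun, resolventFun, e1, hsplit]
        ring
      rw [e0]
      refine (enorm_resolventFun_le hh hmc _ x).trans ?_
      refine setLIntegral_mono' measurableSet_Ioi fun y hy => ?_
      by_cases hy0 : y ∈ Iic (0 : ℝ)
      · rw [indicator_of_mem hy0]
        gcongr ENNReal.ofReal ?_ * _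
        exact hker x y hy (Or.inl hy0)
      · simp [indicator_of_notMem hy0]
  have htot : eLpNorm (resolventFun h m v) 2 volume ≤
      ENNReal.ofReal (Real.exp (D / h) / κ + 1 / h * Real.sqrt I * Real.sqrt J) *
        eLpNorm v 2 volume := by
    calc eLpNorm (resolventFun h m v) 2 volume
        = eLpNorm ((resolventFun h m v - u₂) + u₂) 2 volume := by rw [sub_add_cancel]
      _ ≤ eLpNorm (resolventFun h m v - u₂) 2 volume + eLpNorm u₂ 2 volume :=
          eLpNorm_add_le (hum.sub hu₂m).aestronglyMeasurable hu₂m.aestronglyMeasurable (by norm_num)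
      _ ≤ ENNReal.ofReal (Real.exp (D / h) / κ) * eLpNorm v 2 volume +
          ENNReal.ofReal (Real.sqrt I) *
            (ENNReal.ofReal (1 / h * Real.sqrt J) * eLpNorm v 2 volume) :=
          add_le_add h1 (h2.trans (mul_le_mul_right hz _))
      _ = _ := by
          rw [← mul_assoc, ← ENNReal.ofReal_mul (Real.sqrt_nonneg _), ← add_mul,
            ← ENNReal.ofReal_add (by positivity) (by positivity)]
          congr 2
          ring
  rw [← eLpNorm_congr_ae (hR v)] at htot
  have hpos : 0 ≤ Real.exp (D / h) / κ + 1 / h * Real.sqrt I * Real.sqrt J := by positivity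
  rw [Lp.norm_def, Lp.norm_def, ← ENNReal.toReal_ofReal hpos, ← ENNReal.toReal_mul]
  exact ENNReal.toReal_mono
    (ENNReal.mul_lt_top ENNReal.ofReal_lt_top (Lp.eLpNorm_lt_top v)).ne htot

/-- The optimal vector for the rank one block is the conjugate of the phase, restricted to the right
half line. Its image on `x ≤ 0` is explicit, and discarding the image on `x > 0` loses in the right
direction. -/
theorem le_norm_inverse (hm : Confining m c C) {h : ℝ} (hh : 0 < h) {R : L2 →L[ℂ] L2}
    (hR : ∀ v : L2, R v =ᵐ[volume] resolventFun h m v) :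
    1 / h * Real.sqrt (leftIntegral h fun t => (m t).im) *
      Real.sqrt (rightIntegral h fun t => (m t).im) ≤ ‖R‖ := by
  have hmc := hm.smooth.continuous
  have hp := continuous_phase h hmc
  have hJpos := hm.rightIntegral_pos hh
  have hlI := hm.lintegral_left hh
  have hlJ := hm.lintegral_right hh
  have hI : 0 ≤ leftIntegral h fun t => (m t).im := leftIntegral_nonneg _ _
  have hJdef : rightIntegral h (fun t => (m t).im) = ∫ x in Ioi 0, ‖phase h m x‖ ^ 2 := by
    simp_rw [sq_norm_phase h hmc]
    rfl
  set I := leftIntegral h fun t => (m t).im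
  set J := rightIntegral h fun t => (m t).im
  let v₀ : ℝ → ℂ := (Ioi 0).indicator fun x => (starRingEnd ℂ) (phase h m x)
  have hv₀m : StronglyMeasurable v₀ :=
    (Complex.continuous_conj.comp hp).stronglyMeasurable.indicator measurableSet_Ioi
  have hv₀ : ∫⁻ x, ‖v₀ x‖ₑ ^ 2 = ENNReal.ofReal J := by
    rw [← hlJ, ← lintegral_indicator measurableSet_Ioi]
    refine lintegral_congr fun x => ?_
    by_cases hx : x ∈ Ioi (0 : ℝ)
    · simp only [v₀, indicator_of_mem hx, RCLike.enorm_conj]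
    · simp [v₀, indicator_of_notMem hx]
  have hmem : MemLp v₀ 2 volume := by
    refine ⟨hv₀m.aestronglyMeasurable, ?_⟩
    refine (eLpNorm_two_le (a := ENNReal.ofReal (Real.sqrt J)) ?_).trans_lt ENNReal.ofReal_lt_top
    rw [hv₀, ← ENNReal.ofReal_pow (Real.sqrt_nonneg _), Real.sq_sqrt hJpos.le]
  let v : L2 := hmem.toLp v₀
  have hvv : v =ᵐ[volume] v₀ := hmem.coeFn_toLp
  have hnv : ‖v‖ ^ 2 = J := by
    have : ENNReal.ofReal (‖v‖ ^ 2) = ENNReal.ofReal J := by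
      rw [L2.ofReal_norm_sq, ← hv₀]
      refine lintegral_congr_ae ?_
      filter_upwards [hvv] with x hx
      rw [hx]
    exact (ENNReal.ofReal_eq_ofReal_iff (sq_nonneg _) hJpos.le).mp this
  have hval : ∀ x ≤ 0, resolventFun h m v₀ x = -(Complex.I / h) * J * (phase h m x)⁻¹ := by
    intro x hx
    have e : ∫ y in Ioi x, phase h m y * v₀ y = J := by
      have e1 : ∀ y, phase h m y * v₀ y =
          (Ioi 0).indicator (fun y => ((‖phase h m y‖ ^ 2 : ℝ) : ℂ)) y := fun y => by
        by_cases hy : y ∈ Ioi (0 : ℝ)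
        · simp only [v₀, indicator_of_mem hy]
          rw [Complex.mul_conj, Complex.normSq_eq_norm_sq]
        · simp [v₀, indicator_of_notMem hy]
      simp_rw [e1]
      rw [setIntegral_indicator measurableSet_Ioi, Ioi_inter_Ioi, sup_eq_right.mpr hx,
        integral_complex_ofReal, hJdef]
    rw [resolventFun, e]
    ring
  have hlow : (1 / h * J) ^ 2 * I ≤ ‖R v‖ ^ 2 := by
    rw [← ENNReal.ofReal_le_ofReal_iff (by positivity), L2.ofReal_norm_sq,
      ENNReal.ofReal_mul (by positivity), ← hlI, ← lintegral_const_mul' _ _ ENNReal.ofReal_ne_top]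
    refine le_trans ?_ (setLIntegral_le_lintegral (Iic 0) _)
    refine lintegral_mono_ae ?_
    filter_upwards [self_mem_ae_restrict measurableSet_Iic, ae_restrict_of_ae (hR v)] with x hx hRx
    rw [hRx, resolventFun_congr h m hvv, hval x hx, enorm_mul _ (phase h m x)⁻¹, mul_pow ‖_‖ₑ]
    refine mul_le_mul' ?_ le_rfl
    rw [ENNReal.ofReal_pow (by positivity), ← ofReal_norm]
    refine pow_le_pow_left' (ENNReal.ofReal_le_ofReal ?_) 2
    simp [abs_of_pos hh, abs_of_pos hJpos]
  have hle : ‖R v‖ ^ 2 ≤ ‖R‖ ^ 2 * J := by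
    rw [← hnv, ← mul_pow]
    gcongr
    exact R.le_opNorm v
  have h3 : (1 / h) ^ 2 * I * J ≤ ‖R‖ ^ 2 := by
    have : ((1 / h) ^ 2 * I * J) * J ≤ ‖R‖ ^ 2 * J := by nlinarith
    exact le_of_mul_le_mul_right this hJpos
  refine le_of_sq_le_sq ?_ (norm_nonneg _)
  rwa [mul_pow, mul_pow, Real.sq_sqrt hI, Real.sq_sqrt hJpos.le]

end Confining

/-! ### Exponential remainders and the geometry of one well -/

/-- The factor `1 + e^{-w}` covers both signs of `w`. After multiplication by `e^{-b}` it becomes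
the sum of the exact and the approximating exponential, both of which have Gaussian decay, so `w`
need not be small. -/
theorem abs_exp_neg_sub_one_add_le (w : ℝ) :
    |Real.exp (-w) - 1 + w| ≤ w ^ 2 * (1 + Real.exp (-w)) := by
  have h1 := Real.add_one_le_exp (-w)
  have h2 := Real.add_one_le_exp w
  have hp := Real.exp_pos (-w)
  have hmul : Real.exp (-w) * Real.exp w = 1 := by rw [← Real.exp_add]; simp
  rw [abs_of_nonneg (by linarith)]
  have h3 : Real.exp (-w) * (w + 1) ≤ 1 :=
    (mul_le_mul_of_nonneg_left h2 hp.le).trans_eq hmul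
  rcases le_or_gt 0 w with hw | hw
  · have h4 : Real.exp (-w) * (1 + w) ≤ 1 := by linarith
    have h5 : Real.exp (-w) ≤ 1 / (1 + w) := by
      rw [le_div_iff₀ (by linarith)]; exact h4
    have h6 : 1 / (1 + w) ≤ 1 - w + w ^ 2 := by
      rw [div_le_iff₀ (by linarith)]
      nlinarith [pow_nonneg hw 3]
    nlinarith [mul_nonneg (sq_nonneg w) hp.le]
  · have h7 : Real.exp (-w) - 1 ≤ -w * Real.exp (-w) := by linarith
    have h8 : 0 ≤ -w := by linarith
    have h9 : Real.exp (-w) - 1 + w ≤ -w * (Real.exp (-w) - 1) := by linarith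
    have h10 : -w * (Real.exp (-w) - 1) ≤ -w * (-w * Real.exp (-w)) := by gcongr
    nlinarith [sq_nonneg w]

/-- Comparison of `e^{-a}` with `e^{-b} (1 - X)`, when `a - b = X + Y`. -/
theorem abs_exp_neg_sub_exp_neg_mul_le (b X Y : ℝ) :
    |Real.exp (-(b + X + Y)) - Real.exp (-b) * (1 - X)| ≤
      (|Y| + 2 * X ^ 2 + 2 * Y ^ 2) * (Real.exp (-b) + Real.exp (-(b + X + Y))) := by
  have h := abs_exp_neg_sub_one_add_le (X + Y)
  have hb := Real.exp_pos (-b)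
  have ha := Real.exp_pos (-(b + X + Y))
  have e : Real.exp (-(b + X + Y)) = Real.exp (-b) * Real.exp (-(X + Y)) := by
    rw [← Real.exp_add]; ring_nf
  have e2 : Real.exp (-(b + X + Y)) - Real.exp (-b) * (1 - X) =
      Real.exp (-b) * (Real.exp (-(X + Y)) - 1 + (X + Y)) - Real.exp (-b) * Y := by
    rw [e]; ring
  have hY := abs_nonneg Y
  calc |Real.exp (-(b + X + Y)) - Real.exp (-b) * (1 - X)|
      ≤ Real.exp (-b) * |Real.exp (-(X + Y)) - 1 + (X + Y)| + Real.exp (-b) * |Y| := by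
        rw [e2]
        refine (abs_sub _ _).trans (le_of_eq ?_)
        rw [abs_mul, abs_mul, abs_of_pos hb]
    _ ≤ Real.exp (-b) * ((X + Y) ^ 2 * (1 + Real.exp (-(X + Y)))) + Real.exp (-b) * |Y| := by
        gcongr
    _ = (X + Y) ^ 2 * (Real.exp (-b) + Real.exp (-(b + X + Y))) + Real.exp (-b) * |Y| := by
        rw [e]; ring
    _ ≤ (2 * X ^ 2 + 2 * Y ^ 2) * (Real.exp (-b) + Real.exp (-(b + X + Y))) +
          (Real.exp (-b) + Real.exp (-(b + X + Y))) * |Y| := by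
        gcongr
        · nlinarith [sq_nonneg (X - Y)]
        · linarith
    _ = _ := by ring

/-- Quantitative description of a function `q` near its only zero `x₀` on the left half line; the
size of `q` is governed by the parameter `s`, and `K` is uniform. -/
structure LeftWell (q : ℝ → ℝ) (s x₀ σ c₃ K : ℝ) : Prop where
  cont : Continuous q
  s_pos : 0 < s
  s_le : s ≤ 1
  one_le_K : 1 ≤ K
  x₀_le : x₀ ≤ -(s / K)
  le_x₀ : -(K * s) ≤ x₀
  le_σ : s / K ≤ σ
  σ_le : σ ≤ K * s
  left : ∀ y ≤ x₀, s / K * (x₀ - y) ≤ q y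
  right : ∀ y, x₀ ≤ y → y ≤ 0 → s / K * (y - x₀) ≤ -q y
  right_upper : ∀ y, x₀ ≤ y → y ≤ 0 → -q y ≤ K * s ^ 2
  c₃_le : |c₃| ≤ K
  taylor : ∀ x ≤ 0, |x - x₀| ≤ 1 / K →
    |(∫ t in x₀..x, q t) + σ / 2 * (x - x₀) ^ 2 - c₃ * (x - x₀) ^ 3| ≤ K * (x - x₀) ^ 4

theorem integral_mul_sub_const (k a b z : ℝ) :
    ∫ y in a..b, k * (y - z) = k * ((b - z) ^ 2 - (a - z) ^ 2) / 2 := by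
  rw [intervalIntegral.integral_const_mul, intervalIntegral.integral_comp_sub_right (fun y => y),
    integral_id]
  ring

namespace LeftWell

variable {q : ℝ → ℝ} {s x₀ σ c₃ K : ℝ}

theorem K_pos (hw : LeftWell q s x₀ σ c₃ K) : 0 < K := lt_of_lt_of_le one_pos hw.one_le_K

theorem σ_pos (hw : LeftWell q s x₀ σ c₃ K) : 0 < σ :=
  lt_of_lt_of_le (div_pos hw.s_pos hw.K_pos) hw.le_σ

theorem x₀_neg (hw : LeftWell q s x₀ σ c₃ K) : x₀ < 0 := by
  have := div_pos hw.s_pos hw.K_pos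
  linarith [hw.x₀_le]

/-- The linear bounds on the two sides of `x₀` integrate to the same parabola. It is the Gaussian
majorant, valid on the whole left half line, for Laplace's method. -/
theorem integral_le (hw : LeftWell q s x₀ σ c₃ K) {x : ℝ} (hx : x ≤ 0) :
    ∫ t in x₀..x, q t ≤ -(s / (2 * K) * (x - x₀) ^ 2) := by
  have hK := hw.K_pos
  have hi : ∀ a b : ℝ, IntervalIntegrable q volume a b := fun a b => hw.cont.intervalIntegrable a b
  have hi' : ∀ k a b : ℝ, IntervalIntegrable (fun y => k * (y - x₀)) volume a b := fun k a b =>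
    Continuous.intervalIntegrable (by fun_prop) a b
  rcases le_total x₀ x with h | h
  · have h1 : ∫ t in x₀..x, q t ≤ ∫ t in x₀..x, -(s / K) * (t - x₀) :=
      intervalIntegral.integral_mono_on h (hi _ _) (hi' _ _ _) fun y hy => by
        linarith [hw.right y hy.1 (hy.2.trans hx)]
    rw [integral_mul_sub_const] at h1
    refine h1.trans (le_of_eq ?_)
    field_simp
    ring
  · have h1 : ∫ t in x..x₀, -(s / K) * (t - x₀) ≤ ∫ t in x..x₀, q t :=
      intervalIntegral.integral_mono_on h (hi' _ _ _) (hi _ _) fun y hy => by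
        linarith [hw.left y hy.2]
    rw [integral_mul_sub_const] at h1
    rw [intervalIntegral.integral_symm]
    have e : -(s / K) * ((x₀ - x₀) ^ 2 - (x - x₀) ^ 2) / 2 = s / (2 * K) * (x - x₀) ^ 2 := by
      field_simp
      ring
    linarith

/-- The parabola of `integral_le` has curvature `s/K` and is evaluated at distance at least `s/K`
from its vertex; whence the order `s³`. -/
theorem integral_zero_ge (hw : LeftWell q s x₀ σ c₃ K) :
    s ^ 3 / (2 * K ^ 3) ≤ ∫ t in (0 : ℝ)..x₀, q t := by
  have hK := hw.K_pos
  have hs := hw.s_pos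
  have h1 := hw.integral_le le_rfl
  rw [intervalIntegral.integral_symm]
  have h2 : (s / K) ^ 2 ≤ (0 - x₀) ^ 2 := by
    have := hw.x₀_le
    have : 0 < s / K := div_pos hs hK
    gcongr
    linarith
  have h3 : s / (2 * K) * (s / K) ^ 2 ≤ s / (2 * K) * (0 - x₀) ^ 2 := by gcongr
  have e : s ^ 3 / (2 * K ^ 3) = s / (2 * K) * (s / K) ^ 2 := by
    field_simp
  linarith

theorem integral_zero_le (hw : LeftWell q s x₀ σ c₃ K) :
    ∫ t in (0 : ℝ)..x₀, q t ≤ K ^ 2 * s ^ 3 := by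
  have hK := hw.K_pos
  have hs := hw.s_pos
  have h1 : ∫ t in x₀..0, -(K * s ^ 2) ≤ ∫ t in x₀..0, q t :=
    intervalIntegral.integral_mono_on hw.x₀_neg.le (by simp) (hw.cont.intervalIntegrable _ _)
      fun y hy => by linarith [hw.right_upper y hy.1 hy.2]
  rw [intervalIntegral.integral_const, smul_eq_mul] at h1
  rw [intervalIntegral.integral_symm]
  have h2 : K * s ^ 2 * (-x₀) ≤ K * s ^ 2 * (K * s) := by
    gcongr
    linarith [hw.le_x₀]
  nlinarith

/-- Below the zero `x₀`, and between `x₀` and `0`, the primitive of `q` increases and decreases,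
respectively. -/
theorem neg_integral_le (hw : LeftWell q s x₀ σ c₃ K) {κ : ℝ} (hκ : 0 < κ)
    (hκs : κ ≤ s ^ 2 / (8 * K ^ 4)) {x y : ℝ} (hxy : x ≤ y) (hy : y ≤ 0) :
    ∫ t in x..y, (κ - q t) ≤ (∫ t in (0 : ℝ)..x₀, q t) + s ^ 3 / (4 * K ^ 3) := by
  have hK := hw.K_pos
  have hK1 := hw.one_le_K
  have hs := hw.s_pos
  have hx₀ := hw.x₀_neg
  have hi : ∀ a b : ℝ, IntervalIntegrable (fun t => κ - q t) volume a b := fun a b =>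
    (continuous_const.sub hw.cont).intervalIntegrable a b
  have hΛ0 : 0 ≤ ∫ t in (0 : ℝ)..x₀, q t := le_trans (by positivity) hw.integral_zero_ge
  have hκ' : κ * K ≤ s ^ 2 / (8 * K ^ 3) := by
    calc κ * K ≤ s ^ 2 / (8 * K ^ 4) * K := by gcongr
      _ = _ := by field_simp
  have hκ1 : κ ≤ s ^ 2 := by
    refine hκs.trans (div_le_self (sq_nonneg s) ?_)
    linarith [one_le_pow₀ hK1 (n := 4)]
  -- Left of `x₀` the integrand can be positive only where `q < κ`, that is to the right of `x₀ - κ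
  -- K / s`, where the lower bound for `q` equals `κ`.
  have hleft : ∀ a b, a ≤ b → b ≤ x₀ → ∫ t in a..b, (κ - q t) ≤ s ^ 3 / (8 * K ^ 3) := by
    intro a b hab hb
    have h1 : ∫ t in a..b, (κ - q t) ≤ ∫ t in a..b, (s / K) * (t - (x₀ - κ * K / s)) := by
      refine intervalIntegral.integral_mono_on hab (hi a b)
        (Continuous.intervalIntegrable (by fun_prop) a b) fun t ht => ?_
      have h2 := hw.left t (ht.2.trans hb)
      have e : s / K * (t - (x₀ - κ * K / s)) = κ - s / K * (x₀ - t) := by field_simp; ring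
      linarith
    rw [integral_mul_sub_const] at h1
    refine h1.trans ?_
    have h3 : (b - (x₀ - κ * K / s)) ^ 2 - (a - (x₀ - κ * K / s)) ^ 2 ≤ (κ * K / s) ^ 2 := by
      rcases le_or_gt 0 (b - (x₀ - κ * K / s)) with h4 | h4
      · have : (b - (x₀ - κ * K / s)) ^ 2 ≤ (κ * K / s) ^ 2 := by
          gcongr
          linarith
        nlinarith [sq_nonneg (a - (x₀ - κ * K / s))]
      · nlinarith [sq_nonneg (κ * K / s)]
    calc s / K * ((b - (x₀ - κ * K / s)) ^ 2 - (a - (x₀ - κ * K / s)) ^ 2) / 2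
        ≤ s / K * (κ * K / s) ^ 2 / 2 := by gcongr
      _ = κ * (κ * K) / (2 * s) := by field_simp
      _ ≤ s ^ 2 * (s ^ 2 / (8 * K ^ 3)) / (2 * s) := by gcongr
      _ = s ^ 3 / (8 * K ^ 3) / 2 := by field_simp
      _ ≤ _ := half_le_self (by positivity)
  -- Between `x₀` and `0` the integrand is nonnegative, so the interval may be enlarged to `[x₀,
  -- 0]`. The upper bound on `κ` limits the loss here, as on the left, to `s³/(8K³)`; the total is
  -- half of the least depth in `integral_zero_ge`.
  have hright : ∀ a b, x₀ ≤ a → a ≤ b → b ≤ 0 →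
      ∫ t in a..b, (κ - q t) ≤ (∫ t in (0 : ℝ)..x₀, q t) + s ^ 3 / (8 * K ^ 3) := by
    intro a b ha hab hb
    have h1 : ∫ t in a..b, (κ - q t) ≤ ∫ t in x₀..0, (κ - q t) := by
      refine intervalIntegral.integral_mono_interval ha hab hb ?_ (hi _ _)
      filter_upwards [self_mem_ae_restrict measurableSet_Ioc] with t ht
      have := hw.right t ht.1.le ht.2
      have h2 : 0 ≤ s / K * (t - x₀) := mul_nonneg (by positivity) (by linarith [ht.1])
      simp only [Pi.zero_apply]
      linarith
    have h2 : ∫ t in x₀..0, (κ - q t) = (0 - x₀) * κ + ∫ t in (0 : ℝ)..x₀, q t := by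
      rw [intervalIntegral.integral_sub (by simp) (hw.cont.intervalIntegrable _ _),
        intervalIntegral.integral_const, smul_eq_mul, intervalIntegral.integral_symm 0 x₀,
        sub_neg_eq_add]
    have h3 : (0 - x₀) * κ ≤ s ^ 3 / (8 * K ^ 3) := by
      calc (0 - x₀) * κ ≤ (K * s) * κ := by
            gcongr
            linarith [hw.le_x₀]
        _ = s * (κ * K) := by ring
        _ ≤ s * (s ^ 2 / (8 * K ^ 3)) := by gcongr
        _ = _ := by ring
    linarith
  have e : s ^ 3 / (4 * K ^ 3) = s ^ 3 / (8 * K ^ 3) + s ^ 3 / (8 * K ^ 3) := by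
    field_simp; norm_num
  have hp : 0 ≤ s ^ 3 / (8 * K ^ 3) := by positivity
  rcases le_total y x₀ with h | h
  · linarith [hleft x y hxy h]
  rcases le_total x₀ x with h' | h'
  · linarith [hright x y h' hxy hy]
  rw [← intervalIntegral.integral_add_adjacent_intervals (hi x x₀) (hi x₀ y)]
  linarith [hleft x x₀ h' le_rfl, hright x₀ y le_rfl h hy]

end LeftWell

/-! ### Laplace's method, uniformly in the size of the well -/

theorem integrable_gaussian_mul_one_add_cube {β : ℝ} (hβ : 0 < β) (k : ℝ) :
    Integrable fun t : ℝ => Real.exp (-β * t ^ 2) * (1 + k * t ^ 3) := by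
  have h1 := integrable_exp_neg_mul_sq hβ
  have h2 := integrable_rpow_mul_exp_neg_mul_sq hβ (s := (3 : ℕ)) (by norm_num)
  simp_rw [Real.rpow_natCast] at h2
  refine (h1.add (h2.const_mul k)).congr (Filter.Eventually.of_forall fun t => ?_)
  simp only [Pi.add_apply]
  ring

/-- The cubic is odd and drops out. This cancellation improves the relative error from
`(h/s³)^{1/2}` to `h/s³`. -/
theorem integral_gaussian_mul_one_add_cube {β : ℝ} (hβ : 0 < β) (k : ℝ) :
    ∫ t : ℝ, Real.exp (-β * t ^ 2) * (1 + k * t ^ 3) = Real.sqrt (Real.pi / β) := by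
  have hk := integrable_gaussian_mul_one_add_cube hβ k
  have hk' := integrable_gaussian_mul_one_add_cube hβ (-k)
  have e : ∫ t : ℝ, Real.exp (-β * t ^ 2) * (1 + k * t ^ 3) =
      ∫ t : ℝ, Real.exp (-β * t ^ 2) * (1 + -k * t ^ 3) := by
    rw [← integral_neg_eq_self]
    refine integral_congr_ae (Filter.Eventually.of_forall fun t => ?_)
    simp only [neg_sq]
    ring
  have h2 : (∫ t : ℝ, Real.exp (-β * t ^ 2) * (1 + k * t ^ 3)) +
      ∫ t : ℝ, Real.exp (-β * t ^ 2) * (1 + -k * t ^ 3) = 2 * Real.sqrt (Real.pi / β) := by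
    rw [← integral_add hk hk', ← integral_gaussian, ← integral_const_mul]
    refine integral_congr_ae (Filter.Eventually.of_forall fun t => ?_)
    ring
  linarith

theorem one_add_pow_four_mul_exp_le {K τ : ℝ} (hK : 0 < K) (hτ : 0 ≤ τ) :
    (1 + τ ^ 4) * Real.exp (-(τ / (2 * K))) ≤
      (1 + 24 * (4 * K) ^ 4) * Real.exp (-(τ / (4 * K))) := by
  have h1 := Real.pow_div_factorial_le_exp (τ / (4 * K)) (by positivity) 4
  have h2 := Real.one_le_exp (x := τ / (4 * K)) (by positivity)
  have e : Real.exp (-(τ / (2 * K))) =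
      Real.exp (-(τ / (4 * K))) * Real.exp (-(τ / (4 * K))) := by
    rw [← Real.exp_add]
    congr 1
    field_simp
    ring
  have h3 : 1 + τ ^ 4 ≤ (1 + 24 * (4 * K) ^ 4) * Real.exp (τ / (4 * K)) := by
    rw [div_pow, div_div, div_le_iff₀ (by positivity)] at h1
    norm_num [Nat.factorial] at h1
    nlinarith
  rw [e, ← mul_assoc]
  gcongr
  rwa [Real.exp_neg, ← div_eq_mul_inv, div_le_iff₀ (Real.exp_pos _)]

theorem pow_le_one_add_pow_four {τ : ℝ} (hτ : 0 ≤ τ) {n : ℕ} (hn : n ≤ 4) :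
    τ ^ n ≤ 1 + τ ^ 4 := by
  rcases le_total τ 1 with h | h
  · linarith [pow_le_one₀ hτ h (n := n), pow_nonneg hτ 4]
  · linarith [pow_le_pow_right₀ h hn]

section Pointwise

variable {K G s ε τ t σ c₃ φ η : ℝ}

/-- The scaling is `h = ε s³` and `τ = s t²/h`, so `ε` is the small parameter and `τ` the squared
rescaled distance. The perturbation `2 h η` is split by `|t| ≤ 1 + t²` into a constant and a
quadratic part; the condition `4 G K s ≤ 1` lets half of the Gaussian decay absorb the latter. -/
theorem exp_neg_add_le (hK : 1 ≤ K) (hG : 0 ≤ G) (hs : 0 < s) (hs1 : s ≤ 1) (hε : 0 < ε)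
    (hε1 : ε ≤ 1) (hGs : 4 * G * K * s ≤ 1) (hτ : 0 ≤ τ) (ht : t ^ 2 = τ * ε * s ^ 2)
    (hφ : s / (2 * K) * t ^ 2 ≤ φ) (hη : |η| ≤ G * (|t| + K)) :
    Real.exp (-(2 * φ / (ε * s ^ 3)) + 2 * (ε * s ^ 3) * η) ≤
      Real.exp (2 * G * (K + 1)) * Real.exp (-(τ / (2 * K))) := by
  have hK0 : 0 < K := by linarith
  rw [← Real.exp_add]
  apply Real.exp_le_exp.mpr
  have h1 : τ / K ≤ 2 * φ / (ε * s ^ 3) := by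
    rw [ht] at hφ
    rw [div_le_div_iff₀ hK0 (by positivity)]
    have : s / (2 * K) * (τ * ε * s ^ 2) * (2 * K) ≤ φ * (2 * K) := by gcongr
    have e : s / (2 * K) * (τ * ε * s ^ 2) * (2 * K) = τ * (ε * s ^ 3) := by field_simp
    linarith
  have h0 : ε * s ^ 3 ≤ 1 := mul_le_one₀ hε1 (by positivity) (pow_le_one₀ hs.le hs1)
  have h2 : |t| ≤ 1 + t ^ 2 := by
    rw [← sq_abs]
    nlinarith [sq_nonneg (|t| - 1), abs_nonneg t]
  have h3 : 2 * (ε * s ^ 3) * η ≤ 2 * (ε * s ^ 3) * (G * (1 + t ^ 2 + K)) := by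
    gcongr
    refine (le_abs_self η).trans (hη.trans ?_)
    gcongr
  have h4 : 2 * (ε * s ^ 3) * (G * (1 + K)) ≤ 2 * 1 * (G * (1 + K)) := by gcongr
  have h5 : 2 * (ε * s ^ 3) * G * t ^ 2 ≤ τ / (2 * K) := by
    have h6 : 2 * (ε * s ^ 3) * G * t ^ 2 ≤ 2 * 1 * G * (τ * 1 * (s * 1)) := by
      rw [ht]
      gcongr
      · nlinarith
    rw [le_div_iff₀ (by positivity)]
    have h7 : 2 * 1 * G * (τ * 1 * (s * 1)) * (2 * K) = τ * (4 * G * K * s) := by ring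
    calc 2 * (ε * s ^ 3) * G * t ^ 2 * (2 * K) ≤ 2 * 1 * G * (τ * 1 * (s * 1)) * (2 * K) := by
          gcongr
      _ = τ * (4 * G * K * s) := h7
      _ ≤ τ * 1 := by gcongr
      _ = τ := mul_one _
  have e : τ / K = τ / (2 * K) + τ / (2 * K) := by field_simp; norm_num
  nlinarith

theorem exp_neg_mul_sq_div_le (hK : 1 ≤ K) (hs : 0 < s) (hε : 0 < ε) (hτ : 0 ≤ τ)
    (ht : t ^ 2 = τ * ε * s ^ 2) (hσ : s / K ≤ σ) :
    Real.exp (-(σ / (ε * s ^ 3)) * t ^ 2) ≤ Real.exp (-(τ / (2 * K))) := by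
  have hK0 : 0 < K := by linarith
  apply Real.exp_le_exp.mpr
  have h1 : s / K / (ε * s ^ 3) * t ^ 2 ≤ σ / (ε * s ^ 3) * t ^ 2 := by gcongr
  have e : s / K / (ε * s ^ 3) * t ^ 2 = τ / K := by rw [ht]; field_simp
  have e2 : τ / (2 * K) ≤ τ / K := by
    gcongr
    linarith
  linarith

/-- The exponent is expanded with `X = -2 c₃ t³/h`, of order `τ^{3/2} ε^{1/2}`, and a remainder `Y`
of order `(1 + τ²) ε`, formed by the quartic Taylor error and the perturbation. Only the linear term
in `X` exceeds order `ε` and has to be kept; `X²`, `Y` and `Y²` are at most `ε (1 + τ⁴)` up to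
constants. -/
theorem exists_near_bound (hK : 1 ≤ K) (hG : 0 ≤ G) : ∃ M : ℝ, 0 ≤ M ∧
    ∀ {s ε τ t σ c₃ φ η : ℝ}, 0 < s → s ≤ 1 → 0 < ε → ε ≤ 1 → 4 * G * K * s ≤ 1 → 0 ≤ τ →
    t ^ 2 = τ * ε * s ^ 2 → s / K ≤ σ → |c₃| ≤ K → s / (2 * K) * t ^ 2 ≤ φ →
    |η| ≤ G * (|t| + K) → |t| ≤ 1 → |-φ + σ / 2 * t ^ 2 - c₃ * t ^ 3| ≤ K * t ^ 4 →
    |Real.exp (-(2 * φ / (ε * s ^ 3)) + 2 * (ε * s ^ 3) * η) -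
      Real.exp (-(σ / (ε * s ^ 3)) * t ^ 2) * (1 + 2 * c₃ / (ε * s ^ 3) * t ^ 3)| ≤
      M * ε * ((1 + τ ^ 4) * Real.exp (-(τ / (2 * K)))) := by
  have hK0 : 0 < K := by linarith
  refine ⟨(2 * K + 2 * G * (1 + K) + 8 * K ^ 2 + 4 * (4 * K ^ 2 + 4 * (G * (1 + K)) ^ 2)) *
    (1 + Real.exp (2 * G * (K + 1))), by positivity, ?_⟩
  intro s ε τ t σ c₃ φ η hs hs1 hε hε1 hGs hτ ht hσ hc hφ hη ht1 hT
  have hh : 0 < ε * s ^ 3 := by positivity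
  set h := ε * s ^ 3 with hdef
  obtain ⟨ρ, hρ⟩ : ∃ ρ, φ = σ / 2 * t ^ 2 - c₃ * t ^ 3 + ρ := ⟨φ - (σ / 2 * t ^ 2 - c₃ * t ^ 3), by ring⟩
  have hρ' : |ρ| ≤ K * t ^ 4 := by
    rw [← abs_neg]
    refine le_trans (le_of_eq ?_) hT
    rw [hρ]
    ring_nf
  have hs3 : s ^ 3 ≤ 1 := pow_le_one₀ hs.le hs1
  have key := abs_exp_neg_sub_exp_neg_mul_le (σ / h * t ^ 2) (-(2 * c₃ / h * t ^ 3))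
    (2 * ρ / h - 2 * h * η)
  have e1 : -(σ / h * t ^ 2 + -(2 * c₃ / h * t ^ 3) + (2 * ρ / h - 2 * h * η)) =
      -(2 * φ / h) + 2 * h * η := by
    rw [hρ]
    field_simp
    ring
  rw [e1, sub_neg_eq_add, ← neg_mul] at key
  refine key.trans ?_
  have hb := exp_neg_mul_sq_div_le hK hs hε hτ ht hσ
  have ha := exp_neg_add_le hK hG hs hs1 hε hε1 hGs hτ ht hφ hη
  rw [← hdef] at ha hb
  have hY : |2 * ρ / h - 2 * h * η| ≤ (2 * K * τ ^ 2 + 2 * (G * (1 + K))) * ε := by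
    have h1 : |2 * ρ / h| ≤ 2 * K * τ ^ 2 * ε := by
      rw [abs_div, abs_mul, abs_of_pos hh, div_le_iff₀ hh, abs_two]
      calc 2 * |ρ| ≤ 2 * (K * t ^ 4) := by gcongr
        _ = 2 * K * (τ ^ 2 * ε ^ 2 * s ^ 3 * s) := by
          have : t ^ 4 = (t ^ 2) ^ 2 := by ring
          rw [this, ht]; ring
        _ ≤ 2 * K * (τ ^ 2 * ε ^ 2 * s ^ 3 * 1) := by gcongr
        _ = _ := by rw [hdef]; ring
    have h2 : |2 * h * η| ≤ 2 * (G * (1 + K)) * ε := by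
      rw [abs_mul, abs_of_pos (by positivity)]
      have h3 : h ≤ ε := by
        rw [hdef]
        exact mul_le_of_le_one_right hε.le hs3
      calc 2 * h * |η| ≤ 2 * ε * (G * (1 + K)) := by
            gcongr
            exact hη.trans (by gcongr)
        _ = _ := by ring
    calc _ ≤ |2 * ρ / h| + |2 * h * η| := abs_sub _ _
      _ ≤ _ := by linarith
  have hX : (-(2 * c₃ / h * t ^ 3)) ^ 2 ≤ 4 * K ^ 2 * τ ^ 3 * ε := by
    have e : (-(2 * c₃ / h * t ^ 3)) ^ 2 = 4 * c₃ ^ 2 * τ ^ 3 * ε := by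
      have : t ^ 6 = (t ^ 2) ^ 3 := by ring
      have e3 : (-(2 * c₃ / h * t ^ 3)) ^ 2 = 4 * c₃ ^ 2 * t ^ 6 / h ^ 2 := by ring
      rw [e3, this, ht, hdef]
      field_simp
    rw [e]
    have : c₃ ^ 2 ≤ K ^ 2 := sq_le_sq' (by linarith [neg_abs_le c₃]) ((le_abs_self _).trans hc)
    gcongr
  have hY2 : (2 * ρ / h - 2 * h * η) ^ 2 ≤
      (8 * K ^ 2 * τ ^ 4 + 8 * (G * (1 + K)) ^ 2) * ε := by
    rw [← sq_abs]
    calc |2 * ρ / h - 2 * h * η| ^ 2 ≤ ((2 * K * τ ^ 2 + 2 * (G * (1 + K))) * ε) ^ 2 := by gcongr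
      _ = (2 * K * τ ^ 2 + 2 * (G * (1 + K))) ^ 2 * (ε * ε) := by ring
      _ ≤ (8 * K ^ 2 * τ ^ 4 + 8 * (G * (1 + K)) ^ 2) * (1 * ε) := by
        gcongr
        exact add_sq_le.trans_eq (by ring)
      _ = _ := by ring
  have hτ4 : 0 ≤ τ ^ 4 := by positivity
  have hτ2 := pow_le_one_add_pow_four hτ (n := 2) (by norm_num)
  have hτ3 := pow_le_one_add_pow_four hτ (n := 3) (by norm_num)
  have hGK : 0 ≤ G * (1 + K) := by positivity
  have hsum : |2 * ρ / h - 2 * h * η| + 2 * (-(2 * c₃ / h * t ^ 3)) ^ 2 +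
      2 * (2 * ρ / h - 2 * h * η) ^ 2 ≤ (2 * K + 2 * G * (1 + K) + 8 * K ^ 2 +
        4 * (4 * K ^ 2 + 4 * (G * (1 + K)) ^ 2)) * (1 + τ ^ 4) * ε := by
    calc _ ≤ (2 * K * τ ^ 2 + 2 * (G * (1 + K))) * ε + 2 * (4 * K ^ 2 * τ ^ 3 * ε) +
          2 * ((8 * K ^ 2 * τ ^ 4 + 8 * (G * (1 + K)) ^ 2) * ε) := by gcongr
      _ = (2 * K * τ ^ 2 + 2 * (G * (1 + K)) * 1 + 8 * K ^ 2 * τ ^ 3 + 16 * K ^ 2 * τ ^ 4 +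
          16 * (G * (1 + K)) ^ 2 * 1) * ε := by ring
      _ ≤ (2 * K * (1 + τ ^ 4) + 2 * (G * (1 + K)) * (1 + τ ^ 4) + 8 * K ^ 2 * (1 + τ ^ 4) +
          16 * K ^ 2 * (1 + τ ^ 4) + 16 * (G * (1 + K)) ^ 2 * (1 + τ ^ 4)) * ε := by
        gcongr <;> linarith
      _ = _ := by ring
  calc _ ≤ ((2 * K + 2 * G * (1 + K) + 8 * K ^ 2 + 4 * (4 * K ^ 2 + 4 * (G * (1 + K)) ^ 2)) *
        (1 + τ ^ 4) * ε) * (Real.exp (-(τ / (2 * K))) +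
          Real.exp (2 * G * (K + 1)) * Real.exp (-(τ / (2 * K)))) := by gcongr
    _ = _ := by ring

/-- At distance at least `s/K` one has `K² τ ε ≥ 1`, so a factor `ε` can be bought with a power of
`τ` and no cancellation between the two terms is needed. Here `w` will be either the true integrand
or `0`, beyond the end of the half line. -/
theorem far_bound (hK : 1 ≤ K) (hs : 0 < s) (hε : 0 < ε) (hτ : 0 ≤ τ) (ht : t ^ 2 = τ * ε * s ^ 2)
    (hσ : s / K ≤ σ) (hc : |c₃| ≤ K) {w : ℝ} (hw0 : 0 ≤ w)
    (hw : w ≤ Real.exp (2 * G * (K + 1)) * Real.exp (-(τ / (2 * K)))) (htK : s / K ≤ |t|) :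
    |w - Real.exp (-(σ / (ε * s ^ 3)) * t ^ 2) * (1 + 2 * c₃ / (ε * s ^ 3) * t ^ 3)| ≤
      (Real.exp (2 * G * (K + 1)) + 3) * K ^ 2 * ε *
        ((1 + τ ^ 4) * Real.exp (-(τ / (2 * K)))) := by
  have hK0 : 0 < K := by linarith
  have hb := exp_neg_mul_sq_div_le hK hs hε hτ ht hσ
  set P := Real.exp (2 * G * (K + 1))
  have hP : 0 < P := Real.exp_pos _
  set E := Real.exp (-(τ / (2 * K)))
  have hE : 0 < E := Real.exp_pos _
  set B := Real.exp (-(σ / (ε * s ^ 3)) * t ^ 2)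
  have hB : 0 < B := Real.exp_pos _
  have h1 : 1 ≤ K ^ 2 * τ * ε := by
    have h2 : (s / K) ^ 2 ≤ |t| ^ 2 := by gcongr
    rw [sq_abs, ht, div_pow, div_le_iff₀ (by positivity)] at h2
    have h3 : s ^ 2 * 1 ≤ s ^ 2 * (K ^ 2 * τ * ε) := by nlinarith
    exact le_of_mul_le_mul_left h3 (by positivity)
  have hX : |2 * c₃ / (ε * s ^ 3) * t ^ 3| ≤ 2 * K ^ 2 * τ ^ 2 * ε := by
    have h2 : s * |t| ^ 3 ≤ K * t ^ 4 := by
      rw [div_le_iff₀ hK0] at htK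
      have e : t ^ 4 = |t| ^ 4 := (Even.pow_abs (by decide) t).symm
      rw [e]
      calc s * |t| ^ 3 ≤ (|t| * K) * |t| ^ 3 := by gcongr
        _ = _ := by ring
    have h3 : t ^ 4 = τ ^ 2 * ε ^ 2 * s ^ 4 := by
      have : t ^ 4 = (t ^ 2) ^ 2 := by ring
      rw [this, ht]; ring
    rw [abs_mul, abs_div, abs_mul, abs_two, abs_pow, abs_of_pos (show 0 < ε * s ^ 3 by positivity),
      div_mul_eq_mul_div, div_le_iff₀ (by positivity)]
    have h4 : s * (2 * |c₃| * |t| ^ 3) ≤ s * (2 * K ^ 2 * τ ^ 2 * ε * (ε * s ^ 3)) := by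
      calc s * (2 * |c₃| * |t| ^ 3) = 2 * |c₃| * (s * |t| ^ 3) := by ring
        _ ≤ 2 * K * (K * t ^ 4) := by gcongr
        _ = _ := by rw [h3]; ring
    exact le_of_mul_le_mul_left h4 hs
  have hτ1 : τ ≤ 1 + τ ^ 4 := by simpa using pow_le_one_add_pow_four hτ (n := 1) (by norm_num)
  have hτ2 := pow_le_one_add_pow_four hτ (n := 2) (by norm_num)
  calc |w - B * (1 + 2 * c₃ / (ε * s ^ 3) * t ^ 3)|
      ≤ |w| + |B * (1 + 2 * c₃ / (ε * s ^ 3) * t ^ 3)| := abs_sub _ _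
    _ ≤ w + B * (1 + |2 * c₃ / (ε * s ^ 3) * t ^ 3|) := by
        rw [abs_of_nonneg hw0, abs_mul, abs_of_pos hB]
        gcongr
        exact (abs_add_le _ _).trans (by rw [abs_one])
    _ ≤ P * E + E * (1 + 2 * K ^ 2 * τ ^ 2 * ε) := by gcongr
    _ = ((P + 1) * 1 + 2 * K ^ 2 * τ ^ 2 * ε) * E := by ring
    _ ≤ ((P + 1) * (K ^ 2 * τ * ε) + 2 * K ^ 2 * τ ^ 2 * ε) * E := by gcongr
    _ ≤ ((P + 1) * (K ^ 2 * (1 + τ ^ 4) * ε) + 2 * K ^ 2 * (1 + τ ^ 4) * ε) * E := by gcongr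
    _ = _ := by ring

end Pointwise

/-- Laplace's method at the maximum `x₀` of the primitive of `q`, with uniform constants. -/
theorem LeftWell.exists_laplace {K G : ℝ} (hK : 1 ≤ K) (hG : 0 ≤ G) : ∃ C : ℝ, 0 ≤ C ∧
    ∀ {q : ℝ → ℝ} {s x₀ σ c₃ : ℝ}, LeftWell q s x₀ σ c₃ K → ∀ {γ : ℝ → ℝ}, Continuous γ →
    (∀ x, |γ x| ≤ G) → ∀ {h : ℝ}, 0 < h → h ≤ s ^ 3 → 4 * G * K * s ≤ 1 →
    |leftIntegral h (fun t => q t + h ^ 2 * γ t) -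
      Real.exp (2 * (∫ t in (0 : ℝ)..x₀, q t) / h) * Real.sqrt (Real.pi * h / σ)| ≤
      C * (h / s ^ 3) *
        (Real.exp (2 * (∫ t in (0 : ℝ)..x₀, q t) / h) * Real.sqrt (Real.pi * h / σ)) := by
  have hK0 : 0 < K := by linarith
  obtain ⟨M, hM, hnear⟩ := exists_near_bound hK hG
  set P := Real.exp (2 * G * (K + 1)) with hP
  have hP0 : 0 < P := Real.exp_pos _
  set M' := M + (P + 3) * K ^ 2
  have hM' : 0 ≤ M' := by positivity
  set N := M' * (1 + 24 * (4 * K) ^ 4)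
  have hN : 0 ≤ N := by positivity
  refine ⟨N * (2 * K), by positivity, ?_⟩
  intro q s x₀ σ c₃ hw γ hγ hγG h hh hhs hGs
  have hs := hw.s_pos
  have hσ := hw.σ_pos
  have hqi : ∀ a b : ℝ, IntervalIntegrable q volume a b := fun a b => hw.cont.intervalIntegrable a b
  have hγi : ∀ a b : ℝ, IntervalIntegrable γ volume a b := fun a b => hγ.intervalIntegrable a b
  set Φ := ∫ t in (0 : ℝ)..x₀, q t
  -- Coordinates centred at the well, `x = x₀ + t`: `φ` is the drop of the primitive of `q` from its
  -- maximum, `η` the primitive of the perturbation, and `V` the Gaussian with its cubic correction.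
  let φ : ℝ → ℝ := fun t => -∫ y in x₀..(x₀ + t), q y
  let η : ℝ → ℝ := fun t => ∫ y in (0 : ℝ)..(x₀ + t), γ y
  let U : ℝ → ℝ := fun t => Real.exp (-(2 * φ t / h) + 2 * h * η t)
  let u : ℝ → ℝ := (Iic (-x₀)).indicator U
  let V : ℝ → ℝ := fun t => Real.exp (-(σ / h) * t ^ 2) * (1 + 2 * c₃ / h * t ^ 3)
  have hUc : Continuous U := by
    have h1 : Continuous φ := (intervalIntegral.continuous_primitive hqi x₀).neg.comp
      (continuous_const.add continuous_id)
    have h2 : Continuous η := (intervalIntegral.continuous_primitive hγi 0).comp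
      (continuous_const.add continuous_id)
    fun_prop
  have hleft : leftIntegral h (fun t => q t + h ^ 2 * γ t) =
      Real.exp (2 * Φ / h) * ∫ t, u t := by
    rw [leftIntegral, ← integral_indicator measurableSet_Iic, ← integral_const_mul,
      ← integral_add_left_eq_self _ x₀]
    refine integral_congr_ae (Filter.Eventually.of_forall fun t => ?_)
    by_cases ht : x₀ + t ≤ 0
    · have ht' : t ∈ Iic (-x₀) := by simp only [mem_Iic]; linarith
      simp only [u, indicator_of_mem ht', indicator_of_mem (show x₀ + t ∈ Iic (0 : ℝ) from ht), U]
      rw [← Real.exp_add]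
      congr 1
      rw [intervalIntegral.integral_add (hqi _ _) ((hγi _ _).const_mul _),
        intervalIntegral.integral_const_mul,
        ← intervalIntegral.integral_add_adjacent_intervals (hqi 0 x₀) (hqi x₀ (x₀ + t))]
      simp only [φ, η]
      field_simp
      ring
    · have ht' : t ∉ Iic (-x₀) := by simp only [mem_Iic]; intro h; exact ht (by linarith)
      simp only [u, indicator_of_notMem ht',
        indicator_of_notMem (show x₀ + t ∉ Iic (0 : ℝ) from ht), mul_zero]
  obtain ⟨ε, hε⟩ : ∃ ε, ε = h / s ^ 3 := ⟨_, rfl⟩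
  have hεh : ε * s ^ 3 = h := by rw [hε]; field_simp
  have hε0 : 0 < ε := by rw [hε]; positivity
  have hε1 : ε ≤ 1 := by rw [hε, div_le_one (by positivity)]; exact hhs
  have hs1 := hw.s_le
  have hη : ∀ t, |η t| ≤ G * (|t| + K) := fun t => by
    have h1 := intervalIntegral.norm_integral_le_of_norm_le_const (a := 0) (b := x₀ + t)
      (f := γ) (C := G) fun x _ => hγG x
    rw [Real.norm_eq_abs, sub_zero] at h1
    refine h1.trans ?_
    have h2 : |x₀| ≤ K := by
      rw [abs_of_neg hw.x₀_neg]
      have := hw.le_x₀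
      nlinarith
    have h3 := abs_add_le x₀ t
    gcongr
    linarith
  have hbound : ∀ t, |u t - V t| ≤ N * ε * Real.exp (-(s / (4 * K * h)) * t ^ 2) := by
    intro t
    obtain ⟨τ, hτdef⟩ : ∃ τ, τ = s * t ^ 2 / h := ⟨_, rfl⟩
    have hτ : 0 ≤ τ := by rw [hτdef]; positivity
    have ht : t ^ 2 = τ * ε * s ^ 2 := by
      rw [hτdef, ← hεh]
      field_simp
    have hfin : M' * ε * ((1 + τ ^ 4) * Real.exp (-(τ / (2 * K)))) ≤
        N * ε * Real.exp (-(s / (4 * K * h)) * t ^ 2) := by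
      have h1 := one_add_pow_four_mul_exp_le hK0 hτ
      have e : -(s / (4 * K * h)) * t ^ 2 = -(τ / (4 * K)) := by rw [hτdef]; field_simp
      rw [e]
      calc _ ≤ M' * ε * ((1 + 24 * (4 * K) ^ 4) * Real.exp (-(τ / (4 * K)))) := by gcongr
        _ = _ := by ring
    refine le_trans ?_ hfin
    have hE : 0 ≤ (1 + τ ^ 4) * Real.exp (-(τ / (2 * K))) := by positivity
    -- Used in two places: for `|t| > 1/K`, where the Taylor bound is unavailable, and for `t > -x₀
    -- ≥ s/K`, where the cut off integrand vanishes but the Gaussian does not.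
    have hfar : ∀ {w : ℝ}, 0 ≤ w → w ≤ P * Real.exp (-(τ / (2 * K))) → s / K ≤ |t| →
        |w - V t| ≤ M' * ε * ((1 + τ ^ 4) * Real.exp (-(τ / (2 * K)))) := by
      intro w hw0 hwP htK
      have h1 := far_bound (G := G) hK hs hε0 hτ ht hw.le_σ hw.c₃_le hw0 hwP htK
      rw [hεh] at h1
      refine h1.trans ?_
      gcongr
      exact le_add_of_nonneg_left hM
    by_cases htx : t ∈ Iic (-x₀)
    · have hx : x₀ + t ≤ 0 := by simp only [mem_Iic] at htx; linarith
      have hφ : s / (2 * K) * t ^ 2 ≤ φ t := by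
        have := hw.integral_le hx
        rw [add_sub_cancel_left] at this
        simp only [φ]
        linarith
      have hut : u t = U t := indicator_of_mem htx _
      rw [hut]
      rcases le_or_gt |t| (1 / K) with h1 | h1
      · have ht1 : |t| ≤ 1 := h1.trans (by rw [div_le_one hK0]; exact hK)
        have hT := hw.taylor (x₀ + t) hx (by rwa [add_sub_cancel_left])
        rw [add_sub_cancel_left] at hT
        have h2 := hnear hs hs1 hε0 hε1 hGs hτ ht hw.le_σ hw.c₃_le hφ (hη t) ht1
          (by simpa only [φ, neg_neg] using hT)
        rw [hεh] at h2
        refine h2.trans ?_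
        gcongr
        exact le_add_of_nonneg_right (by positivity)
      · have h2 := exp_neg_add_le hK hG hs hs1 hε0 hε1 hGs hτ ht hφ (hη t)
        rw [hεh] at h2
        refine hfar (Real.exp_pos _).le h2 ?_
        refine le_trans ?_ h1.le
        gcongr
    · have hut : u t = 0 := indicator_of_notMem htx _
      rw [hut]
      refine hfar le_rfl (by positivity) ?_
      simp only [mem_Iic, not_le] at htx
      exact le_trans (by linarith [hw.x₀_le]) (le_abs_self t)
  have hVi : Integrable V := integrable_gaussian_mul_one_add_cube (by positivity) _
  have hVint : ∫ t, V t = Real.sqrt (Real.pi * h / σ) := by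
    rw [integral_gaussian_mul_one_add_cube (by positivity), div_div_eq_mul_div]
  have hgi : Integrable fun t : ℝ => N * ε * Real.exp (-(s / (4 * K * h)) * t ^ 2) :=
    (integrable_exp_neg_mul_sq (by positivity)).const_mul _
  have hum : AEStronglyMeasurable u volume :=
    (hUc.stronglyMeasurable.indicator measurableSet_Iic).aestronglyMeasurable
  have hui : Integrable u := by
    have h1 : Integrable fun t => u t - V t :=
      hgi.mono' (hum.sub hVi.1) (Filter.Eventually.of_forall hbound)
    refine (h1.add hVi).congr (Filter.Eventually.of_forall fun t => ?_)
    simp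
  have hdiff : |(∫ t, u t) - Real.sqrt (Real.pi * h / σ)| ≤
      N * (2 * K) * ε * Real.sqrt (Real.pi * h / σ) := by
    rw [← hVint, ← integral_sub hui hVi]
    refine (norm_integral_le_of_norm_le (f := fun t => u t - V t) hgi
      (Filter.Eventually.of_forall hbound)).trans ?_
    rw [integral_const_mul, integral_gaussian, hVint]
    -- Since `σ ≤ K s`, the error majorant is wider than the true Gaussian by a factor of at most
    -- `2K`.
    have h1 : Real.sqrt (Real.pi / (s / (4 * K * h))) ≤ 2 * K * Real.sqrt (Real.pi * h / σ) := by
      rw [← Real.sqrt_sq (show 0 ≤ 2 * K by positivity), ← Real.sqrt_mul (by positivity)]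
      apply Real.sqrt_le_sqrt
      rw [div_div_eq_mul_div, mul_div_assoc', div_le_div_iff₀ hs hσ]
      have := hw.σ_le
      calc Real.pi * (4 * K * h) * σ ≤ Real.pi * (4 * K * h) * (K * s) := by gcongr
        _ = _ := by ring
    calc N * ε * Real.sqrt (Real.pi / (s / (4 * K * h))) ≤
        N * ε * (2 * K * Real.sqrt (Real.pi * h / σ)) := by gcongr
      _ = _ := by ring
  rw [hleft, ← mul_sub, abs_mul, abs_of_pos (Real.exp_pos _), ← hε]
  calc _ ≤ Real.exp (2 * Φ / h) * (N * (2 * K) * ε * Real.sqrt (Real.pi * h / σ)) := by gcongr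
    _ = _ := by ring

/-! ### From the two Laplace integrals to the norm -/

theorem abs_sqrt_sub_sqrt_le {x y : ℝ} (hx : 0 ≤ x) (hy : 0 < y) {e : ℝ} (h : |x - y| ≤ e * y) :
    |Real.sqrt x - Real.sqrt y| ≤ e * Real.sqrt y := by
  have hsy : 0 < Real.sqrt y := Real.sqrt_pos.mpr hy
  have hsx := Real.sqrt_nonneg x
  have e1 : x - y = (Real.sqrt x - Real.sqrt y) * (Real.sqrt x + Real.sqrt y) := by
    have h1 := Real.mul_self_sqrt hx
    have h2 := Real.mul_self_sqrt hy.le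
    linear_combination -h1 + h2
  have h3 : |Real.sqrt x - Real.sqrt y| * Real.sqrt y ≤ e * Real.sqrt y * Real.sqrt y := by
    calc |Real.sqrt x - Real.sqrt y| * Real.sqrt y
        ≤ |Real.sqrt x - Real.sqrt y| * |Real.sqrt x + Real.sqrt y| := by
          gcongr
          exact le_trans (by linarith) (le_abs_self _)
      _ = |x - y| := by rw [← abs_mul, ← e1]
      _ ≤ e * y := h
      _ = _ := by rw [mul_assoc, Real.mul_self_sqrt hy.le]
  exact le_of_mul_le_mul_right h3 hsy

theorem abs_sqrt_mul_sqrt_sub_le {x y x' y' e : ℝ} (hx : 0 ≤ x) (hy : 0 ≤ y) (hx' : 0 < x')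
    (hy' : 0 < y') (he : 0 ≤ e) (h1 : |x - x'| ≤ e * x') (h2 : |y - y'| ≤ e * y') :
    |Real.sqrt x * Real.sqrt y - Real.sqrt x' * Real.sqrt y'| ≤
      e * (2 + e) * (Real.sqrt x' * Real.sqrt y') := by
  have a1 := abs_sqrt_sub_sqrt_le hx hx' h1
  have a2 := abs_sqrt_sub_sqrt_le hy hy' h2
  have hsx' := Real.sqrt_nonneg x'
  have hsy' := Real.sqrt_nonneg y'
  have hsy : Real.sqrt y ≤ (1 + e) * Real.sqrt y' := by linarith [le_abs_self (√y - √y')]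
  calc |Real.sqrt x * Real.sqrt y - Real.sqrt x' * Real.sqrt y'|
      = |(Real.sqrt x - Real.sqrt x') * Real.sqrt y +
          Real.sqrt x' * (Real.sqrt y - Real.sqrt y')| := by ring_nf
    _ ≤ |Real.sqrt x - Real.sqrt x'| * Real.sqrt y +
          Real.sqrt x' * |Real.sqrt y - Real.sqrt y'| := by
        refine (abs_add_le _ _).trans (le_of_eq ?_)
        rw [abs_mul, abs_mul, abs_of_nonneg (Real.sqrt_nonneg y), abs_of_nonneg hsx']
    _ ≤ e * Real.sqrt x' * ((1 + e) * Real.sqrt y') + Real.sqrt x' * (e * Real.sqrt y') := by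
        gcongr
    _ = _ := by ring

/-- The leading term of the norm of the inverse, in terms of the total depth `Λ` and the slopes at
the two zeros. -/
noncomputable def tunnelTerm (h Λ σp σm : ℝ) : ℝ :=
  Real.sqrt Real.pi * Real.exp (Λ / h) /
    (h ^ (1 / 2 : ℝ) * σp ^ (1 / 4 : ℝ) * σm ^ (1 / 4 : ℝ))

theorem sqrt_exp_mul_sqrt {h σ Φ : ℝ} (hh : 0 < h) (hσ : 0 < σ) :
    Real.sqrt (Real.exp (2 * Φ / h) * Real.sqrt (Real.pi * h / σ)) =
      Real.exp (Φ / h) * (Real.pi ^ (1 / 4 : ℝ) * h ^ (1 / 4 : ℝ) / σ ^ (1 / 4 : ℝ)) := by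
  have hπ := Real.pi_pos
  rw [Real.sqrt_mul (Real.exp_pos _).le, ← Real.exp_half, Real.sqrt_eq_rpow (√_),
    Real.sqrt_eq_rpow, ← Real.rpow_mul (by positivity), Real.div_rpow (by positivity) hσ.le,
    Real.mul_rpow hπ.le hh.le]
  congr 2
  · ring
  all_goals norm_num

theorem tunnelTerm_eq {h Φp Φm σp σm : ℝ} (hh : 0 < h) (hp : 0 < σp) (hm : 0 < σm) :
    1 / h * (Real.sqrt (Real.exp (2 * Φp / h) * Real.sqrt (Real.pi * h / σp)) *
      Real.sqrt (Real.exp (2 * Φm / h) * Real.sqrt (Real.pi * h / σm))) =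
      tunnelTerm h (Φp + Φm) σp σm := by
  have hπ := Real.pi_pos
  rw [sqrt_exp_mul_sqrt hh hp, sqrt_exp_mul_sqrt hh hm, tunnelTerm, add_div, Real.exp_add]
  have e1 : Real.sqrt Real.pi = Real.pi ^ (1 / 4 : ℝ) * Real.pi ^ (1 / 4 : ℝ) := by
    rw [← Real.rpow_add hπ, Real.sqrt_eq_rpow]; norm_num
  have e2 : h ^ (1 / 2 : ℝ) = h ^ (1 / 4 : ℝ) * h ^ (1 / 4 : ℝ) := by
    rw [← Real.rpow_add hh]; norm_num
  have e3 : h = (h ^ (1 / 4 : ℝ)) ^ 4 := by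
    rw [← Real.rpow_natCast, ← Real.rpow_mul hh.le]; norm_num
  have h1 : 0 < h ^ (1 / 4 : ℝ) := Real.rpow_pos_of_pos hh _
  have h2 : 0 < σp ^ (1 / 4 : ℝ) := Real.rpow_pos_of_pos hp _
  have h3 : 0 < σm ^ (1 / 4 : ℝ) := Real.rpow_pos_of_pos hm _
  rw [e1, e2]
  set E1 := Real.exp (Φp / h)
  set E2 := Real.exp (Φm / h)
  have e4 : 1 / h = 1 / (h ^ (1 / 4 : ℝ)) ^ 4 := by rw [← e3]
  rw [e4]
  field_simp

/-- Gives positivity of the leading term and a scale against which the same-side blocks, of size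
`e^{D/h}/s²`, can be measured. The power `s²` is `(s³)^{1/2} (s²)^{1/4}`, from `h ≤ s³` and the two
slopes. -/
theorem le_tunnelTerm {K s h Λ σp σm : ℝ} (hK : 1 ≤ K) (hs : 0 < s) (hh : 0 < h)
    (hhs : h ≤ s ^ 3) (hp : 0 < σp) (hm : 0 < σm) (hpK : σp ≤ K * s) (hmK : σm ≤ K * s) :
    Real.exp (Λ / h) / (K * s ^ 2) ≤ tunnelTerm h Λ σp σm := by
  have hK0 : 0 < K := by linarith
  have hKs : 0 < K * s := by positivity
  have h1 : h ^ (1 / 2 : ℝ) * σp ^ (1 / 4 : ℝ) * σm ^ (1 / 4 : ℝ) ≤ K * s ^ 2 := by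
    calc h ^ (1 / 2 : ℝ) * σp ^ (1 / 4 : ℝ) * σm ^ (1 / 4 : ℝ)
        ≤ (s ^ 3) ^ (1 / 2 : ℝ) * (K * s) ^ (1 / 4 : ℝ) * (K * s) ^ (1 / 4 : ℝ) := by gcongr
      _ = (s ^ 3) ^ (1 / 2 : ℝ) * (K * s) ^ (1 / 2 : ℝ) := by
          rw [mul_assoc, ← Real.rpow_add hKs]; norm_num
      _ = Real.sqrt (K * (s ^ 2) ^ 2) := by
          rw [← Real.mul_rpow (by positivity) hKs.le, Real.sqrt_eq_rpow]
          ring_nf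
      _ ≤ Real.sqrt (K ^ 2 * (s ^ 2) ^ 2) := by
          apply Real.sqrt_le_sqrt
          gcongr
          nlinarith
      _ = K * s ^ 2 := by rw [← mul_pow, Real.sqrt_sq (by positivity)]
  have h2 : 1 ≤ Real.sqrt Real.pi := by
    rw [Real.one_le_sqrt]
    linarith [Real.pi_gt_three]
  rw [tunnelTerm]
  have h3 : 0 < h ^ (1 / 2 : ℝ) * σp ^ (1 / 4 : ℝ) * σm ^ (1 / 4 : ℝ) := by positivity
  have hE := Real.exp_pos (Λ / h)
  gcongr
  nlinarith

theorem exists_norm_inverse_asymptotic {K G : ℝ} (hK : 1 ≤ K) (hG : 0 ≤ G) : ∃ C : ℝ, 0 ≤ C ∧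
    ∀ {q : ℝ → ℝ} {s xp xm σp σm cp cm : ℝ}, LeftWell q s xp σp cp K →
    LeftWell (fun x => q (-x)) s xm σm cm K → ∀ {γ : ℝ → ℝ}, Continuous γ →
    (∀ x, |γ x| ≤ G) → ∀ {h : ℝ}, 0 < h → h ≤ s ^ 3 → 16 * G * K ^ 4 * s ≤ 1 →
    ∀ {m : ℝ → ℂ} {c₀ C₀ : ℝ}, Confining m c₀ C₀ → (∀ x, (m x).im = q x + h ^ 2 * γ x) →
    ∀ {R : L2 →L[ℂ] L2}, (∀ v : L2, R v =ᵐ[volume] resolventFun h m v) →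
    |‖R‖ - tunnelTerm h ((∫ t in (0 : ℝ)..xp, q t) + ∫ t in (0 : ℝ)..xm, q (-t)) σp σm| ≤
      C * (h / s ^ 3) *
        tunnelTerm h ((∫ t in (0 : ℝ)..xp, q t) + ∫ t in (0 : ℝ)..xm, q (-t)) σp σm := by
  have hK0 : 0 < K := by linarith
  obtain ⟨C, hC, hlap⟩ := LeftWell.exists_laplace hK hG
  refine ⟨C * (2 + C) + 64 * K ^ 8, by positivity, ?_⟩
  intro q s xp xm σp σm cp cm hwp hwm γ hγ hγG h hh hhs hGs m c₀ C₀ hm hmq R hR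
  have hs := hwp.s_pos
  have hs1 := hwp.s_le
  have hσp := hwp.σ_pos
  have hσm := hwm.σ_pos
  have hK4 : 1 ≤ K ^ 3 := one_le_pow₀ hK
  have hGs' : 4 * G * K * s ≤ 1 := by
    refine le_trans ?_ hGs
    have : 0 ≤ G * K * s := by positivity
    nlinarith
  obtain ⟨ε, hε⟩ : ∃ ε, ε = h / s ^ 3 := ⟨_, rfl⟩
  have hε0 : 0 < ε := by rw [hε]; positivity
  have hε1 : ε ≤ 1 := by rw [hε, div_le_one (by positivity)]; exact hhs
  have hI := hlap hwp hγ hγG hh hhs hGs'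
  have hJ := hlap hwm (hγ.comp continuous_neg) (fun x => hγG (-x)) hh hhs hGs'
  -- `κ` is half of what `LeftWell.neg_integral_le` admits; the other half absorbs `h² γ`. On one
  -- side the exponent is at most one depth plus `s³/(4K³)`, and the other depth is at least twice
  -- that amount, which yields `D`.
  have hupp := hm.norm_inverse_le hh hR (D := ((∫ t in (0 : ℝ)..xp, q t) +
    ∫ t in (0 : ℝ)..xm, q (-t)) - s ^ 3 / (4 * K ^ 3)) (κ := s ^ 2 / (16 * K ^ 4)) (by positivity)
    (by
      intro x y hxy hor
      set κ := s ^ 2 / (16 * K ^ 4)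
      have hκ : 0 < κ := by positivity
      have hGh : h ^ 2 * G ≤ κ := by
        rw [le_div_iff₀ (by positivity)]
        have h2 : h ^ 2 ≤ (s ^ 3) ^ 2 := by gcongr
        calc h ^ 2 * G * (16 * K ^ 4) ≤ (s ^ 3) ^ 2 * G * (16 * K ^ 4) := by gcongr
          _ = s ^ 2 * s ^ 3 * (16 * G * K ^ 4 * s) := by ring
          _ ≤ s ^ 2 * 1 * 1 := by
            gcongr
            exact pow_le_one₀ hs.le hs1
          _ = s ^ 2 := by ring
      have hκ8 : κ + h ^ 2 * G ≤ s ^ 2 / (8 * K ^ 4) := by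
        have : s ^ 2 / (8 * K ^ 4) = κ + κ := by simp only [κ]; field_simp; norm_num
        linarith
      have hκ0 : 0 < κ + h ^ 2 * G := by positivity
      have hqi : ∀ a b : ℝ, IntervalIntegrable (fun t => κ + h ^ 2 * G - q t) volume a b :=
        fun a b => (continuous_const.sub hwp.cont).intervalIntegrable a b
      have hmi : ∀ a b : ℝ, IntervalIntegrable (fun t => κ - (m t).im) volume a b :=
        fun a b => (continuous_const.sub
          (Complex.continuous_im.comp hm.smooth.continuous)).intervalIntegrable a b
      have h1 : -(∫ t in x..y, (m t).im) = (∫ t in x..y, (κ - (m t).im)) - κ * (y - x) := by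
        have himi : IntervalIntegrable (fun t => (m t).im) volume x y :=
          (Complex.continuous_im.comp hm.smooth.continuous).intervalIntegrable x y
        rw [intervalIntegral.integral_sub intervalIntegrable_const himi,
          intervalIntegral.integral_const, smul_eq_mul]
        ring
      have h2 : ∫ t in x..y, (κ - (m t).im) ≤ ∫ t in x..y, (κ + h ^ 2 * G - q t) := by
        refine intervalIntegral.integral_mono_on hxy.le (hmi x y) (hqi x y) fun t _ => ?_
        rw [hmq t]
        have := (abs_le.mp (hγG t)).1
        have : h ^ 2 * (-G) ≤ h ^ 2 * γ t := by gcongr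
        linarith
      have e3 : s ^ 3 / (2 * K ^ 3) = s ^ 3 / (4 * K ^ 3) + s ^ 3 / (4 * K ^ 3) := by
        field_simp; norm_num
      rw [h1]
      have hp := hwp.integral_zero_ge
      have hm' := hwm.integral_zero_ge
      rcases hor with hy | hx
      · have := hwp.neg_integral_le hκ0 hκ8 hxy.le hy
        linarith
      · have h3 := hwm.neg_integral_le hκ0 hκ8 (x := -y) (y := -x) (by linarith) (by linarith)
        rw [intervalIntegral.integral_comp_neg (fun t => κ + h ^ 2 * G - q t), neg_neg,
          neg_neg] at h3
        linarith)
  have hlow := hm.le_norm_inverse hh hR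
  rw [rightIntegral_eq_leftIntegral] at hupp hlow
  simp only [hmq] at hupp hlow
  rw [← hε] at hI hJ ⊢
  set Φp := ∫ t in (0 : ℝ)..xp, q t
  set Φm := ∫ t in (0 : ℝ)..xm, q (-t)
  have hI0 := leftIntegral_nonneg h (fun t => q t + h ^ 2 * γ t)
  have hJ0 := leftIntegral_nonneg h (fun t => q (-t) + h ^ 2 * γ (-t))
  set I := leftIntegral h (fun t => q t + h ^ 2 * γ t)
  set J := leftIntegral h (fun t => q (-t) + h ^ 2 * γ (-t))
  have hπ := Real.pi_pos
  have hprod := abs_sqrt_mul_sqrt_sub_le hI0 hJ0 (by positivity) (by positivity)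
    (mul_nonneg hC hε0.le) hI hJ
  have hT := tunnelTerm_eq (Φp := Φp) (Φm := Φm) hh hσp hσm
  set T := tunnelTerm h (Φp + Φm) σp σm
  have hTle := le_tunnelTerm (Λ := Φp + Φm) hK hs hh hhs hσp hσm hwp.σ_le hwm.σ_le
  have hT0 : 0 < T := lt_of_lt_of_le (by positivity) hTle
  have hprod' : |1 / h * Real.sqrt I * Real.sqrt J - T| ≤ C * (2 + C) * ε * T := by
    rw [← hT, mul_assoc, ← mul_sub, abs_mul, abs_of_pos (by positivity : 0 < 1 / h)]
    calc _ ≤ 1 / h * (C * ε * (2 + C * ε) *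
          (Real.sqrt (Real.exp (2 * Φp / h) * Real.sqrt (Real.pi * h / σp)) *
      Real.sqrt (Real.exp (2 * Φm / h) * Real.sqrt (Real.pi * h / σm)))) := by gcongr
      _ ≤ 1 / h * (C * ε * (2 + C * 1) *
          (Real.sqrt (Real.exp (2 * Φp / h) * Real.sqrt (Real.pi * h / σp)) *
      Real.sqrt (Real.exp (2 * Φm / h) * Real.sqrt (Real.pi * h / σm)))) := by gcongr
      _ = _ := by ring
  -- Relative to the leading term this is exponentially small in `1/ε`; the crude bound `e^{-1/x} ≤
  -- x` already makes it `O(ε)`, so no separate additive error remains.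
  have hrest : Real.exp ((Φp + Φm - s ^ 3 / (4 * K ^ 3)) / h) / (s ^ 2 / (16 * K ^ 4)) ≤
      64 * K ^ 8 * ε * T := by
    have e1 : (Φp + Φm - s ^ 3 / (4 * K ^ 3)) / h = (Φp + Φm) / h + -(1 / (4 * K ^ 3 * ε)) := by
      rw [hε]; field_simp; ring
    have h1 : Real.exp (-(1 / (4 * K ^ 3 * ε))) ≤ 4 * K ^ 3 * ε := by
      have h2 := Real.add_one_le_exp (1 / (4 * K ^ 3 * ε))
      rw [Real.exp_neg]
      refine inv_le_of_inv_le₀ (by positivity) ?_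
      rw [← one_div]
      linarith
    rw [e1, Real.exp_add]
    calc Real.exp ((Φp + Φm) / h) * Real.exp (-(1 / (4 * K ^ 3 * ε))) / (s ^ 2 / (16 * K ^ 4))
        ≤ Real.exp ((Φp + Φm) / h) * (4 * K ^ 3 * ε) / (s ^ 2 / (16 * K ^ 4)) := by gcongr
      _ = 64 * K ^ 8 * ε * (Real.exp ((Φp + Φm) / h) / (K * s ^ 2)) := by field_simp; norm_num
      _ ≤ _ := by gcongr
  have hK8 : 0 ≤ 64 * K ^ 8 * ε * T := by positivity
  have h1 := abs_le.mp hprod'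
  rw [abs_le]
  constructor
  · nlinarith [h1.1]
  · nlinarith [h1.2]

/-! ### Convexity and Taylor estimates near the bottom -/

/-- The mean value inequality between `z` and `x`, raising the order of vanishing at `z` by one.
Iterated from the bound on `q₃`, it gives Taylor estimates up to the primitive of `q`, without the
factorials, which are not needed. -/
theorem abs_le_mul_pow_of_hasDerivAt {f f' : ℝ → ℝ} {δ B z : ℝ} {n : ℕ}
    (hd : ∀ x, HasDerivAt f (f' x) x) (hz : |z| ≤ δ) (hfz : f z = 0) (hB : 0 ≤ B)
    (hf' : ∀ y, |y| ≤ δ → |f' y| ≤ B * |y - z| ^ n) {x : ℝ} (hx : |x| ≤ δ) :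
    |f x| ≤ B * |x - z| ^ (n + 1) := by
  have h1 := (convex_uIcc z x).norm_image_sub_le_of_norm_hasDerivWithin_le (f := f) (f' := f')
    (C := B * |x - z| ^ n) (fun y _ => (hd y).hasDerivWithinAt) (fun y hy => ?_)
    left_mem_uIcc right_mem_uIcc
  · rw [hfz, sub_zero, Real.norm_eq_abs, Real.norm_eq_abs, mul_assoc, ← pow_succ] at h1
    exact h1
  · have hyδ : |y| ≤ δ := by
      rw [abs_le] at hz hx ⊢
      rcases le_total z x with h | h
      · rw [uIcc_of_le h] at hy
        exact ⟨hz.1.trans hy.1, hy.2.trans hx.2⟩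
      · rw [uIcc_of_ge h] at hy
        exact ⟨hx.1.trans hy.1, hy.2.trans hz.2⟩
    refine (hf' y hyδ).trans ?_
    have := abs_sub_left_of_mem_uIcc hy
    gcongr

/-- A function with a small negative value at `0`, close to the parabola `-α + β x² / 2` near `0`,
and positive away from `0`. -/
structure WellData (q q₁ q₂ q₃ : ℝ → ℝ) (β δ B c α : ℝ) : Prop where
  d₁ : ∀ x, HasDerivAt q (q₁ x) x
  d₂ : ∀ x, HasDerivAt q₁ (q₂ x) x
  d₃ : ∀ x, HasDerivAt q₂ (q₃ x) x
  q₂_ge : ∀ x, |x| ≤ δ → β / 2 ≤ q₂ x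
  q₂_le : ∀ x, |x| ≤ δ → |q₂ x| ≤ B
  q₃_le : ∀ x, |x| ≤ δ → |q₃ x| ≤ B
  q_zero : |q 0 + α| ≤ B * α ^ 2
  q₁_zero : |q₁ 0| ≤ B * α
  q₂_zero : |q₂ 0 - β| ≤ B * α
  far : ∀ x, δ ≤ |x| → c * x ^ 2 ≤ q x

namespace WellData

variable {q q₁ q₂ q₃ : ℝ → ℝ} {β δ B c α : ℝ}

theorem comp_neg (hd : WellData q q₁ q₂ q₃ β δ B c α) :
    WellData (fun x => q (-x)) (fun x => -q₁ (-x)) (fun x => q₂ (-x)) (fun x => -q₃ (-x))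
      β δ B c α where
  d₁ x := by
    have := (hd.d₁ (-x)).comp x (hasDerivAt_neg x)
    rwa [mul_neg_one] at this
  d₂ x := by
    have := ((hd.d₂ (-x)).comp x (hasDerivAt_neg x)).neg
    rwa [mul_neg_one, neg_neg] at this
  d₃ x := by
    have := (hd.d₃ (-x)).comp x (hasDerivAt_neg x)
    rwa [mul_neg_one] at this
  q₂_ge x hx := hd.q₂_ge (-x) (by rwa [abs_neg])
  q₂_le x hx := hd.q₂_le (-x) (by rwa [abs_neg])
  q₃_le x hx := by rw [abs_neg]; exact hd.q₃_le (-x) (by rwa [abs_neg])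
  q_zero := by rw [neg_zero]; exact hd.q_zero
  q₁_zero := by rw [neg_zero, abs_neg]; exact hd.q₁_zero
  q₂_zero := by rw [neg_zero]; exact hd.q₂_zero
  far x hx := by rw [← neg_sq]; exact hd.far (-x) (by rwa [abs_neg])

theorem cont (hd : WellData q q₁ q₂ q₃ β δ B c α) : Continuous q :=
  continuous_iff_continuousAt.mpr fun x => (hd.d₁ x).continuousAt

theorem convexOn_sub (hd : WellData q q₁ q₂ q₃ β δ B c α) (z : ℝ) :
    ConvexOn ℝ (Icc (-δ) δ) fun y => q y - q₁ z * (y - z) - β / 4 * (y - z) ^ 2 := by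
  have h1 : ∀ y, HasDerivAt (fun y => q y - q₁ z * (y - z) - β / 4 * (y - z) ^ 2)
      (q₁ y - q₁ z - β / 2 * (y - z)) y := fun y => by
    have h2 := (hasDerivAt_id y).sub_const z
    have h3 : HasDerivAt (fun y => q y - q₁ z * (y - z) - β / 4 * (y - z) ^ 2) _ y :=
      ((hd.d₁ y).sub (h2.const_mul (q₁ z))).sub ((h2.pow 2).const_mul (β / 4))
    exact h3.congr_deriv (by simp only [id_eq, Nat.cast_ofNat, Nat.add_one_sub_one]; ring)
  have h2 : ∀ y, HasDerivAt (fun y => q₁ y - q₁ z - β / 2 * (y - z)) (q₂ y - β / 2) y := fun y => by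
    have h3 : HasDerivAt (fun y => q₁ y - q₁ z - β / 2 * (y - z)) _ y :=
      ((hd.d₂ y).sub_const (q₁ z)).sub (((hasDerivAt_id y).sub_const z).const_mul (β / 2))
    exact h3.congr_deriv (by ring)
  refine convexOn_of_deriv2_nonneg' (convex_Icc _ _)
    (fun y _ => (h1 y).differentiableAt.differentiableWithinAt) ?_ fun y hy => ?_
  · rw [funext fun y => (h1 y).deriv]
    exact fun y _ => (h2 y).differentiableAt.differentiableWithinAt
  · rw [Function.iterate_succ, Function.iterate_one, Function.comp_apply,
      funext fun y => (h1 y).deriv, (h2 y).deriv]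
    linarith [hd.q₂_ge y (abs_le.mpr hy)]

/-- Strong convexity: the function of `convexOn_sub` is convex with zero derivative at `z`, so it is
minimal there. -/
theorem quadratic_le (hd : WellData q q₁ q₂ q₃ β δ B c α) {y z : ℝ} (hy : |y| ≤ δ) (hz : |z| ≤ δ) :
    q z + q₁ z * (y - z) + β / 4 * (y - z) ^ 2 ≤ q y := by
  have hc := hd.convexOn_sub z
  have hdz : HasDerivAt (fun y => q y - q₁ z * (y - z) - β / 4 * (y - z) ^ 2) 0 z := by
    have h2 := (hasDerivAt_id z).sub_const z
    have h3 : HasDerivAt (fun y => q y - q₁ z * (y - z) - β / 4 * (y - z) ^ 2) _ z :=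
      ((hd.d₁ z).sub (h2.const_mul (q₁ z))).sub ((h2.pow 2).const_mul (β / 4))
    exact h3.congr_deriv (by simp only [id_eq, Nat.cast_ofNat, Nat.add_one_sub_one]; ring)
  have hle : q z ≤ q y - q₁ z * (y - z) - β / 4 * (y - z) ^ 2 := by
    rcases lt_trichotomy z y with h | rfl | h
    · have h1 := hc.le_slope_of_hasDerivAt (abs_le.mp hz) (abs_le.mp hy) h hdz
      rw [slope_def_field, le_div_iff₀ (by linarith)] at h1
      simp only [sub_self, mul_zero, zero_mul, ne_eq, OfNat.ofNat_ne_zero, not_false_eq_true,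
        zero_pow] at h1
      linarith
    · simp
    · have h1 := hc.slope_le_of_hasDerivAt (abs_le.mp hy) (abs_le.mp hz) h hdz
      rw [slope_def_field, div_le_iff₀ (by linarith)] at h1
      simp only [sub_self, mul_zero, zero_mul, ne_eq, OfNat.ofNat_ne_zero, not_false_eq_true,
        zero_pow] at h1
      linarith
  linarith

/-- By convexity the graph lies below the chord from `(x₀, 0)` to `(0, q 0)`. This supplies the
linear lower bound on `-q` inside the well. -/
theorem chord_le (hd : WellData q q₁ q₂ q₃ β δ B c α) (hβ : 0 ≤ β) {x₀ y : ℝ} (hx₀ : |x₀| ≤ δ)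
    (hx₀0 : x₀ < 0) (hqx₀ : q x₀ = 0) (hy1 : x₀ ≤ y) (hy2 : y ≤ 0) :
    (y - x₀) / (-x₀) * (-q 0) ≤ -q y := by
  have hconv : ConvexOn ℝ (Icc (-δ) δ) q := by
    refine convexOn_of_deriv2_nonneg' (convex_Icc _ _)
      (fun y _ => (hd.d₁ y).differentiableAt.differentiableWithinAt) ?_ fun y hy => ?_
    · rw [funext fun y => (hd.d₁ y).deriv]
      exact fun y _ => (hd.d₂ y).differentiableAt.differentiableWithinAt
    · rw [Function.iterate_succ, Function.iterate_one, Function.comp_apply,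
        funext fun y => (hd.d₁ y).deriv, (hd.d₂ y).deriv]
      linarith [hd.q₂_ge y (abs_le.mpr hy)]
  have hx₀ne : 0 < -x₀ := by linarith
  have hz0 : |(0 : ℝ)| ≤ δ := by rw [abs_zero]; exact (abs_nonneg _).trans hx₀
  have hm1 : x₀ ∈ Icc (-δ) δ := abs_le.mp hx₀
  have hm2 : (0 : ℝ) ∈ Icc (-δ) δ := abs_le.mp hz0
  have h1 := hconv.2 hm1 hm2 (show 0 ≤ y / x₀ from div_nonneg_of_nonpos hy2 hx₀0.le)
    (show 0 ≤ (y - x₀) / (-x₀) from div_nonneg (by linarith) hx₀ne.le)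
    (by have := hx₀0.ne; field_simp; ring)
  have e : (y / x₀) • x₀ + ((y - x₀) / -x₀) • (0 : ℝ) = y := by
    have := hx₀0.ne
    simp only [smul_eq_mul, mul_zero, add_zero]
    field_simp
  rw [e, hqx₀, smul_zero, zero_add, smul_eq_mul] at h1
  linarith

theorem abs_q₂_sub_le (hd : WellData q q₁ q₂ q₃ β δ B c α) (hB : 0 ≤ B) {x z : ℝ} (hx : |x| ≤ δ)
    (hz : |z| ≤ δ) : |q₂ x - q₂ z| ≤ B * |x - z| ^ 1 :=
  abs_le_mul_pow_of_hasDerivAt (n := 0) (f := fun x => q₂ x - q₂ z)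
    (fun y => (hd.d₃ y).sub_const _) hz (sub_self _) hB
    (fun y hy => by simpa using hd.q₃_le y hy) hx

theorem abs_q₁_sub_le (hd : WellData q q₁ q₂ q₃ β δ B c α) (hB : 0 ≤ B) {x z : ℝ} (hx : |x| ≤ δ)
    (hz : |z| ≤ δ) : |q₁ x - q₁ z - q₂ z * (x - z)| ≤ B * |x - z| ^ 2 :=
  abs_le_mul_pow_of_hasDerivAt (f := fun x => q₁ x - q₁ z - q₂ z * (x - z))
    (f' := fun x => q₂ x - q₂ z)
    (fun y => by
      have h := ((hd.d₂ y).sub_const (q₁ z)).sub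
        (((hasDerivAt_id y).sub_const z).const_mul (q₂ z))
      rwa [mul_one] at h) hz (by ring) hB
    (fun y hy => hd.abs_q₂_sub_le hB hy hz) hx

theorem abs_q_sub_le (hd : WellData q q₁ q₂ q₃ β δ B c α) (hB : 0 ≤ B) {x z : ℝ} (hx : |x| ≤ δ)
    (hz : |z| ≤ δ) :
    |q x - q z - q₁ z * (x - z) - q₂ z / 2 * (x - z) ^ 2| ≤ B * |x - z| ^ 3 :=
  abs_le_mul_pow_of_hasDerivAt (f := fun x => q x - q z - q₁ z * (x - z) - q₂ z / 2 * (x - z) ^ 2)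
    (f' := fun x => q₁ x - q₁ z - q₂ z * (x - z))
    (fun y => by
      have h0 := (hasDerivAt_id y).sub_const z
      have h : HasDerivAt (fun x => q x - q z - q₁ z * (x - z) - q₂ z / 2 * (x - z) ^ 2) _ y :=
        (((hd.d₁ y).sub_const (q z)).sub (h0.const_mul (q₁ z))).sub
          ((h0.pow 2).const_mul (q₂ z / 2))
      exact h.congr_deriv (by simp only [id_eq, Nat.cast_ofNat, Nat.add_one_sub_one]; ring)) hz (by ring) hB
    (fun y hy => hd.abs_q₁_sub_le hB hy hz) hx

theorem abs_integral_sub_le (hd : WellData q q₁ q₂ q₃ β δ B c α) (hB : 0 ≤ B) {x z : ℝ}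
    (hx : |x| ≤ δ) (hz : |z| ≤ δ) :
    |(∫ t in z..x, q t) - q z * (x - z) - q₁ z / 2 * (x - z) ^ 2 - q₂ z / 6 * (x - z) ^ 3| ≤
      B * |x - z| ^ 4 :=
  abs_le_mul_pow_of_hasDerivAt
    (f := fun x => (∫ t in z..x, q t) - q z * (x - z) - q₁ z / 2 * (x - z) ^ 2 -
      q₂ z / 6 * (x - z) ^ 3)
    (f' := fun x => q x - q z - q₁ z * (x - z) - q₂ z / 2 * (x - z) ^ 2)
    (fun y => by
      have h0 := (hasDerivAt_id y).sub_const z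
      have hI : HasDerivAt (fun x => ∫ t in z..x, q t) (q y) y :=
        intervalIntegral.integral_hasDerivAt_right (hd.cont.intervalIntegrable _ _)
        (hd.cont.stronglyMeasurableAtFilter _ _) hd.cont.continuousAt
      have h : HasDerivAt (fun x => (∫ t in z..x, q t) - q z * (x - z) -
          q₁ z / 2 * (x - z) ^ 2 - q₂ z / 6 * (x - z) ^ 3) _ y :=
        ((hI.sub (h0.const_mul (q z))).sub ((h0.pow 2).const_mul (q₁ z / 2))).sub
          ((h0.pow 3).const_mul (q₂ z / 6))
      exact h.congr_deriv (by simp only [id_eq, Nat.cast_ofNat, Nat.add_one_sub_one]; ring)) hz (by simp) hB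
    (fun y hy => hd.abs_q_sub_le hB hy hz) hx

end WellData

set_option maxHeartbeats 1000000 in
/-- The left zero of `q`, with quantitative information that is uniform in `α = s²`. -/
theorem exists_leftWell {β δ B c : ℝ} (hβ : 0 < β) (hδ : 0 < δ) (hδ1 : δ ≤ 1) (hB : 1 ≤ B)
    (hc : 0 < c) : ∃ K s₀ : ℝ, 1 ≤ K ∧ 0 < s₀ ∧ ∀ {q q₁ q₂ q₃ : ℝ → ℝ} {s : ℝ},
    WellData q q₁ q₂ q₃ β δ B c (s ^ 2) → 0 < s → s ≤ s₀ →
    ∃ x₀ c₃, LeftWell q s x₀ (-q₁ x₀) c₃ K ∧ q x₀ = 0 ∧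
      |x₀ + s * Real.sqrt (2 / β)| ≤ K * s ^ 2 := by
  have hB0 : 0 < B := by linarith
  -- `K₁ s` will bound `|x₀|`: strong convexity at `0` gives `(β/4) x₀² ≤ (2 + B) s²`. The added `1`
  -- makes `K₁² ≥ K₁`.
  obtain ⟨K₁, hK₁⟩ : ∃ K₁, K₁ = 1 + 4 * (2 + B) / β := ⟨_, rfl⟩
  have hK₁1 : 1 ≤ K₁ := by
    rw [hK₁]
    have : 0 ≤ 4 * (2 + B) / β := by positivity
    linarith
  have hK₁0 : 0 < K₁ := by linarith
  set r := Real.sqrt (2 / β)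
  have hr : 0 < r := Real.sqrt_pos.mpr (by positivity)
  have hr2 : r ^ 2 = 2 / β := Real.sq_sqrt (by positivity)
  obtain ⟨K₃, hK₃⟩ : ∃ K₃, K₃ = 2 / β * (B * K₁ + B * K₁ ^ 3 + B + B * K₁ ^ 2) / r := ⟨_, rfl⟩
  have hK₃0 : 0 ≤ K₃ := by rw [hK₃]; positivity
  set K := 2 * K₁ + 2 * B * (1 + K₁) * K₁ + 2 * B * (1 + K₁) + 1 / (c * δ) + 2 / δ + K₃ + B
  have p1 : 0 < 2 * B * (1 + K₁) * K₁ := by positivity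
  have p2 : 0 < 2 * B * (1 + K₁) := by positivity
  have p3 : 0 < 1 / (c * δ) := by positivity
  have p4 : 0 < 2 / δ := by positivity
  have hKK₁ : 2 * K₁ ≤ K := by simp only [K]; linarith
  have hKσ : 2 * B * (1 + K₁) ≤ K := by simp only [K]; linarith
  have hKu : 2 * B * (1 + K₁) * K₁ ≤ K := by simp only [K]; linarith
  have hKc : 1 / (c * δ) ≤ K := by simp only [K]; linarith
  have hKδ : 2 / δ ≤ K := by simp only [K]; linarith
  have hKK₃ : K₃ ≤ K := by simp only [K]; linarith
  have hKB : B ≤ K := by simp only [K]; linarith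
  clear_value K
  have hK1 : 1 ≤ K := by linarith
  have hK0 : 0 < K := by linarith
  -- The smallness of `s` ensures both `2 B s ≤ 1`, which keeps `q 0` comparable to `-s²`, and `K₁ s
  -- ≤ δ/2`, which keeps the zero well inside the convex region.
  refine ⟨K, 1 / (2 * B + 2 * K₁ / δ), hK1, by positivity, ?_⟩
  intro q q₁ q₂ q₃ s hd hs hss
  rw [le_div_iff₀ (by positivity)] at hss
  have q1 : 0 < s * (2 * K₁ / δ) := by positivity
  have q2 : 0 < s * (2 * B) := by positivity
  have hsB : 2 * B * s ≤ 1 := by linarith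
  have hs1 : s ≤ 1 := (le_mul_of_one_le_left hs.le (by linarith)).trans hsB
  have hsK₁ : K₁ * s ≤ δ / 2 := by
    have h1 : s * (2 * K₁ / δ) ≤ 1 := by linarith
    rw [mul_div_assoc', div_le_one hδ] at h1
    linarith
  have hδabs : |δ| ≤ δ := (abs_of_pos hδ).le
  have hz0 : |(0 : ℝ)| ≤ δ := by rw [abs_zero]; exact hδ.le
  -- the value at the origin
  have hq0 : q 0 ≤ -(s ^ 2 / 2) := by
    have h1 := (abs_le.mp hd.q_zero).2
    have h2 : B * (s ^ 2) ^ 2 ≤ s ^ 2 / 2 := by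
      have h3 : 2 * B * s * s ≤ 1 * 1 := by gcongr
      calc B * (s ^ 2) ^ 2 = (2 * B * s * s) * (s ^ 2 / 2) := by ring
        _ ≤ (1 * 1) * (s ^ 2 / 2) := by gcongr
        _ = _ := by ring
    linarith
  have hq0' : -(2 * s ^ 2) ≤ q 0 := by
    have h1 := (abs_le.mp hd.q_zero).1
    have h2 : B * (s ^ 2) ^ 2 ≤ s ^ 2 := by
      have h3 : 2 * B * s * s ≤ 1 * 1 := by gcongr
      calc B * (s ^ 2) ^ 2 = (2 * B * s * s) * (s ^ 2 / 2) := by ring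
        _ ≤ (1 * 1) * (s ^ 2 / 2) := by gcongr
        _ ≤ _ := by linarith [sq_nonneg s]
    linarith
  have hs2 : 0 < s ^ 2 := by positivity
  have hqδ : 0 < q (-δ) := by
    have := hd.far (-δ) (by rw [abs_neg]; exact le_abs_self δ)
    have h2 : 0 < c * (-δ) ^ 2 := by rw [neg_sq]; positivity
    linarith
  obtain ⟨x₀, ⟨hx1, hx2⟩, hqx₀⟩ : (0 : ℝ) ∈ q '' Icc (-δ) 0 :=
    intermediate_value_Icc' (by linarith) hd.cont.continuousOn ⟨by linarith, hqδ.le⟩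
  have hx₀0 : x₀ < 0 := by
    rcases hx2.eq_or_lt with h | h
    · rw [h] at hqx₀; linarith
    · exact h
  have hx₀δ : |x₀| ≤ δ := abs_le.mpr ⟨hx1, by linarith⟩
  have hx₀abs : |x₀| = -x₀ := abs_of_neg hx₀0
  have hq₁0 := abs_le.mp hd.q₁_zero
  -- the size of the zero
  have hx₀K₁ : -x₀ ≤ K₁ * s := by
    have h1 := hd.quadratic_le hx₀δ hz0
    rw [hqx₀, sub_zero] at h1
    have h2 : -(B * s ^ 2) ≤ q₁ 0 * x₀ := by
      have : |q₁ 0 * x₀| ≤ B * s ^ 2 * 1 := by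
        rw [abs_mul]
        exact mul_le_mul hd.q₁_zero (hx₀δ.trans hδ1) (abs_nonneg _) (by positivity)
      linarith [(abs_le.mp this).1]
    have h3 : x₀ ^ 2 ≤ 4 * (2 + B) / β * s ^ 2 := by
      rw [div_mul_eq_mul_div, le_div_iff₀ hβ]
      linarith
    have h4 : (-x₀) ^ 2 ≤ (K₁ * s) ^ 2 := by
      have h5 : 4 * (2 + B) / β ≤ K₁ ^ 2 := by linarith [le_self_pow₀ hK₁1 two_ne_zero]
      calc (-x₀) ^ 2 = x₀ ^ 2 := neg_sq _
        _ ≤ 4 * (2 + B) / β * s ^ 2 := h3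
        _ ≤ K₁ ^ 2 * s ^ 2 := by gcongr
        _ = _ := by ring
    exact le_of_sq_le_sq h4 (by positivity)
  -- the slope
  have hσlow0 : s ^ 2 / 2 ≤ -q₁ x₀ * (-x₀) := by
    have h1 := hd.quadratic_le hz0 hx₀δ
    rw [hqx₀] at h1
    have : 0 ≤ β / 4 * (0 - x₀) ^ 2 := by positivity
    linarith
  have hσlow : s / (2 * K₁) ≤ -q₁ x₀ := by
    have hpos : 0 < -q₁ x₀ := by
      by_contra hneg
      have : -q₁ x₀ * (-x₀) ≤ 0 := mul_nonpos_of_nonpos_of_nonneg (not_lt.mp hneg) (by linarith)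
      linarith
    rw [div_le_iff₀ (by positivity)]
    have h2 : -q₁ x₀ * (-x₀) ≤ -q₁ x₀ * (K₁ * s) := by gcongr
    have h3 : s * s ≤ s * (-q₁ x₀ * (2 * K₁)) := by linarith
    exact le_of_mul_le_mul_left h3 hs
  have hσpos : 0 < -q₁ x₀ := lt_of_lt_of_le (by positivity) hσlow
  have hσup : -q₁ x₀ ≤ B * (1 + K₁) * s := by
    have h1 : |q₁ x₀ - q₁ 0| ≤ B * |x₀ - 0| := by
      have := abs_le_mul_pow_of_hasDerivAt (n := 0) (f := fun x => q₁ x - q₁ 0)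
        (fun y => (hd.d₂ y).sub_const _) hz0 (sub_self _) hB0.le
        (fun y hy => by simpa using hd.q₂_le y hy) hx₀δ
      simpa using this
    rw [sub_zero, hx₀abs] at h1
    have h2 : B * (-x₀) ≤ B * (K₁ * s) := by gcongr
    have h3 : B * s ^ 2 ≤ B * s := by
      gcongr
      exact pow_le_of_le_one hs.le hs1 two_ne_zero
    linarith [(abs_le.mp h1).1]
  have hx₀low : s / (2 * B * (1 + K₁)) ≤ -x₀ := by
    rw [div_le_iff₀ p2]
    have h1 : -q₁ x₀ * (-x₀) ≤ B * (1 + K₁) * s * (-x₀) := by gcongr; linarith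
    have h3 : s * s ≤ s * (-x₀ * (2 * B * (1 + K₁))) := by linarith
    exact le_of_mul_le_mul_left h3 hs
  have hsK : s / K ≤ s / (2 * K₁) := by gcongr
  refine ⟨x₀, q₂ x₀ / 6, ?_, hqx₀, ?_⟩
  · refine ⟨hd.cont, hs, hs1, hK1, ?_, ?_, hsK.trans hσlow, ?_, ?_, ?_, ?_, ?_, ?_⟩
    · have : s / K ≤ s / (2 * B * (1 + K₁)) := by gcongr
      linarith
    · have : K₁ * s ≤ K * s := by gcongr; linarith
      linarith
    · refine hσup.trans ?_
      gcongr
      linarith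
    -- Inside `[-δ, x₀]` the tangent at `x₀` bounds `q` from below; further out the quadratic growth
    -- does.
    · intro y hy
      rcases le_or_gt (-δ) y with h | h
      · have h1 := hd.quadratic_le (y := y) (abs_le.mpr ⟨h, by linarith⟩) hx₀δ
        rw [hqx₀] at h1
        have h2 : s / K * (x₀ - y) ≤ -q₁ x₀ * (x₀ - y) := by
          have : 0 ≤ x₀ - y := by linarith
          gcongr
          exact hsK.trans hσlow
        have : 0 ≤ β / 4 * (y - x₀) ^ 2 := by positivity
        linarith
      · have hyabs : |y| = -y := abs_of_neg (by linarith)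
        have h1 := hd.far y (by rw [hyabs]; linarith)
        have h2 : s / K ≤ c * δ := by
          rw [div_le_iff₀ hK0]
          rw [div_le_iff₀ (by positivity)] at hKc
          linarith
        calc s / K * (x₀ - y) ≤ c * δ * (-y) := by
              gcongr
              all_goals linarith
          _ ≤ c * (-y) * (-y) := by
              gcongr
              all_goals linarith
          _ = c * y ^ 2 := by ring
          _ ≤ q y := h1
    · intro y hy1 hy2
      have hx₀ne : 0 < -x₀ := by linarith
      have h1 := hd.chord_le hβ.le hx₀δ hx₀0 hqx₀ hy1 hy2
      have h2 : s / K ≤ (s ^ 2 / 2) / (-x₀) := by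
        refine hsK.trans ?_
        rw [div_le_div_iff₀ (by positivity) hx₀ne]
        have : s * -x₀ ≤ s * (K₁ * s) := by gcongr
        linarith
      calc s / K * (y - x₀) ≤ (s ^ 2 / 2) / (-x₀) * (y - x₀) := by
            have : 0 ≤ y - x₀ := by linarith
            gcongr
        _ = (y - x₀) / (-x₀) * (s ^ 2 / 2) := by ring
        _ ≤ (y - x₀) / (-x₀) * (-q 0) := by
            refine mul_le_mul_of_nonneg_left ?_ (div_nonneg (by linarith) hx₀ne.le)
            linarith
        _ ≤ -q y := h1
    · intro y hy1 hy2
      have h1 := hd.quadratic_le (y := y) (abs_le.mpr ⟨by linarith, by linarith⟩) hx₀δ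
      rw [hqx₀] at h1
      have h2 : 0 ≤ β / 4 * (y - x₀) ^ 2 := by positivity
      have h3 : -q₁ x₀ * (y - x₀) ≤ B * (1 + K₁) * s * (K₁ * s) := by
        gcongr
        all_goals linarith
      have h4 : B * (1 + K₁) * K₁ * s ^ 2 ≤ K * s ^ 2 := by gcongr; linarith
      linarith
    · rw [abs_div, abs_of_pos (by norm_num : (0 : ℝ) < 6)]
      have := hd.q₂_le x₀ hx₀δ
      linarith
    · intro x hx hxx₀
      have hxδ : |x| ≤ δ := by
        have h1 : 1 / K ≤ δ / 2 := by
          rw [div_le_div_iff₀ hK0 two_pos]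
          rw [div_le_iff₀ hδ] at hKδ
          linarith
        have := (abs_le.mp hxx₀).1
        exact abs_le.mpr ⟨by linarith, by linarith⟩
      have h1 := hd.abs_integral_sub_le hB0.le hxδ hx₀δ
      rw [hqx₀] at h1
      have e : |x - x₀| ^ 4 = (x - x₀) ^ 4 := Even.pow_abs (by decide) _
      rw [e] at h1
      calc _ = |(∫ t in x₀..x, q t) - 0 * (x - x₀) - q₁ x₀ / 2 * (x - x₀) ^ 2 -
            q₂ x₀ / 6 * (x - x₀) ^ 3| := by ring_nf
        _ ≤ _ := h1
        _ ≤ _ := by gcongr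
  · have h1 := hd.abs_q_sub_le hB0.le hx₀δ hz0
    rw [hqx₀, sub_zero, hx₀abs] at h1
    have hx₀3 : (-x₀) ^ 3 ≤ (K₁ * s) ^ 3 := by
      gcongr
      linarith
    have hx₀2 : x₀ ^ 2 ≤ (K₁ * s) ^ 2 := by
      rw [← neg_sq]
      gcongr
      linarith
    have h2 : |q₁ 0 * x₀| ≤ B * s ^ 2 * (K₁ * s) := by
      rw [abs_mul, hx₀abs]
      exact mul_le_mul hd.q₁_zero hx₀K₁ (by linarith) (by positivity)
    have h3 : |(q₂ 0 - β) / 2 * x₀ ^ 2| ≤ B * s ^ 2 * (K₁ * s) ^ 2 := by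
      rw [abs_mul, abs_div, abs_two, abs_of_nonneg (sq_nonneg x₀)]
      refine mul_le_mul ?_ hx₀2 (sq_nonneg _) (by positivity)
      have := hd.q₂_zero
      have : 0 ≤ B * s ^ 2 := by positivity
      linarith
    have h4 : |β / 2 * x₀ ^ 2 - s ^ 2| ≤ (B * K₁ + B * K₁ ^ 3 + B + B * K₁ ^ 2) * s ^ 3 := by
      have e : β / 2 * x₀ ^ 2 - s ^ 2 = -(0 - q 0 - q₁ 0 * x₀ - q₂ 0 / 2 * x₀ ^ 2) -
          (q 0 + s ^ 2) - q₁ 0 * x₀ - (q₂ 0 - β) / 2 * x₀ ^ 2 := by ring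
      have hs4 : (s ^ 2) ^ 2 ≤ s ^ 3 := by
        calc (s ^ 2) ^ 2 = s ^ 3 * s := by ring
          _ ≤ s ^ 3 * 1 := by gcongr
          _ = _ := mul_one _
      have h5 : B * (s ^ 2) ^ 2 ≤ B * s ^ 3 := by gcongr
      have h6 : B * s ^ 2 * (K₁ * s) ^ 2 ≤ B * K₁ ^ 2 * s ^ 3 := by
        calc B * s ^ 2 * (K₁ * s) ^ 2 = B * K₁ ^ 2 * (s ^ 2) ^ 2 := by ring
          _ ≤ _ := by gcongr
      have h7 : B * (-x₀) ^ 3 ≤ B * (K₁ * s) ^ 3 := by gcongr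
      have a1 := abs_le.mp h1
      have a2 := abs_le.mp h2
      have a3 := abs_le.mp h3
      have a4 := abs_le.mp hd.q_zero
      rw [e, abs_le]
      constructor
      · linarith [a1.1, a1.2, a2.1, a2.2, a3.1, a3.2, a4.1, a4.2]
      · linarith [a1.1, a1.2, a2.1, a2.2, a3.1, a3.2, a4.1, a4.2]
    -- Taylor expansion at `0` controls only `x₀² - s² r²`. Since `x₀ < 0`, the factor `|x₀ - s r|`
    -- is at least `s r`, and dividing by it gains the missing power of `s`.
    have e2 : (x₀ + s * r) * (x₀ - s * r) = 2 / β * (β / 2 * x₀ ^ 2 - s ^ 2) := by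
      have : (x₀ + s * r) * (x₀ - s * r) = x₀ ^ 2 - s ^ 2 * r ^ 2 := by ring
      rw [this, hr2]
      field_simp
    have h8 : |x₀ + s * r| * (s * r) ≤ K₃ * s ^ 2 * (s * r) := by
      calc |x₀ + s * r| * (s * r) ≤ |x₀ + s * r| * |x₀ - s * r| := by
            gcongr
            rw [abs_of_neg (by linarith [mul_pos hs hr])]
            linarith
        _ = 2 / β * |β / 2 * x₀ ^ 2 - s ^ 2| := by
            rw [← abs_mul, e2, abs_mul, abs_of_pos (by positivity)]
        _ ≤ 2 / β * ((B * K₁ + B * K₁ ^ 3 + B + B * K₁ ^ 2) * s ^ 3) := by gcongr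
        _ = _ := by rw [hK₃]; field_simp
    have h9 := le_of_mul_le_mul_right h8 (by positivity)
    refine h9.trans ?_
    gcongr

/-! ### Uniform data for `Im g(·, α)` on the strip -/

theorem uniqueDiffOn_strip {A : ℝ} (hA : 0 < A) : UniqueDiffOn ℝ (strip A) :=
  uniqueDiffOn_univ.prod (uniqueDiffOn_Icc hA)

/-- The directional derivative along `v` of a function on the strip. -/
noncomputable def stripDeriv (A : ℝ) (v : ℝ × ℝ) (F : ℝ × ℝ → ℝ) (p : ℝ × ℝ) : ℝ :=
  fderivWithin ℝ F (strip A) p v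

theorem ContDiffOn.stripDeriv {A : ℝ} (hA : 0 < A) {F : ℝ × ℝ → ℝ} (hF : ContDiffOn ℝ ∞ F (strip A))
    (v : ℝ × ℝ) : ContDiffOn ℝ ∞ (stripDeriv A v F) (strip A) :=
  (hF.fderivWithin (uniqueDiffOn_strip hA) (by simp)).clm_apply contDiffOn_const

theorem mem_strip {A x α : ℝ} (hα : α ∈ Icc 0 A) : (x, α) ∈ strip A := ⟨mem_univ _, hα⟩

theorem hasDerivAt_strip_fst {A : ℝ} {F : ℝ × ℝ → ℝ} (hF : ContDiffOn ℝ ∞ F (strip A)) {α : ℝ}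
    (hα : α ∈ Icc 0 A) (x : ℝ) :
    HasDerivAt (fun x => F (x, α)) (stripDeriv A (1, 0) F (x, α)) x := by
  have h1 := (hF.differentiableOn (by simp) (x, α) (mem_strip hα)).hasFDerivWithinAt
  have h2 : HasDerivWithinAt (fun x : ℝ => (x, α)) (1, 0) univ x :=
    ((hasDerivAt_id x).prodMk (hasDerivAt_const x α)).hasDerivWithinAt
  exact (h1.comp_hasDerivWithinAt x h2 fun y _ => mem_strip hα).hasDerivAt Filter.univ_mem

theorem hasDerivWithinAt_strip_snd {A : ℝ} {F : ℝ × ℝ → ℝ} (hF : ContDiffOn ℝ ∞ F (strip A))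
    {α : ℝ} (hα : α ∈ Icc 0 A) (x : ℝ) :
    HasDerivWithinAt (fun α => F (x, α)) (stripDeriv A (0, 1) F (x, α)) (Icc 0 A) α := by
  have h1 := (hF.differentiableOn (by simp) (x, α) (mem_strip hα)).hasFDerivWithinAt
  have h2 : HasDerivWithinAt (fun α : ℝ => (x, α)) (0, 1) (Icc 0 A) α :=
    ((hasDerivAt_const α x).prodMk (hasDerivAt_id α)).hasDerivWithinAt
  exact h1.comp_hasDerivWithinAt α h2 fun y hy => mem_strip hy

theorem exists_bound_strip {A r : ℝ} {F : ℝ × ℝ → ℝ} (hF : ContDiffOn ℝ ∞ F (strip A)) :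
    ∃ B : ℝ, 0 ≤ B ∧ ∀ x, |x| ≤ r → ∀ α ∈ Icc 0 A, |F (x, α)| ≤ B := by
  obtain ⟨B, hB⟩ := ((isCompact_Icc (a := -r) (b := r)).prod
    (isCompact_Icc (a := (0 : ℝ)) (b := A))).exists_bound_of_continuousOn
    (hF.continuousOn.mono (prod_mono_left (subset_univ _)))
  exact ⟨|B|, abs_nonneg B, fun x hx α hα =>
    (hB (x, α) ⟨abs_le.mp hx, hα⟩).trans (le_abs_self B)⟩

theorem abs_sub_le_of_stripDeriv_le {A r B : ℝ} {F : ℝ × ℝ → ℝ} (hF : ContDiffOn ℝ ∞ F (strip A))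
    (hB : ∀ x, |x| ≤ r → ∀ α ∈ Icc 0 A, |stripDeriv A (0, 1) F (x, α)| ≤ B) {x : ℝ} (hx : |x| ≤ r)
    {α : ℝ} (hα : α ∈ Icc 0 A) : |F (x, α) - F (x, 0)| ≤ B * α := by
  have h1 := (convex_Icc 0 A).norm_image_sub_le_of_norm_hasDerivWithin_le
    (f := fun α => F (x, α)) (C := B) (fun β hβ => hasDerivWithinAt_strip_snd hF hβ x)
    (fun β hβ => hB x hx β hβ) (left_mem_Icc.mpr (hα.1.trans hα.2)) hα
  rwa [sub_zero, Real.norm_of_nonneg hα.1] at h1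

/-- On compact parts of the strip the derivatives in `α` are bounded, so `Im g` and its
`x`-derivatives differ by `O(α)` from their values at `α = 0`. Away from the origin, positivity at
`α = 0` and compactness give the lower bound up to a fixed radius, and the assumed growth gives it
beyond. -/
theorem exists_wellData {A : ℝ} (hA : 0 < A) {g : ℝ → ℝ → ℂ}
    (hg : ContDiffOn ℝ ∞ (fun q : ℝ × ℝ => g q.1 q.2) (strip A)) {C₀ : ℝ} (hC₀ : 0 < C₀)
    (hlow : ∀ x, ∀ α ∈ Icc 0 A, x ^ 2 / C₀ - C₀ ≤ (g x α).im)
    (hpos : ∀ x, x ≠ 0 → 0 < (g x 0).im) (hg0 : g 0 0 = 0)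
    (hgα : derivWithin (fun α => g 0 α) (Icc 0 A) 0 = -Complex.I)
    (hgx : deriv (fun x => g x 0) 0 = 0)
    (hgxx : 0 < (iteratedDeriv 2 (fun x => g x 0) 0).im) :
    ∃ (q₁ q₂ q₃ : ℝ → ℝ → ℝ) (δ B c ε : ℝ), 0 < δ ∧ δ ≤ 1 ∧ 1 ≤ B ∧ 0 < c ∧ 0 < ε ∧ ε ≤ A ∧
      ∀ α ∈ Ioc 0 ε, WellData (fun x => (g x α).im) (q₁ α) (q₂ α) (q₃ α)
        (iteratedDeriv 2 (fun x => g x 0) 0).im δ B c α := by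
  set β := (iteratedDeriv 2 (fun x => g x 0) 0).im with hβ
  have h0A : (0 : ℝ) ∈ Icc 0 A := left_mem_Icc.mpr hA.le
  let Q : ℝ × ℝ → ℝ := fun p => (g p.1 p.2).im
  have hQ : ContDiffOn ℝ ∞ Q (strip A) := Complex.imCLM.contDiff.comp_contDiffOn hg
  set Q₁ := stripDeriv A (1, 0) Q
  set Q₂ := stripDeriv A (1, 0) Q₁
  set Q₃ := stripDeriv A (1, 0) Q₂
  have hQ₁ : ContDiffOn ℝ ∞ Q₁ (strip A) := hQ.stripDeriv hA _
  have hQ₂ : ContDiffOn ℝ ∞ Q₂ (strip A) := hQ₁.stripDeriv hA _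
  have hQ₃ : ContDiffOn ℝ ∞ Q₃ (strip A) := hQ₂.stripDeriv hA _
  set P := stripDeriv A (0, 1) Q
  have hP : ContDiffOn ℝ ∞ P (strip A) := hQ.stripDeriv hA _
  have hslice : ContDiff ℝ ∞ fun x => g x 0 := by
    rw [← contDiffOn_univ]
    exact hg.comp (contDiff_id.prodMk contDiff_const).contDiffOn fun x _ => mem_strip h0A
  have hslice' : ContDiff ℝ ∞ (deriv fun x => g x 0) := (contDiff_infty_iff_deriv.mp hslice).2
  -- values of the derivatives at the origin
  have hQ00 : Q (0, 0) = 0 := by simp [Q, hg0]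
  have hQ₁x : ∀ x, Q₁ (x, 0) = (deriv (fun x => g x 0) x).im := fun x =>
    (hasDerivAt_strip_fst hQ h0A x).unique (Complex.imCLM.hasFDerivAt.comp_hasDerivAt x
      ((hslice.differentiable (by simp)) x).hasDerivAt)
  have hQ₁0 : Q₁ (0, 0) = 0 := by rw [hQ₁x, hgx, Complex.zero_im]
  have hQ₂0 : Q₂ (0, 0) = β := by
    have h1 := hasDerivAt_strip_fst hQ₁ h0A 0
    simp_rw [hQ₁x] at h1
    rw [hβ, iteratedDeriv_succ, iteratedDeriv_one]
    exact h1.unique (Complex.imCLM.hasFDerivAt.comp_hasDerivAt 0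
      ((hslice'.differentiable (by simp)) 0).hasDerivAt)
  have hP0 : P (0, 0) = -1 := by
    have hgd : DifferentiableWithinAt ℝ (fun α => g 0 α) (Icc 0 A) 0 :=
      ((hg.differentiableOn (by simp)) (0, 0) (mem_strip h0A)).comp 0
        (t := strip A) (f := fun α : ℝ => ((0 : ℝ), α)) (by fun_prop) fun α hα => mem_strip hα
    have h1 := Complex.imCLM.hasFDerivAt.comp_hasDerivWithinAt 0 hgd.hasDerivWithinAt
    rw [hgα] at h1
    have h2 := (uniqueDiffOn_Icc hA 0 h0A).eq_deriv _ (hasDerivWithinAt_strip_snd hQ h0A 0) h1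
    exact h2.trans (by simp)
  -- uniform bounds
  obtain ⟨r, hr⟩ : ∃ r, r = 2 * C₀ + 1 := ⟨_, rfl⟩
  have hr1 : 1 ≤ r := by linarith
  obtain ⟨B₁, hB₁0, hB₁⟩ := exists_bound_strip (r := r) hP
  obtain ⟨B₂, hB₂0, hB₂⟩ := exists_bound_strip (r := r) (hP.stripDeriv hA (0, 1))
  obtain ⟨B₃, hB₃0, hB₃⟩ := exists_bound_strip (r := r) (hQ₁.stripDeriv hA (0, 1))
  obtain ⟨B₄, hB₄0, hB₄⟩ := exists_bound_strip (r := r) (hQ₂.stripDeriv hA (0, 1))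
  obtain ⟨B₅, hB₅0, hB₅⟩ := exists_bound_strip (r := r) hQ₂
  obtain ⟨B₆, hB₆0, hB₆⟩ := exists_bound_strip (r := r) hQ₃
  obtain ⟨B, hB⟩ : ∃ B, B = 1 + B₁ + B₂ + B₃ + B₄ + B₅ + B₆ := ⟨_, rfl⟩
  have hB1 : 1 ≤ B := by linarith
  have hBp : 0 < B := by linarith
  obtain ⟨δ, hδ⟩ : ∃ δ, δ = min 1 (β / (4 * B)) := ⟨_, rfl⟩
  have hδ0 : 0 < δ := by rw [hδ]; positivity
  have hδ1 : δ ≤ 1 := by rw [hδ]; exact min_le_left _ _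
  have hδB : B * δ ≤ β / 4 := by
    calc B * δ ≤ B * (β / (4 * B)) := by rw [hδ]; gcongr; exact min_le_right _ _
      _ = β / 4 := by field_simp
  obtain ⟨c₁, hc₁0, hc₁⟩ : ∃ c₁, 0 < c₁ ∧ ∀ x ∈ Icc (-r) r ∩ {x : ℝ | δ ≤ |x|}, c₁ ≤ (g x 0).im := by
    refine IsCompact.exists_forall_le' (isCompact_Icc.inter_right
      (isClosed_le continuous_const continuous_abs))
      (Complex.continuous_im.comp hslice.continuous).continuousOn fun x hx => hpos x ?_
    rintro rfl
    have := hx.2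
    simp only [mem_ofPred_eq, abs_zero] at this
    linarith
  -- `δ` and `ε` each cost the second derivative at most `β/4`, one for moving in `x` and the other
  -- in `α`, leaving `β/2`. The last entry preserves half of the positive minimum `c₁`.
  obtain ⟨ε, hε⟩ : ∃ ε, ε = min A (min (β / (4 * B)) (c₁ / (2 * B))) := ⟨_, rfl⟩
  have hε0 : 0 < ε := by rw [hε]; positivity
  have hεA : ε ≤ A := by rw [hε]; exact min_le_left _ _
  have hεβ : B * ε ≤ β / 4 := by
    calc B * ε ≤ B * (β / (4 * B)) := by
          rw [hε]; gcongr; exact (min_le_right _ _).trans (min_le_left _ _)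
      _ = β / 4 := by field_simp
  have hεc : B * ε ≤ c₁ / 2 := by
    calc B * ε ≤ B * (c₁ / (2 * B)) := by
          rw [hε]; gcongr; exact (min_le_right _ _).trans (min_le_right _ _)
      _ = c₁ / 2 := by field_simp
  refine ⟨fun α x => Q₁ (x, α), fun α x => Q₂ (x, α), fun α x => Q₃ (x, α), δ, B,
    min (1 / (2 * C₀)) (c₁ / (2 * r ^ 2)), ε, hδ0, hδ1, hB1, by positivity, hε0, hεA, ?_⟩
  intro α hα
  have hαA : α ∈ Icc 0 A := ⟨hα.1.le, hα.2.trans hεA⟩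
  have hαB : B * α ≤ B * ε := by have := hα.2; gcongr
  have h0r : |(0 : ℝ)| ≤ r := by rw [abs_zero]; linarith
  have hmono : ∀ {b t : ℝ}, t ≤ b * α → b ≤ B → t ≤ B * α := fun h1 h2 =>
    h1.trans (mul_le_mul_of_nonneg_right h2 hα.1.le)
  have hq₂0 : |Q₂ (0, α) - β| ≤ B * α := by
    rw [← hQ₂0]
    exact hmono (abs_sub_le_of_stripDeriv_le hQ₂ hB₄ h0r hαA) (by linarith)
  have hq₃ : ∀ x, |x| ≤ δ → |Q₃ (x, α)| ≤ B := fun x hx =>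
    (hB₆ x (by linarith) α hαA).trans (by linarith)
  refine ⟨hasDerivAt_strip_fst hQ hαA, hasDerivAt_strip_fst hQ₁ hαA, hasDerivAt_strip_fst hQ₂ hαA,
    fun x hx => ?_, fun x hx => (hB₅ x (by linarith) α hαA).trans (by linarith), hq₃,
    ?_, ?_, hq₂0, fun x hx => ?_⟩
  · have h1 := abs_le_mul_pow_of_hasDerivAt (n := 0) (z := 0) (f := fun x => Q₂ (x, α) - Q₂ (0, α))
      (fun y => (hasDerivAt_strip_fst hQ₂ hαA y).sub_const _) (by rw [abs_zero]; exact hδ0.le)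
      (sub_self _) hBp.le (fun y hy => by simpa using hq₃ y hy) hx
    rw [sub_zero, zero_add, pow_one] at h1
    have h2 : B * |x| ≤ B * δ := by gcongr
    have h3 := (abs_le.mp h1).1
    have h4 := (abs_le.mp hq₂0).1
    linarith
  -- The derivative in `α` at `x = 0` is `-1 + O(α)`, so integrating it gives `-α + O(α²)`.
  · have hbound : ∀ a ∈ Icc 0 α, |P (0, a) - -1| ≤ B * α := fun a ha => by
      rw [← hP0]
      have haA : a ∈ Icc 0 A := ⟨ha.1, ha.2.trans hαA.2⟩
      refine (abs_sub_le_of_stripDeriv_le hP hB₂ h0r haA).trans ?_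
      have := ha.2
      have : 0 ≤ a := ha.1
      gcongr
      linarith
    have h1 := (convex_Icc 0 α).norm_image_sub_le_of_norm_hasDerivWithin_le
      (f := fun a => Q (0, a) + a) (f' := fun a => P (0, a) + 1) (C := B * α)
      (fun a ha => (((hasDerivWithinAt_strip_snd hQ ⟨ha.1, ha.2.trans hαA.2⟩ 0).mono
        (Icc_subset_Icc_right hαA.2)).add (hasDerivWithinAt_id a _)))
      (fun a ha => by simpa using hbound a ha) (left_mem_Icc.mpr hα.1.le) (right_mem_Icc.mpr hα.1.le)
    simp only [hQ00, add_zero, sub_zero, Real.norm_eq_abs, abs_of_pos hα.1] at h1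
    calc _ ≤ _ := h1
      _ = _ := by ring
  · have h1 := abs_sub_le_of_stripDeriv_le hQ₁ hB₃ h0r hαA
    rw [hQ₁0, sub_zero] at h1
    exact hmono h1 (by linarith)
  · rcases le_or_gt |x| r with hxr | hxr
    · have h1 := abs_sub_le_of_stripDeriv_le hQ hB₁ hxr hαA
      have h2 := hc₁ x ⟨abs_le.mp hxr, hx⟩
      have h3 : |Q (x, α) - Q (x, 0)| ≤ B * α := hmono h1 (by linarith)
      have h4 := (abs_le.mp h3).1
      have h5 : x ^ 2 ≤ r ^ 2 := by rw [← sq_abs]; gcongr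
      have hr0 : 0 < r := by linarith
      calc min (1 / (2 * C₀)) (c₁ / (2 * r ^ 2)) * x ^ 2 ≤ c₁ / (2 * r ^ 2) * r ^ 2 := by
            gcongr
            exact min_le_right _ _
        _ = c₁ / 2 := by field_simp
        _ ≤ Q (x, α) := by
            have : c₁ ≤ Q (x, 0) := h2
            linarith
    -- Beyond `r = 2 C₀ + 1` one has `x² ≥ 4 C₀²`, so half of `x²/C₀` outweighs the constant `C₀`.
    · have h1 := hlow x α hαA
      have h2 : (2 * C₀) ^ 2 ≤ x ^ 2 := by
        rw [← sq_abs x]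
        gcongr
        linarith
      calc min (1 / (2 * C₀)) (c₁ / (2 * r ^ 2)) * x ^ 2 ≤ 1 / (2 * C₀) * x ^ 2 := by
            gcongr
            exact min_le_left _ _
        _ ≤ x ^ 2 / C₀ - C₀ := by
            rw [← sub_nonneg]
            have e : x ^ 2 / C₀ - C₀ - 1 / (2 * C₀) * x ^ 2 = (x ^ 2 - 2 * C₀ ^ 2) / (2 * C₀) := by
              field_simp
              ring
            rw [e]
            refine div_nonneg ?_ (by positivity)
            linarith [sq_nonneg C₀]
        _ ≤ _ := h1

/-! ### Poisson brackets of the symbol -/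

section Poisson

variable {g : ℝ → ℝ → ℂ} {α : ℝ}

theorem hasFDerivAt_symb {ρ : ℝ × ℝ} (hg : DifferentiableAt ℝ (fun x => g x α) ρ.1) :
    HasFDerivAt (symb g α) (Complex.ofRealCLM.comp (ContinuousLinearMap.snd ℝ ℝ ℝ) +
      (ContinuousLinearMap.fst ℝ ℝ ℝ).smulRight (deriv (fun x => g x α) ρ.1)) ρ := by
  have h1 : HasFDerivAt (fun ρ : ℝ × ℝ => (ρ.2 : ℂ))
      (Complex.ofRealCLM.comp (ContinuousLinearMap.snd ℝ ℝ ℝ)) ρ :=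
    (Complex.ofRealCLM.comp (ContinuousLinearMap.snd ℝ ℝ ℝ)).hasFDerivAt
  have h2 : HasFDerivAt (fun ρ : ℝ × ℝ => g ρ.1 α)
      ((ContinuousLinearMap.fst ℝ ℝ ℝ).smulRight (deriv (fun x => g x α) ρ.1)) ρ :=
    (hg.hasDerivAt.hasFDerivAt.comp ρ hasFDerivAt_fst).congr_fderiv (by ext <;> simp)
  exact h1.add h2

theorem fderiv_symb {ρ : ℝ × ℝ} (hg : DifferentiableAt ℝ (fun x => g x α) ρ.1) (v : ℝ × ℝ) :
    fderiv ℝ (symb g α) ρ v = v.2 + v.1 * deriv (fun x => g x α) ρ.1 := by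
  rw [(hasFDerivAt_symb hg).fderiv]
  simp

theorem fderiv_symbConj {ρ : ℝ × ℝ} (hg : DifferentiableAt ℝ (fun x => g x α) ρ.1) (v : ℝ × ℝ) :
    fderiv ℝ (symbConj g α) ρ v =
      v.2 + v.1 * (starRingEnd ℂ) (deriv (fun x => g x α) ρ.1) := by
  have h : HasFDerivAt (symbConj g α) _ ρ :=
    Complex.conjCLE.toContinuousLinearMap.hasFDerivAt.comp ρ (hasFDerivAt_symb hg)
  rw [h.fderiv]
  simp

/-- Both `ξ`-derivatives are `1`, so the bracket is the conjugate of `g'_x` minus `g'_x`. -/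
theorem poisson_symb_symbConj {ρ : ℝ × ℝ} (hg : DifferentiableAt ℝ (fun x => g x α) ρ.1) :
    poisson (symb g α) (symbConj g α) ρ =
      -(2 * Complex.I * (deriv (fun x => g x α) ρ.1).im) := by
  rw [poisson, fderiv_symb hg, fderiv_symb hg, fderiv_symbConj hg, fderiv_symbConj hg]
  apply Complex.ext <;> simp
  ring

theorem poisson_symbConj_symb {ρ : ℝ × ℝ} (hg : DifferentiableAt ℝ (fun x => g x α) ρ.1) :
    poisson (symbConj g α) (symb g α) ρ =
      2 * Complex.I * (deriv (fun x => g x α) ρ.1).im := by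
  rw [poisson, fderiv_symb hg, fderiv_symb hg, fderiv_symbConj hg, fderiv_symbConj hg]
  apply Complex.ext <;> simp
  ring

theorem poissonHalfI_symb_symbConj {ρ : ℝ × ℝ} (hg : DifferentiableAt ℝ (fun x => g x α) ρ.1) :
    poissonHalfI (symb g α) (symbConj g α) ρ = ((-(deriv (fun x => g x α) ρ.1).im : ℝ) : ℂ) := by
  rw [poissonHalfI, poisson_symb_symbConj hg]
  have := Complex.I_ne_zero
  push_cast
  field_simp

theorem poissonHalfI_symbConj_symb {ρ : ℝ × ℝ} (hg : DifferentiableAt ℝ (fun x => g x α) ρ.1) :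
    poissonHalfI (symbConj g α) (symb g α) ρ = (((deriv (fun x => g x α) ρ.1).im : ℝ) : ℂ) := by
  rw [poissonHalfI, poisson_symbConj_symb hg]
  have := Complex.I_ne_zero
  field_simp

/-- The inner bracket `-Im g'_x` does not depend on `ξ`, and `p` has `ξ`-derivative `1`, so only an
`x`-derivative survives. -/
theorem poisson_symb_poissonHalfI (hg : ContDiff ℝ ∞ fun x => g x α) (ρ : ℝ × ℝ) :
    poisson (symb g α) (poissonHalfI (symb g α) (symbConj g α)) ρ =
      ((-(iteratedDeriv 2 (fun x => g x α) ρ.1).im : ℝ) : ℂ) := by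
  have hd : Differentiable ℝ fun x => g x α := hg.differentiable (by simp)
  have hd' : Differentiable ℝ (deriv fun x => g x α) :=
    (contDiff_infty_iff_deriv.mp hg).2.differentiable (by simp)
  have e : poissonHalfI (symb g α) (symbConj g α) =
      fun ρ => ((-(deriv (fun x => g x α) ρ.1).im : ℝ) : ℂ) :=
    funext fun ρ => poissonHalfI_symb_symbConj (hd ρ.1)
  have h1 : HasDerivAt (fun x => ((-(deriv (fun x => g x α) x).im : ℝ) : ℂ))
      ((-(iteratedDeriv 2 (fun x => g x α) ρ.1).im : ℝ) : ℂ) ρ.1 := by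
    rw [iteratedDeriv_succ, iteratedDeriv_one]
    exact (Complex.imCLM.hasFDerivAt.comp_hasDerivAt ρ.1 (hd' ρ.1).hasDerivAt).neg.ofReal_comp
  have h2 : HasFDerivAt (fun ρ : ℝ × ℝ => ((-(deriv (fun x => g x α) ρ.1).im : ℝ) : ℂ)) _ ρ :=
    h1.hasFDerivAt.comp ρ hasFDerivAt_fst
  rw [poisson, e, h2.fderiv, fderiv_symb (hd _), fderiv_symb (hd _)]
  simp

end Poisson

/-! ### Assembly -/

/-- The remainder estimate with no terms and no derivatives is a uniform bound on `g_*`, which is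
the form in which the size of `g_*` enters the norm estimate. -/
theorem exists_bound_of_hasSmoothExpansion {A : ℝ} {gs : ℝ → ℝ → ℝ → ℂ} {a : ℕ → ℝ → ℝ → ℂ}
    (hexp : HasSmoothExpansion A gs a) : ∃ G : ℝ, 0 ≤ G ∧
    ∀ h ∈ Ioc (0 : ℝ) 1, ∀ α ∈ Icc 0 A, ∀ x, ‖gs x α h‖ ≤ G := by
  obtain ⟨G, hG⟩ := hexp.2.2 0 0
  refine ⟨|G|, abs_nonneg G, fun h hh α hα x => ?_⟩
  have h1 := hG h hh (x, α) (mem_strip hα)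
  simp only [norm_iteratedFDerivWithin_zero, Finset.range_zero, Finset.sum_empty, sub_zero,
    pow_zero, mul_one] at h1
  exact h1.trans (le_abs_self G)

theorem contDiff_slice {A : ℝ} {f : ℝ → ℝ → ℂ}
    (hf : ContDiffOn ℝ ∞ (fun q : ℝ × ℝ => f q.1 q.2) (strip A)) {α : ℝ} (hα : α ∈ Icc 0 A) :
    ContDiff ℝ ∞ fun x => f x α := by
  rw [← contDiffOn_univ]
  exact hf.comp (contDiff_id.prodMk contDiff_const).contDiffOn fun x _ => mem_strip hα

theorem confining_of_bounds {g₀ γ : ℝ → ℂ} {C₀ G h : ℝ} (hg : ContDiff ℝ ∞ g₀)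
    (hγ : ContDiff ℝ ∞ γ) (hC₀ : 0 < C₀) (hG : 0 ≤ G) (hh : h ∈ Ioc (0 : ℝ) 1)
    (hlow : ∀ x, x ^ 2 / C₀ - C₀ ≤ (g₀ x).im) (hupp : ∀ x, ‖g₀ x‖ ≤ C₀ * (x ^ 2 + 1))
    (hγG : ∀ x, ‖γ x‖ ≤ G) :
    Confining (fun x => g₀ x + (h : ℂ) ^ 2 * γ x) (1 / C₀) (C₀ + G) := by
  have hn : ∀ x, ‖(h : ℂ) ^ 2 * γ x‖ ≤ G := fun x => by
    rw [norm_mul, norm_pow, Complex.norm_real, Real.norm_eq_abs, sq_abs]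
    exact (mul_le_of_le_one_left (norm_nonneg _) (pow_le_one₀ hh.1.le hh.2)).trans (hγG x)
  refine ⟨hg.add (contDiff_const.mul hγ), by positivity, by positivity, fun x => ?_, fun x => ?_⟩
  · have h1 := (abs_le.mp ((Complex.abs_im_le_norm _).trans (hn x))).1
    have h2 := hlow x
    rw [Complex.add_im, one_div_mul_eq_div]
    linarith
  · refine (norm_add_le _ _).trans ?_
    have h1 := hupp x
    have h2 := hn x
    nlinarith [mul_nonneg hG (sq_nonneg x)]

/-- The imaginary part of the action is the sum of the depths of the two wells, seen from `0`; this
identifies the exponents of the two Laplace integrals with `Im ℓ₀`. -/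
theorem action_im {g : ℝ → ℝ → ℂ} {α : ℝ} (hg : Continuous fun x => g x α) (a b : ℝ) :
    (action g α a (-b)).im =
      (∫ t in (0 : ℝ)..a, (g t α).im) + ∫ t in (0 : ℝ)..b, (g (-t) α).im := by
  have hi : ∀ a b : ℝ, IntervalIntegrable (fun t => (g t α).im) volume a b := fun a b =>
    (Complex.continuous_im.comp hg).intervalIntegrable a b
  have h1 : (∫ y in a..(-b), g y α).im = ∫ y in a..(-b), (g y α).im :=
    (Complex.imCLM.intervalIntegral_comp_comm (hg.intervalIntegrable _ _)).symm
  rw [action, Complex.neg_im, h1, intervalIntegral.integral_comp_neg (fun t => (g t α).im),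
    neg_zero, ← intervalIntegral.integral_add_adjacent_intervals (hi a 0) (hi 0 (-b)),
    intervalIntegral.integral_symm 0 a, intervalIntegral.integral_symm 0 (-b)]
  ring

theorem leadingTerm_eq {g : ℝ → ℝ → ℂ} {α h : ℝ} {ρp ρm : ℝ × ℝ}
    (hg : Differentiable ℝ fun x => g x α) :
    leadingTerm g α h ρp ρm = tunnelTerm h (action g α ρp.1 ρm.1).im
      (-(deriv (fun x => g x α) ρp.1).im) (deriv (fun x => g x α) ρm.1).im := by
  rw [leadingTerm, tunnelTerm, poissonHalfI_symb_symbConj (hg _), poissonHalfI_symbConj_symb (hg _),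
    Complex.ofReal_re, Complex.ofReal_re]

theorem LeftWell.zero_iff {q : ℝ → ℝ} {s xp xm σp σm cp cm K : ℝ} (hp : LeftWell q s xp σp cp K)
    (hm : LeftWell (fun x => q (-x)) s xm σm cm K) (hqp : q xp = 0) (hqm : q (-xm) = 0) (x : ℝ) :
    q x = 0 ↔ x = xp ∨ x = -xm := by
  have hsK : 0 < s / K := div_pos hp.s_pos hp.K_pos
  have key : ∀ {q : ℝ → ℝ} {x₀ σ c y : ℝ}, LeftWell q s x₀ σ c K → y ≤ 0 → q y = 0 → y = x₀ := by
    intro q x₀ σ c y hw hy hq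
    rcases lt_trichotomy y x₀ with h | h | h
    · have := hw.left y h.le
      have : 0 < s / K * (x₀ - y) := mul_pos hsK (by linarith)
      linarith
    · exact h
    · have := hw.right y h.le hy
      have : 0 < s / K * (y - x₀) := mul_pos hsK (by linarith)
      linarith
  constructor
  · intro hx
    rcases le_total x 0 with h | h
    · exact Or.inl (key hp h hx)
    · right
      have := key hm (y := -x) (by linarith) (by simpa using hx)
      linarith
  · rintro (rfl | rfl)
    · exact hqp
    · exact hqm

theorem symb_eq_zero_iff {g : ℝ → ℝ → ℂ} {α : ℝ} (ρ : ℝ × ℝ) :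
    symb g α ρ = 0 ↔ (g ρ.1 α).im = 0 ∧ ρ.2 = -(g ρ.1 α).re := by
  rw [symb, Complex.ext_iff]
  simp only [Complex.add_re, Complex.add_im, Complex.ofReal_re, Complex.ofReal_im, zero_add,
    Complex.zero_re, Complex.zero_im, eq_neg_iff_add_eq_zero]
  exact and_comm

/-- The characteristic points of `ξ + g(x, α)` are the bottoms of two opposite wells. -/
theorem exists_characteristic_points {A : ℝ} (hA : 0 < A) {g : ℝ → ℝ → ℂ}
    (hg : ContDiffOn ℝ ∞ (fun q : ℝ × ℝ => g q.1 q.2) (strip A)) {C₀ : ℝ} (hC₀ : 0 < C₀)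
    (hlow : ∀ x, ∀ α ∈ Icc 0 A, x ^ 2 / C₀ - C₀ ≤ (g x α).im)
    (hpos : ∀ x, x ≠ 0 → 0 < (g x 0).im) (hg0 : g 0 0 = 0)
    (hgα : derivWithin (fun α => g 0 α) (Icc 0 A) 0 = -Complex.I)
    (hgx : deriv (fun x => g x 0) 0 = 0)
    (hgxx : 0 < (iteratedDeriv 2 (fun x => g x 0) 0).im) :
    ∃ K ε : ℝ, ∃ ρp ρm : ℝ → ℝ × ℝ, 1 ≤ K ∧ 0 < ε ∧ ε ≤ A ∧ ∀ α ∈ Ioc 0 ε, ∃ cp cm : ℝ,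
      LeftWell (fun x => (g x α).im) (Real.sqrt α) (ρp α).1
        (-(deriv (fun x => g x α) (ρp α).1).im) cp K ∧
      LeftWell (fun x => (g (-x) α).im) (Real.sqrt α) (-(ρm α).1)
        (deriv (fun x => g x α) (ρm α).1).im cm K ∧
      symb g α (ρp α) = 0 ∧ symb g α (ρm α) = 0 ∧
      |(ρp α).1 + Real.sqrt α *
        Real.sqrt (2 / (iteratedDeriv 2 (fun x => g x 0) 0).im)| ≤ K * α ∧
      |(ρm α).1 - Real.sqrt α *
        Real.sqrt (2 / (iteratedDeriv 2 (fun x => g x 0) 0).im)| ≤ K * α := by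
  obtain ⟨q₁, q₂, q₃, δ, B, c, ε, hδ, hδ1, hB, hc, hε, hεA, hd⟩ :=
    exists_wellData hA hg hC₀ hlow hpos hg0 hgα hgx hgxx
  obtain ⟨K, s₀, hK, hs₀, hw⟩ := exists_leftWell hgxx hδ hδ1 hB hc
  -- The range of `α` is a premise inside the existential, so that `choose` yields total functions
  -- of `α`; outside the range the points are junk.
  have key : ∀ α, ∃ ρp ρm : ℝ × ℝ, α ∈ Ioc 0 (min ε (s₀ ^ 2)) → ∃ cp cm : ℝ,
      LeftWell (fun x => (g x α).im) (Real.sqrt α) ρp.1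
        (-(deriv (fun x => g x α) ρp.1).im) cp K ∧
      LeftWell (fun x => (g (-x) α).im) (Real.sqrt α) (-ρm.1)
        (deriv (fun x => g x α) ρm.1).im cm K ∧
      symb g α ρp = 0 ∧ symb g α ρm = 0 ∧
      |ρp.1 + Real.sqrt α *
        Real.sqrt (2 / (iteratedDeriv 2 (fun x => g x 0) 0).im)| ≤ K * α ∧
      |ρm.1 - Real.sqrt α *
        Real.sqrt (2 / (iteratedDeriv 2 (fun x => g x 0) 0).im)| ≤ K * α := by
    intro α
    by_cases hα : α ∈ Ioc 0 (min ε (s₀ ^ 2))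
    swap
    · exact ⟨0, 0, fun h => absurd h hα⟩
    have hαε : α ≤ ε := hα.2.trans (min_le_left _ _)
    have hs2 : Real.sqrt α ^ 2 = α := Real.sq_sqrt hα.1.le
    have hs : 0 < Real.sqrt α := Real.sqrt_pos.mpr hα.1
    have hss : Real.sqrt α ≤ s₀ :=
      (Real.sqrt_le_left hs₀.le).mpr (hα.2.trans (min_le_right _ _))
    have hdα := hd α ⟨hα.1, hαε⟩
    have hder : ∀ x, (deriv (fun x => g x α) x).im = q₁ α x := fun x => by
      have h1 : DifferentiableAt ℝ (fun x => g x α) x :=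
        (contDiff_slice hg ⟨hα.1.le, hαε.trans hεA⟩).differentiable (by simp) x
      exact (Complex.imCLM.hasFDerivAt.comp_hasDerivAt x h1.hasDerivAt).unique (hdα.d₁ x)
    rw [← hs2] at hdα
    obtain ⟨xp, cp, hwp, hqp, hxp⟩ := hw hdα hs hss
    -- The right zero is minus the left zero of the reflected function.
    obtain ⟨xm, cm, hwm, hqm, hxm⟩ := hw hdα.comp_neg hs hss
    rw [hs2] at hxp hxm hwp hwm hqp hqm
    refine ⟨(xp, -(g xp α).re), (-xm, -(g (-xm) α).re), fun _ => ⟨cp, cm, ?_, ?_, ?_, ?_, hxp, ?_⟩⟩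
    · simpa only [hder] using hwp
    · simpa only [hder, neg_neg] using hwm
    · exact (symb_eq_zero_iff _).mpr ⟨hqp, rfl⟩
    · exact (symb_eq_zero_iff _).mpr ⟨hqm, rfl⟩
    · rwa [← abs_neg, neg_sub, sub_neg_eq_add, add_comm]
  choose ρp ρm hρ using key
  exact ⟨K, min ε (s₀ ^ 2), ρp, ρm, hK, lt_min hε (by positivity), (min_le_left _ _).trans hεA, hρ⟩

theorem proposition1p1
    (A : ℝ) (hA : 0 < A)
    (g : ℝ → ℝ → ℂ) (gs : ℝ → ℝ → ℝ → ℂ) (a : ℕ → ℝ → ℝ → ℂ)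
    (hg : ContDiffOn ℝ ∞ (fun q : ℝ × ℝ => g q.1 q.2) (strip A))
    (C₀ : ℝ) (hC₀ : 0 < C₀)
    (hlow : ∀ x, ∀ α ∈ Icc 0 A, x ^ 2 / C₀ - C₀ ≤ (g x α).im)
    (hupp : ∀ x, ∀ α ∈ Icc 0 A, ‖g x α‖ ≤ C₀ * (x ^ 2 + 1))
    (hgs : ∀ h ∈ Ioc (0 : ℝ) 1, ContDiffOn ℝ ∞ (fun q : ℝ × ℝ => gs q.1 q.2 h) (strip A))
    (hexp : HasSmoothExpansion A gs a)
    (hpos : ∀ x, x ≠ 0 → 0 < (g x 0).im)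
    (hg0 : g 0 0 = 0)
    (hgα : derivWithin (fun α => g 0 α) (Icc 0 A) 0 = -Complex.I)
    (hgx : deriv (fun x => g x 0) 0 = 0)
    (hgxx : 0 < (iteratedDeriv 2 (fun x => g x 0) 0).im) :
    ∃ R : ℝ → ℝ → (L2 →L[ℂ] L2),
      -- `P_α` has domain `H_sc` and is invertible, for every `α` and every `h`
      (∀ α ∈ Icc 0 A, ∀ h ∈ Ioc (0 : ℝ) 1,
        (modelOp h (fun x => g x α + (h : ℂ) ^ 2 * gs x α h)).domain = Hsc ∧
        IsBoundedInverse (modelOp h (fun x => g x α + (h : ℂ) ^ 2 * gs x α h)) (R α h)) ∧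
      ∃ ρp ρm : ℝ → ℝ × ℝ, ∃ ε ∈ Ioc 0 A, ∃ C : ℝ, 0 < C ∧ ∀ α ∈ Ioc 0 ε,
        -- the characteristic set of `p_α` is `{ρ₊, ρ₋}`, labelled by the sign of the bracket
        {ρ : ℝ × ℝ | symb g α ρ = 0} = {ρp α, ρm α} ∧
        (deriv (fun x => g x α) (ρp α).1).im < 0 ∧
        0 < (deriv (fun x => g x α) (ρm α).1).im ∧
        0 < (poissonHalfI (symb g α) (symbConj g α) (ρp α)).re ∧
        0 < (poissonHalfI (symbConj g α) (symb g α) (ρm α)).re ∧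
        -- asymptotics of `x₊` and `x₋`
        (poisson (symb g 0) (poissonHalfI (symb g 0) (symbConj g 0)) (0, 0)).re < 0 ∧
        |(ρp α).1 + α ^ (1 / 2 : ℝ) *
          (-2 / (poisson (symb g 0) (poissonHalfI (symb g 0) (symbConj g 0)) (0, 0)).re)
            ^ (1 / 2 : ℝ)| ≤ C * α ∧
        |(ρm α).1 - α ^ (1 / 2 : ℝ) *
          (-2 / (poisson (symb g 0) (poissonHalfI (symb g 0) (symbConj g 0)) (0, 0)).re)
            ^ (1 / 2 : ℝ)| ≤ C * α ∧
        -- sizes of the action and of the brackets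
        α ^ (3 / 2 : ℝ) / C ≤ (action g α (ρp α).1 (ρm α).1).im ∧
        (action g α (ρp α).1 (ρm α).1).im ≤ C * α ^ (3 / 2 : ℝ) ∧
        (∀ ρ ∈ ({ρp α, ρm α} : Set (ℝ × ℝ)),
          α ^ (1 / 2 : ℝ) / C ≤ ‖1 / 2 * poisson (symb g α) (symbConj g α) ρ‖ ∧
          ‖1 / 2 * poisson (symb g α) (symbConj g α) ρ‖ ≤ C * α ^ (1 / 2 : ℝ)) ∧
        -- the norm of the inverse, for `h ≪ α^{3/2}`
        ∀ h ∈ Ioc (0 : ℝ) 1, h ≤ ε * α ^ (3 / 2 : ℝ) →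
          ∃ r s : ℝ, |r| ≤ C * (h / α ^ (3 / 2 : ℝ)) ∧
            |s| ≤ C * (1 / (h ^ (1 / 2 : ℝ) * α ^ (1 / 4 : ℝ))) ∧
            ‖R α h‖ = leadingTerm g α h (ρp α) (ρm α) * (1 + r) + s := by
  obtain ⟨G, hG, hγG⟩ := exists_bound_of_hasSmoothExpansion hexp
  have hconf : ∀ α ∈ Icc 0 A, ∀ h ∈ Ioc (0 : ℝ) 1,
      Confining (fun x => g x α + (h : ℂ) ^ 2 * gs x α h) (1 / C₀) (C₀ + G) := fun α hα h hh =>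
    confining_of_bounds (contDiff_slice hg hα)
      (contDiff_slice (f := fun x α => gs x α h) (hgs h hh) hα) hC₀ hG hh
      (fun x => hlow x α hα) (fun x => hupp x α hα) (hγG h hh α hα)
  have hinv : ∀ α h, ∃ R : L2 →L[ℂ] L2, α ∈ Icc 0 A → h ∈ Ioc (0 : ℝ) 1 →
      IsBoundedInverse (modelOp h (fun x => g x α + (h : ℂ) ^ 2 * gs x α h)) R ∧
      ∀ v, R v =ᵐ[volume] resolventFun h (fun x => g x α + (h : ℂ) ^ 2 * gs x α h) v := by
    intro α h
    by_cases H : α ∈ Icc 0 A ∧ h ∈ Ioc (0 : ℝ) 1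
    · obtain ⟨R, hR⟩ := (hconf α H.1 h H.2).exists_isBoundedInverse H.2.1
      exact ⟨R, fun _ _ => hR⟩
    · exact ⟨0, fun h1 h2 => absurd ⟨h1, h2⟩ H⟩
  choose R hR using hinv
  refine ⟨R, fun α hα h hh => ⟨(hconf α hα h hh).domain_modelOp h, (hR α h hα hh).1⟩, ?_⟩
  obtain ⟨K, ε₀, ρp, ρm, hK, hε₀, hε₀A, hρ⟩ :=
    exists_characteristic_points hA hg hC₀ hlow hpos hg0 hgα hgx hgxx
  obtain ⟨C₁, hC₁, hasym⟩ := exists_norm_inverse_asymptotic hK hG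
  have hK0 : 0 < K := by linarith
  set β := (iteratedDeriv 2 (fun x => g x 0) 0).im with hβ
  have h0 : (0 : ℝ) ∈ Icc 0 A := ⟨le_rfl, hA.le⟩
  have hbr : (poisson (symb g 0) (poissonHalfI (symb g 0) (symbConj g 0)) (0, 0)).re = -β := by
    rw [poisson_symb_poissonHalfI (contDiff_slice hg h0), Complex.ofReal_re]
  -- Chosen so that `s ≤ η` gives `16 G K⁴ s ≤ 1`, as the norm asymptotics require. Since `s = √α`,
  -- the bound on `α` is `η²`.
  set η := 1 / (16 * G * K ^ 4 + 1) with hη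
  have hη0 : 0 < η := by positivity
  have hηG : 16 * G * K ^ 4 * η ≤ 1 := by
    rw [hη, mul_one_div, div_le_one (by positivity)]
    linarith
  have hcube : K ≤ K ^ 3 := le_self_pow₀ hK (by norm_num)
  have hCp : 0 < 2 * K ^ 3 + 2 * K ^ 2 + C₁ := by positivity
  refine ⟨ρp, ρm, min ε₀ (min 1 (η ^ 2)), ⟨by positivity, (min_le_left _ _).trans hε₀A⟩,
    2 * K ^ 3 + 2 * K ^ 2 + C₁, hCp, fun α hα => ?_⟩
  set C := 2 * K ^ 3 + 2 * K ^ 2 + C₁ with hC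
  have hK3 : 0 < K ^ 3 := by positivity
  have hK2 : 0 < K ^ 2 := by positivity
  have hKC : K ≤ C := by linarith
  have hC₁C : C₁ ≤ C := by linarith
  have hε1 : min ε₀ (min 1 (η ^ 2)) ≤ 1 := (min_le_right _ _).trans (min_le_left _ _)
  have hαε₀ : α ≤ ε₀ := hα.2.trans (min_le_left _ _)
  have hαη : α ≤ η ^ 2 := hα.2.trans ((min_le_right _ _).trans (min_le_right _ _))
  have hαA : α ∈ Icc 0 A := ⟨hα.1.le, hαε₀.trans hε₀A⟩
  obtain ⟨cp, cm, hwp, hwm, hzp, hzm, hxp, hxm⟩ := hρ α ⟨hα.1, hαε₀⟩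
  set s := Real.sqrt α with hs
  have hs0 : 0 < s := Real.sqrt_pos.mpr hα.1
  have hsη : s ≤ η := (Real.sqrt_le_left hη0.le).mpr hαη
  have hα2 : α ^ (1 / 2 : ℝ) = s := (Real.sqrt_eq_rpow α).symm
  have hα3 : α ^ (3 / 2 : ℝ) = s ^ 3 := by
    rw [← hα2, ← Real.rpow_natCast, ← Real.rpow_mul hα.1.le]
    norm_num
  have hcd := contDiff_slice hg hαA
  have hdf : Differentiable ℝ fun x => g x α := hcd.differentiable (by simp)
  have hσp := hwp.σ_pos
  have hσm := hwm.σ_pos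
  have hneg := action_im hcd.continuous (ρp α).1 (-(ρm α).1)
  rw [neg_neg] at hneg
  have hΛp := hwp.integral_zero_ge
  have hΛm := hwm.integral_zero_ge
  have hΛp' := hwp.integral_zero_le
  have hΛm' := hwm.integral_zero_le
  have hs3 : 0 < s ^ 3 := by positivity
  have hnorm : ∀ ρ, ‖1 / 2 * poisson (symb g α) (symbConj g α) ρ‖ =
      |(deriv (fun x => g x α) ρ.1).im| := fun ρ => by
    rw [poisson_symb_symbConj (hdf _)]
    simp
  have hsKC : s / C ≤ s / K := by gcongr
  have hKsC : K * s ≤ C * s := by gcongr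
  have hroot : (-2 / -β) ^ (1 / 2 : ℝ) = Real.sqrt (2 / β) := by
    rw [neg_div_neg_eq, Real.sqrt_eq_rpow]
  rw [hbr, hroot, hα2, hα3, hneg]
  refine ⟨?_, by linarith, hσm, ?_, ?_, by linarith, hxp.trans ?_, hxm.trans ?_, ?_, ?_, ?_, ?_⟩
  · ext ρ
    rw [Set.mem_ofPred_eq, mem_insert_iff, mem_singleton_iff]
    constructor
    · intro h
      obtain ⟨h1, h2⟩ := (symb_eq_zero_iff ρ).mp h
      obtain ⟨hp1, hp2⟩ := (symb_eq_zero_iff _).mp hzp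
      obtain ⟨hm1, hm2⟩ := (symb_eq_zero_iff _).mp hzm
      rcases (hwp.zero_iff hwm hp1 (by simpa using hm1) ρ.1).mp h1 with e | e
      · exact Or.inl (Prod.ext e (by rw [h2, hp2, e]))
      · rw [neg_neg] at e
        exact Or.inr (Prod.ext e (by rw [h2, hm2, e]))
    · rintro (rfl | rfl)
      · exact hzp
      · exact hzm
  · rw [poissonHalfI_symb_symbConj (hdf _), Complex.ofReal_re]
    exact hσp
  · rw [poissonHalfI_symbConj_symb (hdf _), Complex.ofReal_re]
    exact hσm
  · exact mul_le_mul_of_nonneg_right hKC hα.1.le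
  · exact mul_le_mul_of_nonneg_right hKC hα.1.le
  · have h1 : s ^ 3 / C ≤ s ^ 3 / (2 * K ^ 3) := by
      gcongr
      linarith
    have h2 : 0 < s ^ 3 / (2 * K ^ 3) := by positivity
    linarith
  · have h1 : 2 * K ^ 2 * s ^ 3 ≤ C * s ^ 3 := by
      gcongr
      linarith
    linarith
  · rintro ρ (rfl | rfl)
    · rw [hnorm, abs_of_neg (by linarith)]
      exact ⟨hsKC.trans hwp.le_σ, hwp.σ_le.trans hKsC⟩
    · rw [hnorm, abs_of_pos hσm]
      exact ⟨hsKC.trans hwm.le_σ, hwm.σ_le.trans hKsC⟩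
  · intro h hh hhα
    -- Here the entry `1` in the minimum defining `ε` is used.
    have hhs : h ≤ s ^ 3 := hhα.trans (mul_le_of_le_one_left hs3.le hε1)
    have hmain := hasym hwp hwm (γ := fun x => (gs x α h).im)
      (Complex.continuous_im.comp
        (contDiff_slice (f := fun x α => gs x α h) (hgs h hh) hαA).continuous)
      (fun x => (Complex.abs_im_le_norm _).trans (hγG h hh α hαA x)) hh.1 hhs
      ((mul_le_mul_of_nonneg_left hsη (by positivity)).trans hηG) (hconf α hαA h hh)
      (fun x => by simp [← Complex.ofReal_pow]) (hR α h hαA hh).2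
    rw [← hneg, ← leadingTerm_eq hdf] at hmain
    have hT : 0 < leadingTerm g α h (ρp α) (ρm α) := by
      rw [leadingTerm_eq hdf]
      exact lt_of_lt_of_le (by positivity)
        (le_tunnelTerm hK hs0 hh.1 hhs hσp hσm hwp.σ_le hwm.σ_le)
    set T := leadingTerm g α h (ρp α) (ρm α)
    -- The whole deviation is put into the relative error; the additive one is zero.
    refine ⟨(‖R α h‖ - T) / T, 0, ?_, ?_, ?_⟩
    · rw [abs_div, abs_of_pos hT, div_le_iff₀ hT]
      refine hmain.trans ?_
      have := hh.1
      gcongr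
    · rw [abs_zero]
      have := hh.1
      have := hα.1
      positivity
    · field_simp
      ring
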